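/- **Conventions.** Fix $\tau$ with $\operatorname{Im}\tau>0$, $q=e^{2\pi i\tau}$, and $\theta(x)=2q^{1/8}\sin(\pi x)\prod_{k\ge1}(1-q^k)(1-q^ke^{2\pi ix})(1-q^ke^{-2\pi ix})$. In multiplicative notation put $\vartheta(e^{2\pi ix})=\theta(x)/\theta'(0)$ (a function of the logarithm of its argument) and $\delta(a,b)=\dfrac{\vartheta(ab)}{\vartheta(a)\vartheta(b)}$. For $0\le 2r\le m$ consider meromorphic functions of $x_1,\dots,x_m,u,h,\mu_1,\dots,\mu_r$. The type of $\vartheta(\chi)$, for a character $\chi$, is the quadratic form $\frac12\chi^2$ ($\chi$ written additively), so that $\delta(\chi,\psi)$ has type $\chi\psi$; types add up under products. A sum of products of functions $\delta$ is *pure* if all its summands have the same type. For $1\le i<m$ and a character $\nu$ let $$\mathfrak C_i^{\nu}(f)=\delta\big(\tfrac{x_{i+1}}{x_i},\nu\big)f+\delta\big(\tfrac{x_i}{x_{i+1}},h\big)\,s_if ,$$ where $s_i$ exchanges $x_i$ and $x_{i+1}$; for pure $f$ the parameter $\nu$ is *admissible* if $\mathfrak C_i^\nu(f)$ is pure. **Elliptic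 classes of link patterns.** A labelled link pattern of size $m$ and rank $r$ is a sequence $\mathcal P=((a_1,b_1),\dots,(a_r,b_r))$ of arrows $a_k\mapsto b_k$, where the $2r$ numbers $a_k,b_k\in\{1,\dots,m\}$ are all different. $\mathfrak S_m$ acts on nodes, and $\sigma\in\mathfrak S_r$ acts by $\sigma^\mu$ on labels, and on functions by $\mu_k\mapsto\mu_{\sigma(k)}$. Let $\mathcal P^{\min}_{m,r}$ have the arrows $m-r+k\mapsto k$, and $$\mathcal E\ell\ell(\mathcal P^{\min}_{m,r})=\prod_{i=1}^r\Big(\delta\big(u\tfrac{x_i}{x_{m-r+i}},\mu_i\big)\prod_{j=m-r+i+1}^m\delta\big(u\tfrac{x_i}{x_j},h\big)\Big).$$ For $\mathcal P=\sigma^\mu w\,\mathcal P^{\min}_{m,r}$ with $w\in\mathfrak S_m$ of minimal length among all such presentations, and a reduced word $w=s_{i_1}\cdots s_{i_\ell}$, put $$\mathcal E\ell\ell(\mathcal P)=\sigma^\mu\,\mathfrak C_{i_1}^{\nu_1}\cdots\mathfrak C_{i_\ell}^{\nu_\ell}\,\mathcal E\ell\ell(\mathcal P^{\min}_{m,r})$$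 with all the $\nu_k$ admissible. **Elliptic weight functions.** For $\omega\in\mathfrak S_n$ let $i^{(k)}_1<\dots<i^{(k)}_k$ be the elements of $\{\omega(1),\dots,\omega(k)\}$. For $1\le k<n$ put $j(k,a)=\omega^{-1}(i^{(k)}_a)$, $c(k,a)=1$ if $\omega(k+1)<i^{(k)}_a$ and $c(k,a)=0$ otherwise, $s_{k,a}=h^{1-c(k,a)}\mu_{k+1}/\mu_{j(k,a)}$, and $$\psi_{k,a,b}(x)=\begin{cases}\vartheta(xh)/\vartheta(h)& i^{(k+1)}_b<i^{(k)}_a,\\ \vartheta(x\,s_{k,a})/\vartheta(s_{k,a})& i^{(k+1)}_b=i^{(k)}_a,\\ \vartheta(x)& i^{(k+1)}_b>i^{(k)}_a,\end{cases}$$ $$U_\omega=\prod_{k=1}^{n-1}\prod_{a=1}^k\Big(\prod_{b=1}^{k+1}\psi_{k,a,b}\big(t^{(k+1)}_b/t^{(k)}_a\big)\prod_{b=a+1}^k\delta\big(t^{(k)}_b/t^{(k)}_a,h\big)\Big).$$ With $\mathrm{Sym}_{t^{(k)}}$ the sum over all permutations of $t^{(k)}_1,\dots,t^{(k)}_k$,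 the elliptic weight function $\widehat{\mathbf w}_\omega(z,\gamma,\mu,h)$ is $$\frac{\mathrm{Sym}_{t^{(1)}}\cdots\mathrm{Sym}_{t^{(n-1)}}U_\omega}{\prod_{k=1}^{n-1}\prod_{1\le a\neq b\le k}\vartheta\big(h\,t^{(k)}_a/t^{(k)}_b\big)/\vartheta(h)}\quad\text{at } t^{(n)}=(z_1,\dots,z_n),\ t^{(k)}=(\gamma_1,\dots,\gamma_k)\ (k<n).$$ **Statement.** Let $n\ge1$, $m=2n-1$, $r=n-1$, and let $\mathcal P$ be a labelled link pattern all of whose arrows have their sources in the last $n-1$ nodes. Let $\omega\in\mathfrak S_n$ be the permutation such that $\mathcal P$ consists of the arrows $n+j\mapsto\omega(j)$, $1\le j\le n-1$. Put $u=1$, $x_i=z_i$ for $i\le n$, $x_{n+j}=\gamma_j$ for $j\le n-1$, and $$eu_{M'}=\prod_{i=1}^n\prod_{j=1}^{n-1}\vartheta\big(\tfrac{z_i}{\gamma_j}\big),\qquad \mathcal B'=\prod_{1\le i<j\le n-1}\frac{\vartheta\big(\tfrac{\gamma_i}{\gamma_j}h\big)}{\vartheta(h)} .$$ Substitute $h\mu_n/\mu_j$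 for the $\mu$-variable attached to the arrow with source $n+j$; that is, $\mu_j:=h\mu_n/\mu_j$ for $1\le j<n$ if this arrow has label $j$. Then $\mathcal E\ell\ell(\mathcal P)$ exists, and for every choice of $\sigma$, $w$ and of the reduced word in its definition $$\frac{\mathcal E\ell\ell(\mathcal P)\cdot eu_{M'}}{\mathcal B'}=\widehat{\mathbf w}_\omega(z,\gamma,\mu,h),$$ at all points at which $\vartheta(h)$, $\vartheta(z_i/\gamma_j)$, $\vartheta(z_i/z_j)$, $\vartheta(\gamma_i/\gamma_j)$, $\vartheta(h\gamma_i/\gamma_j)$ (for $i\ne j$ in the last three) and $\vartheta(\mu_j/\mu_i)$, $\vartheta(h\mu_j/\mu_i)$ (for $i<j$) do not vanish; in particular as meromorphic functions. -/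

import Mathlib

open scoped BigOperators Matrix

noncomputable section

namespace EllipticLink

/-! ## Theta functions

All variables are written additively: a multiplicative variable `a` is represented by a complex
number `x` with `a = exp (2 π i x)`, so that products of variables become sums. -/

/-- The Jacobi theta function
`2 q^(1/8) sin (π x) ∏_{n ≥ 1} (1 - q^n) (1 - q^n e^(2πix)) (1 - q^n e^(-2πix))`,
where `q = e^(2πiτ)`. -/
def theta (τ x : ℂ) : ℂ :=
  2 * Complex.exp (2 * Real.pi * Complex.I * τ / 8) * Complex.sin (Real.pi * x) *
    ∏' n : ℕ,
      ((1 - Complex.exp (2 * Real.pi * Complex.I * τ) ^ (n + 1)) *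
        (1 - Complex.exp (2 * Real.pi * Complex.I * τ) ^ (n + 1) *
          Complex.exp (2 * Real.pi * Complex.I * x)) *
        (1 - Complex.exp (2 * Real.pi * Complex.I * τ) ^ (n + 1) /
          Complex.exp (2 * Real.pi * Complex.I * x)))

/-- The theta function normalised to have derivative `1` at the origin. -/
def vtheta (τ x : ℂ) : ℂ := theta τ x / deriv (theta τ) 0

/-- The function `δ(e^(2πix), e^(2πiy)) = F_τ(x, y) = θ'(0) θ(x + y) / (θ(x) θ(y))`. -/
def delta (τ x y : ℂ) : ℂ :=
  deriv (theta τ) 0 * theta τ (x + y) / (theta τ x * theta τ y)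

theorem delta_eq_vtheta (τ x y : ℂ) :
    delta τ x y = vtheta τ (x + y) / (vtheta τ x * vtheta τ y) := by
  unfold delta vtheta
  by_cases hd : deriv (theta τ) 0 = 0
  · simp [hd]
  by_cases hx : theta τ x = 0
  · simp [hx]
  by_cases hy : theta τ y = 0
  · simp [hy]
  field_simp

/-! ## Variables and characters -/

/-- The variables `x_1, …, x_m, u, h, μ_1, …, μ_r` (indices start at `0`). -/
inductive Var (m r : ℕ) where
  | x (i : Fin m)
  | u
  | h
  | mu (k : Fin r)
  deriving DecidableEq, Fintype

/-- A character, i.e. a Laurent monomial in the variables, given by its exponents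
(equivalently, an integral linear form in the logarithms of the variables). -/
abbrev Character (m r : ℕ) := Var m r → ℤ

/-- A point of the space of logarithms of the variables. -/
abbrev Point (m r : ℕ) := Var m r → ℂ

variable {m r : ℕ}

/-- A single variable as a character. -/
def char (v : Var m r) : Character m r := Pi.single v 1

/-- The value of a character at a point. -/
def Character.eval (χ : Character m r) (p : Point m r) : ℂ := ∑ v, (χ v : ℂ) * p v

/-- The simple transposition of the positions `i` and `i + 1`. -/
def simple (i : Fin (m - 1)) : Equiv.Perm (Fin m) :=
  Equiv.swap ⟨i, by omega⟩ ⟨i + 1, by omega⟩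

/-- The variable `x_i`. -/
def xL (i : Fin (m - 1)) : Var m r := Var.x ⟨i, by omega⟩

/-- The variable `x_{i+1}`. -/
def xR (i : Fin (m - 1)) : Var m r := Var.x ⟨i + 1, by omega⟩

/-- A permutation of `{1, …, m}` acting on the `x`-variables only. -/
def permX (w : Equiv.Perm (Fin m)) : Var m r → Var m r
  | .x i => .x (w i)
  | v => v

/-- A permutation of `{1, …, r}` acting on the `μ`-variables only. -/
def permMu (σ : Equiv.Perm (Fin r)) : Var m r → Var m r
  | .mu k => .mu (σ k)
  | v => v

/-! ## Combinations of products of `δ`-functions, their types, and purity -/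

/-- A formal product of factors `δ(χ, ψ)`. -/
abbrev Term (m r : ℕ) := List (Character m r × Character m r)

/-- A formal sum of products of factors `δ(χ, ψ)`. -/
abbrev Combination (m r : ℕ) := List (Term m r)

/-- The meromorphic function given by a combination of products of `δ`-functions. -/
def Combination.eval (τ : ℂ) (F : Combination m r) (p : Point m r) : ℂ :=
  (F.map fun t => (t.map fun c => delta τ (c.1.eval p) (c.2.eval p)).prod).sum

/-- The type of `θ(χ)` is the quadratic form `χ² / 2`. Quadratic forms are recorded by
their (integral, symmetric) Gram matrices. -/
def thetaType (χ : Character m r) : Matrix (Var m r) (Var m r) ℤ := Matrix.vecMulVec χ χ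

/-- The type of `δ(χ, ψ) = ϑ(χψ) / (ϑ(χ) ϑ(ψ))`. -/
def deltaType (χ ψ : Character m r) : Matrix (Var m r) (Var m r) ℤ :=
  thetaType (χ + ψ) - thetaType χ - thetaType ψ

/-- The type of a product is the sum of the types of its factors. -/
def Term.type (t : Term m r) : Matrix (Var m r) (Var m r) ℤ :=
  (t.map fun c => deltaType c.1 c.2).sum

/-- A combination is pure if all its summands have the same type. -/
def Combination.IsPure (F : Combination m r) : Prop :=
  ∃ Q : Matrix (Var m r) (Var m r) ℤ, ∀ t ∈ F, Term.type t = Q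

/-! ## Elliptic Demazure operations -/

/-- The elliptic Demazure operation on functions, with parameter the character `ν`:
`δ(x_{i+1} / x_i, ν) f + δ(x_i / x_{i+1}, h) s_i f`. -/
def demazureFun (τ : ℂ) (i : Fin (m - 1)) (ν : Character m r) (f : Point m r → ℂ)
    (p : Point m r) : ℂ :=
  delta τ (p (xR i) - p (xL i)) (ν.eval p) * f p +
    delta τ (p (xL i) - p (xR i)) (p .h) * f (fun v => p (permX (simple i) v))

/-- The simple transposition `s_i` applied to a formal product. -/
def Term.reflect (i : Fin (m - 1)) (t : Term m r) : Term m r :=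
  t.map fun c => (fun v => c.1 (permX (simple i) v), fun v => c.2 (permX (simple i) v))

/-- The elliptic Demazure operation on combinations of products of `δ`-functions. -/
def demazure (i : Fin (m - 1)) (ν : Character m r) (F : Combination m r) : Combination m r :=
  F.map (fun t => (char (xR i) - char (xL i), ν) :: t) ++
    F.map (fun t => (char (xL i) - char (xR i), char .h) :: Term.reflect i t)

theorem eval_char (v : Var m r) (p : Point m r) : (char v).eval p = p v := by
  simp [Character.eval, char, Pi.single_apply]

theorem eval_sub (χ ψ : Character m r) (p : Point m r) :
    Character.eval (χ - ψ) p = χ.eval p - ψ.eval p := by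
  simp [Character.eval, sub_mul, Finset.sum_sub_distrib]

theorem permX_simple_invol (i : Fin (m - 1)) :
    Function.Involutive (permX (r := r) (simple (m := m) i)) := by
  intro v
  cases v <;> simp [permX, simple]

theorem eval_reflect (i : Fin (m - 1)) (χ : Character m r) (p : Point m r) :
    Character.eval (fun v => χ (permX (simple i) v)) p =
      χ.eval (fun v => p (permX (simple i) v)) := by
  unfold Character.eval
  refine Fintype.sum_equiv (permX_simple_invol i).toPerm _ _ fun v => ?_
  simp [Function.Involutive.coe_toPerm, permX_simple_invol i v]

/-- The formal operation realises the operation on functions. -/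
theorem eval_demazure (τ : ℂ) (i : Fin (m - 1)) (ν : Character m r) (F : Combination m r) :
    (demazure i ν F).eval τ = demazureFun τ i ν (F.eval τ) := by
  funext p
  simp [demazure, Combination.eval, demazureFun, Term.reflect, eval_sub, eval_char,
    List.sum_map_mul_left, Function.comp_def, eval_reflect]

/-- `Diamond F₀ [i₁, …, i_ℓ] F` says that `F` is the composition
`C_{i₁}^{ν₁} ⋯ C_{i_ℓ}^{ν_ℓ} F₀` of elliptic Demazure operations in which every parameter
`ν_k` is admissible, i.e. every operation produces a pure combination. -/
inductive Diamond (F₀ : Combination m r) : List (Fin (m - 1)) → Combination m r → Prop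
  | nil : Diamond F₀ [] F₀
  | cons {L : List (Fin (m - 1))} {F : Combination m r} (i : Fin (m - 1)) (ν : Character m r) :
      Diamond F₀ L F → (demazure i ν F).IsPure → Diamond F₀ (i :: L) (demazure i ν F)

/-! ## Labelled link patterns and their elliptic classes -/

/-- A labelled link pattern of size `m` and rank `r`: a sequence of `r` arrows
`source k ↦ target k` between nodes `1, …, m`, all `2r` end points being different. -/
@[ext]
structure LinkPattern (m r : ℕ) where
  source : Fin r → Fin m
  target : Fin r → Fin m
  injective : Function.Injective (Sum.elim source target)

/-- The minimal pattern, with arrows `m - r + k ↦ k` for `k = 1, …, r`. -/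
def minPattern (hr : 2 * r ≤ m) : LinkPattern m r where
  source k := ⟨m - r + k, by omega⟩
  target k := ⟨k, by omega⟩
  injective := by
    rintro (a | a) (b | b) hab <;> simp [Fin.ext_iff] at hab ⊢ <;> omega

/-- The action of `S_r` (on labels) and `S_m` (on nodes) on labelled link patterns. -/
def LinkPattern.act (σ : Equiv.Perm (Fin r)) (w : Equiv.Perm (Fin m)) (P : LinkPattern m r) :
    LinkPattern m r where
  source k := w (P.source (σ.symm k))
  target k := w (P.target (σ.symm k))
  injective := by
    have h : Sum.elim (fun k => w (P.source (σ.symm k))) (fun k => w (P.target (σ.symm k))) =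
        w ∘ Sum.elim P.source P.target ∘ Sum.map σ.symm σ.symm := by
      funext k; cases k <;> rfl
    rw [h]
    exact w.injective.comp (P.injective.comp
      (Sum.map_injective.2 ⟨Equiv.injective _, Equiv.injective _⟩))

/-- The elliptic class of the minimal pattern:
`∏_i ( δ(u x_i / x_{m-r+i}, μ_i) ∏_{j > i} δ(u x_i / x_{m-r+j}, h) )`. -/
def minClass (hr : 2 * r ≤ m) : Combination m r :=
  [(List.finRange r).flatMap fun i =>
    (char .u + char (.x ((minPattern hr).target i)) - char (.x ((minPattern hr).source i)),
        char (.mu i)) ::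
      ((List.finRange r).filter fun j => i < j).map fun j =>
        (char .u + char (.x ((minPattern hr).target i)) - char (.x ((minPattern hr).source j)),
          char .h)]

/-- `P = σ^μ w P_min`, where `w = s_{i₁} ⋯ s_{i_ℓ}` is given by a word. -/
def Presents (hr : 2 * r ≤ m) (σ : Equiv.Perm (Fin r)) (L : List (Fin (m - 1)))
    (P : LinkPattern m r) : Prop :=
  P = (minPattern hr).act σ (L.map simple).prod

/-- The function `f` is the elliptic class `Ell(P)`, i.e. `f = σ^μ C_w^⋄ Ell(P_min)` for
some presentation `P = σ^μ w P_min` with `w` of minimal length among all such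
presentations, and some reduced word of `w`. (A word of minimal length among
all the words presenting `P` is the same as a reduced word of a permutation of minimal
length presenting `P`.) -/
def IsEllipticClass (τ : ℂ) (hr : 2 * r ≤ m) (P : LinkPattern m r)
    (f : Point m r → ℂ) : Prop :=
  ∃ (σ : Equiv.Perm (Fin r)) (L : List (Fin (m - 1))) (F : Combination m r),
    Presents hr σ L P ∧
    (∀ σ' L', Presents hr σ' L' P → L.length ≤ L'.length) ∧
    Diamond (minClass hr) L F ∧
    f = fun p => F.eval τ (fun v => p (permMu σ v))

/-! ## The elliptic weight function -/

/-- The set `{ω(1), …, ω(k)}`. -/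
def firstValues {n : ℕ} (ω : Equiv.Perm (Fin n)) (k : ℕ) : Finset (Fin n) :=
  (Finset.univ.filter fun j : Fin n => (j : ℕ) < k).map ω.toEmbedding

theorem card_firstValues {n : ℕ} (ω : Equiv.Perm (Fin n)) {k : ℕ} (hk : k ≤ n) :
    (firstValues ω k).card = k := by
  rw [firstValues, Finset.card_map, Fin.card_filter_val_lt]
  omega

/-- The elements `i_1^{(k)} < … < i_k^{(k)}` of `{ω(1), …, ω(k)}` in increasing order. -/
def sortedValue {n : ℕ} (ω : Equiv.Perm (Fin n)) {k : ℕ} (hk : k ≤ n) (a : Fin k) : Fin n :=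
  (firstValues ω k).orderEmbOfFin (card_firstValues ω hk) a

/-- The exponent `h^{1 - c} μ_{k+1} / μ_j`, where `ω(j) = i_a^{(k)}` and `c` is `1` if
`ω(k+1) < i_a^{(k)}` and `0` otherwise. (In zero-based indexing the index of `μ_{k+1}` and the
argument of `ω(k+1)` is `k`.) -/
def dynParam {n : ℕ} (h : ℂ) (μ : Fin n → ℂ) (ω : Equiv.Perm (Fin n)) (k : ℕ) (hk : k < n)
    (a : Fin k) : ℂ :=
  (if ω ⟨k, hk⟩ < sortedValue ω hk.le a then 0 else h) + μ ⟨k, hk⟩ -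
    μ (ω.symm (sortedValue ω hk.le a))

/-- The factor `ψ_{ω,k,a,b}(x)`: it is `ϑ(x h) / ϑ(h)`, `ϑ(x s) / ϑ(s)` with `s` the dynamical
parameter, or `ϑ(x)`, according to whether `i_b^{(k+1)}` is smaller than, equal to, or
larger than `i_a^{(k)}`. -/
def psi {n : ℕ} (τ h : ℂ) (μ : Fin n → ℂ) (ω : Equiv.Perm (Fin n)) (k : ℕ) (hk : k < n)
    (a : Fin k) (b : Fin (k + 1)) (x : ℂ) : ℂ :=
  if sortedValue ω (Nat.succ_le_of_lt hk) b < sortedValue ω hk.le a then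
    vtheta τ (x + h) / vtheta τ h
  else if sortedValue ω (Nat.succ_le_of_lt hk) b = sortedValue ω hk.le a then
    vtheta τ (x + dynParam h μ ω k hk a) / vtheta τ (dynParam h μ ω k hk a)
  else vtheta τ x

/-- The function `U_ω` of the variables `t k a = t^{(k)}_a`, `1 ≤ a ≤ k ≤ n`. -/
def weightU {n : ℕ} (τ h : ℂ) (μ : Fin n → ℂ) (ω : Equiv.Perm (Fin n))
    (t : (k : ℕ) → Fin k → ℂ) : ℂ :=
  ∏ k : Fin n, ∏ a : Fin k,
    ((∏ b : Fin (k + 1), psi τ h μ ω k k.2 a b (t (k + 1) b - t k a)) *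
      ∏ b : Fin k, if a < b then delta τ (t k b - t k a) h else 1)

/-- Permuting, for every `k < n`, the variables `t^{(k)}_1, …, t^{(k)}_k`. -/
def permuteT {n : ℕ} (s : (k : Fin n) → Equiv.Perm (Fin k)) (t : (k : ℕ) → Fin k → ℂ) :
    (k : ℕ) → Fin k → ℂ :=
  fun k a => if hk : k < n then t k (s ⟨k, hk⟩ a) else t k a

/-- The normalised elliptic weight function
`(Sym_{t^{(1)}} ⋯ Sym_{t^{(n-1)}} U_ω) / ∏_{k<n} ∏_{a ≠ b ≤ k} (ϑ(h t^{(k)}_a / t^{(k)}_b) / ϑ(h))`. -/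
def weightT {n : ℕ} (τ h : ℂ) (μ : Fin n → ℂ) (ω : Equiv.Perm (Fin n))
    (t : (k : ℕ) → Fin k → ℂ) : ℂ :=
  (∑ s : (k : Fin n) → Equiv.Perm (Fin k), weightU τ h μ ω (permuteT s t)) /
    ∏ k : Fin n, ∏ a : Fin k, ∏ b : Fin k,
      if a ≠ b then vtheta τ (h + t k a - t k b) / vtheta τ h else 1

/-- The elliptic weight function `ŵ_ω(z, γ, μ, h)` of the full flag variety of `ℂ^n`, `n = r + 1`:
the normalised weight function at `t^{(n)} = z` and `t^{(k)} = (γ_1, …, γ_k)` for `k < n`. -/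
def weightFunction (τ h : ℂ) (z : Fin (r + 1) → ℂ) (γ : Fin r → ℂ) (μ : Fin (r + 1) → ℂ)
    (ω : Equiv.Perm (Fin (r + 1))) : ℂ :=
  weightT τ h μ ω fun k a =>
    if hk : k ≤ r then γ ⟨a, by omega⟩ else if hk' : k = r + 1 then z ⟨a, by omega⟩ else 0

/-! ## The quotient attached to a link pattern in the `n × (n - 1)` rectangle, `n = r + 1` -/

/-- For a pattern of size `2n - 1` and rank `n - 1` whose arrows start in the last `n - 1` nodes:
the index `j` such that the arrow with label `k` starts at the node `n + j`. -/
def sourceIndex (P : LinkPattern (2 * r + 1) r) (hP : ∀ k, r + 1 ≤ (P.source k : ℕ))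
    (k : Fin r) : Fin r :=
  ⟨P.source k - (r + 1), by have := hP k; omega⟩

/-- The point with `x = (z_1, …, z_n, γ_1, …, γ_{n-1})`, `u = 1`, and the `μ`-variable of
the arrow starting at the node `n + j` equal to `h μ_n / μ_j`. -/
def substitution (h : ℂ) (z : Fin (r + 1) → ℂ) (γ : Fin r → ℂ) (μ : Fin (r + 1) → ℂ)
    (P : LinkPattern (2 * r + 1) r) (hP : ∀ k, r + 1 ≤ (P.source k : ℕ)) :
    Point (2 * r + 1) r
  | .x i => if hi : (i : ℕ) < r + 1 then z ⟨i, hi⟩ else γ ⟨i - (r + 1), by omega⟩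
  | .u => 0
  | .h => h
  | .mu k => h + μ (Fin.last r) - μ (sourceIndex P hP k).castSucc

/-- The elliptic Euler class `∏_{i ≤ n} ∏_{j ≤ n-1} ϑ(z_i / γ_j)`. -/
def eulerM (τ : ℂ) (z : Fin (r + 1) → ℂ) (γ : Fin r → ℂ) : ℂ :=
  ∏ i : Fin (r + 1), ∏ j : Fin r, vtheta τ (z i - γ j)

/-- The elliptic Chern class `∏_{1 ≤ i < j ≤ n-1} ϑ(γ_i h / γ_j) / ϑ(h)`. -/
def chernB (τ h : ℂ) (γ : Fin r → ℂ) : ℂ :=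
  ∏ i : Fin r, ∏ j : Fin r,
    if i < j then vtheta τ (γ i - γ j + h) / vtheta τ h else 1

end EllipticLink

end

open EllipticLink

/-! Both sides satisfy the same recursion under the exchange of `z_i` and `z_{i+1}`, with the same
initial value at the minimal pattern, that is, at `ω = 1`.

Classes. Along a word, all summands have a common type of the shape `patternType`, described by one
weight for each node. Purity forces the parameter of a Demazure operation to be the difference of
the weights of the nodes `i` and `i + 1`, and the operation then merely exchanges these two weights
(`demazure_isPure_iff`, `Diamond.eval_eq`). So admissible parameters exist and are unique, and the
class is the explicit function `wordEval`. If all sources lie in the last `n - 1` nodes, a word of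
minimal length never mixes the two blocks of nodes (`ne_of_mem_of_ascending`). A letter moving
sources can be traded for one moving targets, at the cost of a relabelling of the arrows
(`wordStep_highLetter`, `exists_lowEmb_word`). What remains is a word acting on `z` alone, each
letter of which creates an inversion. After the substitution of the `μ`-variables, the weights of
the first `n` nodes are `-μ_j` up to a common summand, so the parameters are quotients of two
variables `μ_j`.

Weight functions. `weightFunction_swap` is the same operation with the same parameter. It is proved
by induction on the levels: at the first level containing both positions whose values are exchanged,
the recursion is a theta identity in two cells (`levelFactor_swap_eq`), and `levelFactor_exchange`
carries the operation from the variables of one level to those of the next. For `ω = 1`, the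
specialisation `t^{(k)} = (γ_1, …, γ_k)` makes every nontrivial permutation in the symmetrisation
contribute a factor `ϑ(1) = 0`. The surviving term is the minimal class times the Euler class over
the Chern class (`weightFunction_one`, `minFun_mul_eulerM`).

All theta identities reduce to Weierstrass' three-term relation `vtheta_three_term`. One
consequence, `delta_exchange`, drives both the trade of sources for targets and the passage between
levels. The three-term relation is read off from the theta series, and Jacobi's triple product is
needed because `theta` is defined as a product. -/

noncomputable section
namespace EllipticLink

/-! ## Jacobi's triple product -/

/-- Gaussian binomial coefficients. -/
def gaussBinom (q : ℂ) : ℕ → ℕ → ℂ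
  | _, 0 => 1
  | 0, _ + 1 => 0
  | M + 1, k + 1 => gaussBinom q M k + q ^ (k + 1) * gaussBinom q M (k + 1)

/-- The finite `q`-Pochhammer symbol `∏_{i ≤ N} (1 - q^i)`. -/
def qPoch (q : ℂ) (N : ℕ) : ℂ := ∏ i ∈ Finset.range N, (1 - q ^ (i + 1))

theorem gaussBinom_zero_right (q : ℂ) (M : ℕ) : gaussBinom q M 0 = 1 := by
  cases M <;> rfl

theorem gaussBinom_eq_zero (q : ℂ) {M k : ℕ} (h : M < k) : gaussBinom q M k = 0 := by
  induction M generalizing k with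
  | zero => obtain ⟨k, rfl⟩ := Nat.exists_eq_succ_of_ne_zero h.ne'; rfl
  | succ M ih =>
    obtain ⟨k, rfl⟩ := Nat.exists_eq_succ_of_ne_zero (Nat.ne_zero_of_lt h)
    rw [gaussBinom, ih (by omega), ih (by omega)]; ring

/-- The quotient formula for Gaussian binomials without division, so that it also holds at roots of
unity. -/
theorem gaussBinom_mul_qPoch (q : ℂ) (a b : ℕ) :
    gaussBinom q (a + b) a * (qPoch q a * qPoch q b) = qPoch q (a + b) := by
  induction hn : a + b generalizing a b with
  | zero =>
    obtain ⟨rfl, rfl⟩ : a = 0 ∧ b = 0 := by omega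
    simp [gaussBinom, qPoch]
  | succ n ih =>
    cases a with
    | zero =>
      obtain rfl : b = n + 1 := by omega
      simp [gaussBinom, qPoch]
    | succ a =>
      cases b with
      | zero =>
        obtain rfl : a = n := by omega
        have := ih a 0 rfl
        rw [gaussBinom, gaussBinom_eq_zero q (Nat.lt_succ_self a)]
        simp only [qPoch, Finset.prod_range_succ, Finset.prod_range_zero] at this ⊢
        linear_combination (1 - q ^ (a + 1)) * this
      | succ b =>
        have h1 := ih a (b + 1) (by omega)
        have h2 := ih (a + 1) b (by omega)
        have e : n = a + b + 1 := by omega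
        subst e
        rw [gaussBinom]
        have p1 : ∀ k, qPoch q (k + 1) = qPoch q k * (1 - q ^ (k + 1)) := fun k => by
          simp [qPoch, Finset.prod_range_succ]
        rw [p1 (a + b + 1), p1 a, p1 b]
        rw [p1 b] at h1
        rw [p1 a] at h2
        -- This is `1 - q^(a+b+2) = (1 - q^(a+1)) + q^(a+1) (1 - q^(b+1))`.
        linear_combination (1 - q ^ (a + 1)) * h1 + q ^ (a + 1) * (1 - q ^ (b + 1)) * h2

/-- The finite `q`-binomial theorem with `q = p^2`. The induction splits off the factor `j = 0`; the
other factors are the product for `M` at `y p^2`, which matches the recursion defining `gaussBinom`.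
-/
theorem prod_one_add_eq_sum_gaussBinom (p y : ℂ) (M : ℕ) :
    ∏ j ∈ Finset.range M, (1 + y * p ^ (2 * j + 1)) =
      ∑ k ∈ Finset.range (M + 1), p ^ (k ^ 2) * gaussBinom (p ^ 2) M k * y ^ k := by
  induction M generalizing y with
  | zero => simp [gaussBinom]
  | succ M ih =>
    rw [Finset.prod_range_succ']
    have : ∀ j, 1 + y * p ^ (2 * (j + 1) + 1) = 1 + (y * p ^ 2) * p ^ (2 * j + 1) := fun j => by
      ring
    simp only [this]
    rw [ih, Finset.sum_range_succ' _ (M + 1)]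
    simp only [gaussBinom]
    have e1 : ∑ k ∈ Finset.range (M + 1), p ^ (k ^ 2) * gaussBinom (p ^ 2) M k * (y * p ^ 2) ^ k
        = 1 + ∑ k ∈ Finset.range (M + 1), p ^ ((k + 1) ^ 2) *
          ((p ^ 2) ^ (k + 1) * gaussBinom (p ^ 2) M (k + 1)) * y ^ (k + 1) := by
      rw [Finset.sum_range_succ', Finset.sum_range_succ _ M,
        gaussBinom_eq_zero _ (Nat.lt_succ_self M), gaussBinom_zero_right]
      simp only [mul_zero, zero_mul, add_zero]
      rw [add_comm]
      congr 1
      · simp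
      · exact Finset.sum_congr rfl fun k _ => by ring
    have e2 : (∑ k ∈ Finset.range (M + 1), p ^ (k ^ 2) * gaussBinom (p ^ 2) M k *
        (y * p ^ 2) ^ k) * (y * p) =
        ∑ k ∈ Finset.range (M + 1), p ^ ((k + 1) ^ 2) * gaussBinom (p ^ 2) M k * y ^ (k + 1) := by
      rw [Finset.sum_mul]
      exact Finset.sum_congr rfl fun k _ => by ring
    simp only [mul_add, add_mul, Finset.sum_add_distrib]
    simp only [mul_zero, zero_add, pow_one, mul_one]
    rw [e2, e1]
    simp
    ring

/-- The finite triple product: the `q`-binomial theorem with `2N` factors at `y = z p^(-2N)`. The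
last `N` factors are those in `z`; each of the first `N`, in reverse order, becomes a factor in
`z⁻¹` once `z p^(-(2j+1))` is taken out, which gives `z^N p^(-N^2)` in all. -/
theorem prod_eq_sum_gaussBinom {p z : ℂ} (hp : p ≠ 0) (hz : z ≠ 0) (N : ℕ) :
    ∏ j ∈ Finset.range N, ((1 + z * p ^ (2 * j + 1)) * (1 + z⁻¹ * p ^ (2 * j + 1))) =
      ∑ k ∈ Finset.range (2 * N + 1), p ^ (((k : ℤ) - N) ^ 2).toNat *
        gaussBinom (p ^ 2) (2 * N) k * z ^ ((k : ℤ) - N) := by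
  have key := prod_one_add_eq_sum_gaussBinom p (z * (p ^ (2 * N))⁻¹) (2 * N)
  have h1 : ∏ j ∈ Finset.range (2 * N), (1 + z * (p ^ (2 * N))⁻¹ * p ^ (2 * j + 1)) =
      z ^ N * (p ^ (N ^ 2))⁻¹ *
        ∏ j ∈ Finset.range N, ((1 + z * p ^ (2 * j + 1)) * (1 + z⁻¹ * p ^ (2 * j + 1))) := by
    rw [two_mul, Finset.prod_range_add, Finset.prod_mul_distrib, ← Finset.prod_range_reflect]
    have a1 : ∏ j ∈ Finset.range N, (1 + z * (p ^ (N + N))⁻¹ * p ^ (2 * (N - 1 - j) + 1)) =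
        ∏ j ∈ Finset.range N, (z * (p ^ (2 * j + 1))⁻¹ * (1 + z⁻¹ * p ^ (2 * j + 1))) := by
      refine Finset.prod_congr rfl fun j hj => ?_
      have hj := Finset.mem_range.1 hj
      have : N + N = (2 * (N - 1 - j) + 1) + (2 * j + 1) := by omega
      rw [this, pow_add]
      field_simp
      ring
    have a2 : ∏ j ∈ Finset.range N, (1 + z * (p ^ (N + N))⁻¹ * p ^ (2 * (N + j) + 1)) =
        ∏ j ∈ Finset.range N, (1 + z * p ^ (2 * j + 1)) := by
      refine Finset.prod_congr rfl fun j hj => ?_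
      have : 2 * (N + j) + 1 = (N + N) + (2 * j + 1) := by ring
      rw [this, pow_add p (N + N), mul_assoc z, inv_mul_cancel_left₀ (pow_ne_zero _ hp)]
    have a3 : ∏ j ∈ Finset.range N, (z * (p ^ (2 * j + 1))⁻¹) = z ^ N * (p ^ (N ^ 2))⁻¹ := by
      rw [Finset.prod_mul_distrib, Finset.prod_inv_distrib, Finset.prod_const, Finset.card_range,
        Finset.prod_pow_eq_pow_sum]
      congr 3
      clear * -
      induction N with
      | zero => rfl
      | succ N ih => rw [Finset.sum_range_succ, ih]; ring
    rw [a1, a2, Finset.prod_mul_distrib, a3]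
    ring
  rw [h1] at key
  have hc : z ^ N * (p ^ (N ^ 2))⁻¹ ≠ 0 := mul_ne_zero (pow_ne_zero _ hz) (inv_ne_zero
    (pow_ne_zero _ hp))
  apply mul_left_cancel₀ hc
  rw [key, Finset.mul_sum]
  refine Finset.sum_congr rfl fun k _ => ?_
  have hk : p ^ (((k : ℤ) - N) ^ 2).toNat * p ^ (2 * N * k) = p ^ (N ^ 2) * p ^ (k ^ 2) := by
    rw [← pow_add, ← pow_add]
    congr 1
    have := Int.toNat_of_nonneg (sq_nonneg ((k : ℤ) - N))
    zify
    rw [this]; ring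
  have hz' : z ^ N * z ^ ((k : ℤ) - N) = z ^ k := by
    rw [← zpow_natCast z N, ← zpow_add₀ hz, ← zpow_natCast z k]; congr 1; ring
  rw [mul_pow, inv_pow, ← pow_mul]
  rw [← hz']
  have hp1 := pow_ne_zero (2 * N * k) hp
  have hp2 := pow_ne_zero (N ^ 2) hp
  field_simp
  linear_combination (-gaussBinom (p ^ 2) (2 * N) k) * hk

end EllipticLink
end

/-! ### Limit of the finite triple product. -/

noncomputable section
namespace EllipticLink
open Filter Topology Complex

theorem tendsto_qPoch {q : ℂ} (hq : ‖q‖ < 1) :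
    ∃ Φ : ℂ, Φ ≠ 0 ∧ Tendsto (qPoch q) atTop (𝓝 Φ) := by
  have hs : Summable fun n : ℕ => ‖-q ^ (n + 1)‖ := by
    simp only [norm_neg, norm_pow]
    exact (summable_nat_add_iff 1).2 (summable_geometric_of_lt_one (norm_nonneg _) hq)
  refine ⟨∏' n : ℕ, (1 + -q ^ (n + 1)), ?_, ?_⟩
  · refine tprod_one_add_ne_zero_of_summable (fun n h => ?_) hs
    have : ‖q ^ (n + 1)‖ = 1 := by
      rw [show q ^ (n + 1) = 1 by linear_combination -h, norm_one]
    rw [norm_pow] at this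
    exact (pow_lt_one₀ (norm_nonneg _) hq (Nat.succ_ne_zero n)).ne this
  · have := (multipliable_one_add_of_summable hs).hasProd.tendsto_prod_nat
    refine this.congr fun N => ?_
    simp [qPoch, sub_eq_add_neg]

theorem qPoch_ne_zero {q : ℂ} (hq : ‖q‖ < 1) (N : ℕ) : qPoch q N ≠ 0 := by
  refine Finset.prod_ne_zero_iff.2 fun n _ h => ?_
  have : ‖q ^ (n + 1)‖ = 1 := by rw [show q ^ (n + 1) = 1 by linear_combination -h, norm_one]
  rw [norm_pow] at this
  exact (pow_lt_one₀ (norm_nonneg _) hq (Nat.succ_ne_zero n)).ne this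

/-- A bound independent of both indices, which provides the dominating series for `N → ∞`. The
symbols `qPoch q N` converge to a nonzero limit, so they and their inverses are bounded. -/
theorem norm_gaussBinom_le {q : ℂ} (hq : ‖q‖ < 1) :
    ∃ K : ℝ, ∀ M k, ‖gaussBinom q M k‖ ≤ K := by
  obtain ⟨Φ, hΦ, hlim⟩ := tendsto_qPoch hq
  obtain ⟨C, hC⟩ := hlim.norm.bddAbove_range
  obtain ⟨D, hD⟩ := (hlim.inv₀ hΦ).norm.bddAbove_range
  have hC' : ∀ n, ‖qPoch q n‖ ≤ C := fun n => hC ⟨n, rfl⟩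
  have hD' : ∀ n, ‖(qPoch q n)⁻¹‖ ≤ D := fun n => hD ⟨n, rfl⟩
  have hC0 : 0 ≤ C := (norm_nonneg _).trans (hC' 0)
  have hD0 : 0 ≤ D := (norm_nonneg _).trans (hD' 0)
  refine ⟨C * (D * D), fun M k => ?_⟩
  by_cases h : k ≤ M
  · obtain ⟨b, rfl⟩ := Nat.exists_eq_add_of_le h
    have e : gaussBinom q (k + b) k = qPoch q (k + b) * ((qPoch q k)⁻¹ * (qPoch q b)⁻¹) := by
      rw [← gaussBinom_mul_qPoch q k b]
      have := qPoch_ne_zero hq k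
      have := qPoch_ne_zero hq b
      field_simp
    rw [e, norm_mul, norm_mul]
    gcongr <;> first | exact hC' _ | exact hD' _
  · rw [gaussBinom_eq_zero q (by omega), norm_zero]
    positivity

/-- The coefficient at fixed distance `m` from the centre tends to `Φ / (Φ Φ)`. The truncations by
`toNat` and by natural subtraction are harmless as soon as `|m| ≤ N`. -/
theorem tendsto_gaussBinom {q Φ : ℂ} (hq : ‖q‖ < 1) (hΦ : Φ ≠ 0)
    (hlim : Tendsto (qPoch q) atTop (𝓝 Φ)) (m : ℤ) :
    Tendsto (fun N : ℕ => gaussBinom q (2 * N) (m + N).toNat) atTop (𝓝 Φ⁻¹) := by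
  have h1 : Tendsto (fun N : ℕ => (m + N).toNat) atTop atTop := by
    refine tendsto_atTop_atTop.2 fun b => ⟨b + m.natAbs, fun N hN => by omega⟩
  have h2 : Tendsto (fun N : ℕ => 2 * N - (m + N).toNat) atTop atTop := by
    refine tendsto_atTop_atTop.2 fun b => ⟨b + m.natAbs, fun N hN => by omega⟩
  have h3 : Tendsto (fun N : ℕ => 2 * N) atTop atTop :=
    tendsto_atTop_atTop.2 fun b => ⟨b, fun N hN => by omega⟩
  have h4 := (hlim.comp h3).div ((hlim.comp h1).mul (hlim.comp h2)) (mul_ne_zero hΦ hΦ)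
  have h5 : Φ / (Φ * Φ) = Φ⁻¹ := by field_simp
  rw [h5] at h4
  refine h4.congr' ?_
  filter_upwards [eventually_ge_atTop m.natAbs] with N hN
  have := gaussBinom_mul_qPoch q (m + N).toNat (2 * N - (m + N).toNat)
  rw [show (m + N).toNat + (2 * N - (m + N).toNat) = 2 * N by omega] at this
  have h6 := qPoch_ne_zero hq (m + N).toNat
  have h7 := qPoch_ne_zero hq (2 * N - (m + N).toNat)
  simp only [Function.comp_def, Pi.div_apply]
  rw [← this]
  field_simp

/-- Recentring turns the sums of varying length into series over the fixed index set `ℤ`, as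
dominated convergence requires. -/
theorem sum_range_eq_tsum (g : ℤ → ℕ → ℂ) (N : ℕ) :
    ∑ k ∈ Finset.range (2 * N + 1), g ((k : ℤ) - N) k =
      ∑' m : ℤ, if m.natAbs ≤ N then g m (m + N).toNat else 0 := by
  rw [tsum_eq_sum (s := Finset.Icc (-(N : ℤ)) N)]
  · refine Finset.sum_nbij' (fun k => (k : ℤ) - N) (fun m => (m + N).toNat) ?_ ?_ ?_ ?_ ?_
    · intro k hk; simp at hk ⊢; omega
    · intro k hk; simp at hk ⊢; omega
    · intro k hk; simp
    · intro k hk; simp at hk ⊢; omega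
    · intro k hk
      simp at hk
      rw [if_pos (by omega)]
      simp
  · intro m hm
    rw [if_neg]
    simp at hm
    omega

/-- Jacobi's triple product. -/
theorem tendsto_prod_jacobiTheta₂ {τ : ℂ} (hτ : 0 < τ.im) :
    ∃ Φ : ℂ, Φ ≠ 0 ∧ Tendsto (qPoch (cexp (Real.pi * I * τ) ^ 2)) atTop (𝓝 Φ) ∧ ∀ v : ℂ,
      Tendsto (fun N => ∏ j ∈ Finset.range N,
        ((1 + cexp (2 * Real.pi * I * v) * cexp (Real.pi * I * τ) ^ (2 * j + 1)) *
          (1 + (cexp (2 * Real.pi * I * v))⁻¹ * cexp (Real.pi * I * τ) ^ (2 * j + 1)))) atTop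
        (𝓝 (Φ⁻¹ * jacobiTheta₂ v τ)) := by
  set p := cexp (Real.pi * I * τ) with hp
  have hp0 : p ≠ 0 := exp_ne_zero _
  have hp1 : ‖p ^ 2‖ < 1 := by
    rw [norm_pow, hp, Complex.norm_exp]
    refine pow_lt_one₀ (Real.exp_pos _).le ?_ two_ne_zero
    rw [Real.exp_lt_one_iff]
    simp [mul_assoc]
    positivity
  obtain ⟨Φ, hΦ, hlim⟩ := tendsto_qPoch hp1
  refine ⟨Φ, hΦ, hlim, fun v => ?_⟩
  set z := cexp (2 * Real.pi * I * v) with hz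
  have hz0 : z ≠ 0 := exp_ne_zero _
  obtain ⟨K, hK⟩ := norm_gaussBinom_le hp1
  have hterm : ∀ m : ℤ, jacobiTheta₂_term m v τ = p ^ (m ^ 2).toNat * z ^ m := fun m => by
    rw [jacobiTheta₂_term, hp, hz, ← exp_nat_mul, ← exp_int_mul, ← exp_add]
    congr 1
    have : (((m ^ 2).toNat : ℕ) : ℂ) = (m : ℂ) ^ 2 := by
      rw [← Int.cast_natCast, Int.toNat_of_nonneg (sq_nonneg m)]; push_cast; rfl
    rw [this]; ring
  have hsum := (hasSum_jacobiTheta₂_term v hτ).summable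
  simp only [prod_eq_sum_gaussBinom hp0 hz0]
  have e : ∀ N : ℕ, ∑ k ∈ Finset.range (2 * N + 1), p ^ (((k : ℤ) - N) ^ 2).toNat *
        gaussBinom (p ^ 2) (2 * N) k * z ^ ((k : ℤ) - N) =
      ∑' m : ℤ, if m.natAbs ≤ N then
        gaussBinom (p ^ 2) (2 * N) (m + N).toNat * jacobiTheta₂_term m v τ else 0 := fun N => by
    rw [← sum_range_eq_tsum (fun m k => gaussBinom (p ^ 2) (2 * N) k * jacobiTheta₂_term m v τ)]
    refine Finset.sum_congr rfl fun k _ => ?_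
    rw [hterm]; ring
  simp only [e]
  have : Φ⁻¹ * jacobiTheta₂ v τ = ∑' m : ℤ, Φ⁻¹ * jacobiTheta₂_term m v τ := by
    rw [tsum_mul_left]; rfl
  rw [this]
  refine tendsto_tsum_of_dominated_convergence (bound := fun m => K * ‖jacobiTheta₂_term m v τ‖)
    (hsum.norm.mul_left K) (fun m => ?_) (Eventually.of_forall fun N m => ?_)
  · refine ((tendsto_gaussBinom hp1 hΦ hlim m).mul_const _).congr' ?_
    filter_upwards [eventually_ge_atTop m.natAbs] with N hN
    rw [if_pos hN]
  · have hK0 : 0 ≤ K := (norm_nonneg _).trans (hK 0 0)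
    split_ifs
    · rw [norm_mul]
      gcongr
      exact hK _ _
    · rw [norm_zero]; positivity

end EllipticLink
end

/-! ### The theta series and the three-term relation. -/

noncomputable section
namespace EllipticLink
open Filter Topology Complex

theorem norm_exp_two_pi_I_mul_lt_one {τ : ℂ} (hτ : 0 < τ.im) :
    ‖cexp (2 * Real.pi * I * τ)‖ < 1 := by
  rw [Complex.norm_exp, Real.exp_lt_one_iff]
  simp [mul_assoc]
  positivity

/-- Jacobi's triple product at the argument shifted by `1/2 + τ/2`: the factors become `1 - q^(j+1)
X` and `1 - q^j X⁻¹`, with `X = e^(2πix)`. The additional factor `1 - X⁻¹` coming from `j = 0` is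
the sine. -/
theorem theta_eq_jacobiTheta₂ {τ : ℂ} (hτ : 0 < τ.im) (x : ℂ) :
    theta τ x = -I * cexp (2 * Real.pi * I * τ / 8) * cexp (Real.pi * I * x) *
      jacobiTheta₂ (x + 1 / 2 + τ / 2) τ := by
  obtain ⟨Φ, hΦ, hφ, hprod⟩ := tendsto_prod_jacobiTheta₂ hτ
  have hq := norm_exp_two_pi_I_mul_lt_one hτ
  have hpq : cexp (Real.pi * I * τ) ^ 2 = cexp (2 * Real.pi * I * τ) := by
    rw [← exp_nat_mul]; congr 1; push_cast; ring
  have hz : cexp (2 * Real.pi * I * (x + 1 / 2 + τ / 2)) =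
      -(cexp (2 * Real.pi * I * x) * cexp (Real.pi * I * τ)) := by
    rw [← exp_add, ← neg_one_mul, ← exp_pi_mul_I, ← exp_add]; congr 1; ring
  have hP := hprod (x + 1 / 2 + τ / 2)
  rw [hz] at hP
  rw [hpq] at hφ
  unfold theta
  set q := cexp (2 * Real.pi * I * τ) with hqdef
  set X := cexp (2 * Real.pi * I * x) with hX
  have hX0 : X ≠ 0 := exp_ne_zero _
  set p := cexp (Real.pi * I * τ) with hp
  have hp0 : p ≠ 0 := exp_ne_zero _
  have hs : ∀ c : ℂ, Multipliable fun n : ℕ => 1 + -(q ^ (n + 1) * c) := fun c => by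
    refine multipliable_one_add_of_summable ?_
    simp only [norm_neg, norm_mul, norm_pow]
    exact ((summable_nat_add_iff 1).2
      (summable_geometric_of_lt_one (norm_nonneg _) hq)).mul_right _
  have hT := (((hs 1).mul (hs X)).mul (hs X⁻¹)).hasProd.tendsto_prod_nat
  have hqN : Tendsto (fun N : ℕ => 1 - q ^ N * X⁻¹) atTop (𝓝 (1 - 0 * X⁻¹)) :=
    ((tendsto_pow_atTop_nhds_zero_of_norm_lt_one hq).mul_const _).const_sub _
  have hL := hT.const_mul (1 - X⁻¹)
  have hR := (hφ.mul hP).mul hqN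
  -- The factors in `X⁻¹` are shifted by one index between the two products, so the partial products
  -- differ by `1 - q^N X⁻¹`, which tends to `1`.
  have heq : ∀ N : ℕ, (1 - X⁻¹) * ∏ n ∈ Finset.range N,
      ((1 + -(q ^ (n + 1) * 1)) * (1 + -(q ^ (n + 1) * X)) * (1 + -(q ^ (n + 1) * X⁻¹))) =
      qPoch q N * (∏ j ∈ Finset.range N, ((1 + -(X * p) * p ^ (2 * j + 1)) *
        (1 + (-(X * p))⁻¹ * p ^ (2 * j + 1)))) * (1 - q ^ N * X⁻¹) := fun N => by
    induction N with
    | zero => simp [qPoch]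
    | succ N ih =>
      have e : qPoch q (N + 1) = qPoch q N * (1 - q ^ (N + 1)) := by
        simp [qPoch, Finset.prod_range_succ]
      have e1 : (-(X * p)) * p ^ (2 * N + 1) = -(q ^ (N + 1) * X) := by
        rw [← hpq, ← pow_mul]; ring
      have e2 : (-(X * p))⁻¹ * p ^ (2 * N + 1) = -(q ^ N * X⁻¹) := by
        rw [← hpq, ← pow_mul, pow_succ]
        field_simp
      rw [Finset.prod_range_succ, Finset.prod_range_succ, ← mul_assoc, ih, e, e1, e2]
      ring
  have hlim := tendsto_nhds_unique (hL.congr heq) hR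
  have hJ : (1 - X⁻¹) * ∏' n : ℕ, ((1 + -(q ^ (n + 1) * 1)) * (1 + -(q ^ (n + 1) * X)) *
      (1 + -(q ^ (n + 1) * X⁻¹))) = jacobiTheta₂ (x + 1 / 2 + τ / 2) τ := by
    rw [hlim]; field_simp; ring
  rw [← hJ]
  have hsin : 2 * Complex.sin (Real.pi * x) = -I * (cexp (Real.pi * I * x) * (1 - X⁻¹)) := by
    have : cexp (Real.pi * I * x) * X⁻¹ = cexp (-(Real.pi * x) * I) := by
      rw [hX, ← exp_neg, ← exp_add]; congr 1; ring
    rw [Complex.sin, mul_sub, this, show (Real.pi : ℂ) * I * x = Real.pi * x * I by ring]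
    ring
  have hprod' : ∏' n : ℕ, ((1 - q ^ (n + 1)) * (1 - q ^ (n + 1) * X) * (1 - q ^ (n + 1) / X)) =
      ∏' n : ℕ, ((1 + -(q ^ (n + 1) * 1)) * (1 + -(q ^ (n + 1) * X)) *
        (1 + -(q ^ (n + 1) * X⁻¹))) := by
    congr 1; funext n; rw [div_eq_mul_inv]; ring
  rw [hprod']
  linear_combination cexp (2 * Real.pi * I * τ / 8) * (∏' n : ℕ, ((1 + -(q ^ (n + 1) * 1)) *
    (1 + -(q ^ (n + 1) * X)) * (1 + -(q ^ (n + 1) * X⁻¹)))) * hsin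

/-- The even part of the theta series of a product of two theta functions. -/
def thetaEven (τ x : ℂ) : ℂ :=
  ∑' a : ℤ, cexp (2 * Real.pi * I * (2 * a) * x + Real.pi * I * τ * (2 * a) ^ 2 / 2)

/-- The odd part of the theta series of a product of two theta functions. -/
def thetaOdd (τ x : ℂ) : ℂ :=
  ∑' a : ℤ, cexp (2 * Real.pi * I * (2 * a + 1) * x + Real.pi * I * τ * (2 * a + 1) ^ 2 / 2)

theorem summable_thetaEven {τ : ℂ} (hτ : 0 < τ.im) (x : ℂ) : Summable fun a : ℤ =>
    ‖cexp (2 * Real.pi * I * (2 * a) * x + Real.pi * I * τ * (2 * a) ^ 2 / 2)‖ := by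
  have := (hasSum_jacobiTheta₂_term (2 * x) (τ := 2 * τ) (by simpa using hτ)).summable.norm
  refine this.congr fun a => ?_
  rw [jacobiTheta₂_term]; congr 2; ring

theorem summable_thetaOdd {τ : ℂ} (hτ : 0 < τ.im) (x : ℂ) : Summable fun a : ℤ =>
    ‖cexp (2 * Real.pi * I * (2 * a + 1) * x + Real.pi * I * τ * (2 * a + 1) ^ 2 / 2)‖ := by
  have := ((hasSum_jacobiTheta₂_term (2 * x + τ) (τ := 2 * τ)
    (by simpa using hτ)).summable.mul_left (cexp (2 * Real.pi * I * x + Real.pi * I * τ / 2))).norm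
  refine this.congr fun a => ?_
  rw [jacobiTheta₂_term, ← exp_add]; congr 2; ring

/-- Terms of the theta series. -/
def thetaTerm (τ x : ℂ) (n : ℤ) : ℂ :=
  (-1) ^ n * cexp (2 * Real.pi * I * (n + 1 / 2) * x + Real.pi * I * τ * (n + 1 / 2) ^ 2)

theorem thetaTerm_eq (τ x : ℂ) (n : ℤ) : thetaTerm τ x n = cexp (Real.pi * I * τ / 4) *
    cexp (Real.pi * I * x) * jacobiTheta₂_term n (x + 1 / 2 + τ / 2) τ := by
  rw [thetaTerm, jacobiTheta₂_term, ← exp_pi_mul_I, ← exp_int_mul, ← exp_add, ← exp_add,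
    ← exp_add]
  congr 1; ring

theorem theta_eq_tsum {τ : ℂ} (hτ : 0 < τ.im) (x : ℂ) :
    theta τ x = -I * ∑' n, thetaTerm τ x n := by
  simp only [thetaTerm_eq]
  rw [theta_eq_jacobiTheta₂ hτ, tsum_mul_left, ← jacobiTheta₂,
    show (2 : ℂ) * Real.pi * I * τ / 8 = Real.pi * I * τ / 4 by ring]
  ring

theorem summable_thetaTerm {τ : ℂ} (hτ : 0 < τ.im) (x : ℂ) :
    Summable fun n => ‖thetaTerm τ x n‖ := by
  simp only [thetaTerm_eq]
  exact ((hasSum_jacobiTheta₂_term _ hτ).summable.mul_left _).norm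

/-- Pairs of integers, sorted by the parity of their sum. -/
def parityEquiv : (ℤ × ℤ) ⊕ (ℤ × ℤ) ≃ ℤ × ℤ where
  toFun := Sum.elim (fun c => (c.1 + c.2, c.1 - c.2)) (fun c => (c.1 + c.2, c.1 - c.2 - 1))
  invFun c := if (c.1 + c.2) % 2 = 0 then .inl ((c.1 + c.2) / 2, (c.1 - c.2) / 2)
    else .inr ((c.1 + c.2 + 1) / 2, (c.1 - c.2 - 1) / 2)
  left_inv := by
    rintro (⟨a, b⟩ | ⟨a, b⟩)
    · have h : (a + b + (a - b)) % 2 = 0 := by omega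
      refine (if_pos h).trans ?_
      simp only [Sum.elim_inl, Sum.inl.injEq, Prod.mk.injEq]; omega
    · have h : ¬(a + b + (a - b - 1)) % 2 = 0 := by omega
      refine (if_neg h).trans ?_
      simp only [Sum.elim_inr, Sum.inr.injEq, Prod.mk.injEq]; omega
  right_inv := by
    rintro ⟨a, b⟩
    dsimp only
    split_ifs with h
    · simp only [Sum.elim_inl, Prod.mk.injEq]; omega
    · simp only [Sum.elim_inr, Prod.mk.injEq]; omega

/-- In the double series, sort the pairs of indices by the parity of their sum. On each half, sum
and difference of the indices are independent, so the series factors; the sign `(-1)^(n+m)`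
separates the two halves. The product thus becomes a `2 × 2` determinant, from which the three-term
relation is immediate. -/
theorem theta_mul_theta {τ : ℂ} (hτ : 0 < τ.im) (x y : ℂ) :
    theta τ (x + y) * theta τ (x - y) =
      thetaEven τ x * thetaOdd τ y - thetaOdd τ x * thetaEven τ y := by
  have hA := summable_thetaEven hτ
  have hB := summable_thetaOdd hτ
  have hE := summable_thetaTerm hτ
  have h1 := (summable_mul_of_summable_norm (hE (x + y)) (hE (x - y))).hasSum
  rw [← tsum_mul_tsum_of_summable_norm (hE (x + y)) (hE (x - y)),
    ← parityEquiv.hasSum_iff] at h1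
  have h2 := (summable_mul_of_summable_norm (hB x) (hA y)).hasSum
  rw [← tsum_mul_tsum_of_summable_norm (hB x) (hA y)] at h2
  have h3 := (summable_mul_of_summable_norm (hA x) (hB y)).hasSum.neg
  rw [← tsum_mul_tsum_of_summable_norm (hA x) (hB y)] at h3
  have h4 := HasSum.sum (f := (fun c : ℤ × ℤ => thetaTerm τ (x + y) c.1 *
    thetaTerm τ (x - y) c.2) ∘ parityEquiv) (h2.congr_fun fun c => ?_) (h3.congr_fun fun c => ?_)
  · have := h1.unique h4
    change _ = thetaOdd τ x * thetaEven τ y + -(thetaEven τ x * thetaOdd τ y) at this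
    rw [theta_eq_tsum hτ, theta_eq_tsum hτ]
    linear_combination I ^ 2 * this +
      (thetaOdd τ x * thetaEven τ y - thetaEven τ x * thetaOdd τ y) * I_sq
  · simp only [Function.comp_apply, parityEquiv, Equiv.coe_fn_mk, Sum.elim_inl, thetaTerm]
    rw [mul_mul_mul_comm, ← zpow_add₀ (by norm_num), (by ring : c.1 + c.2 + (c.1 - c.2) = 2 * c.1),
      zpow_mul, ← exp_add, ← exp_add]
    norm_num
    congr 1; ring
  · simp only [Function.comp_apply, parityEquiv, Equiv.coe_fn_mk, Sum.elim_inr, thetaTerm]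
    rw [mul_mul_mul_comm, ← zpow_add₀ (by norm_num),
      (by ring : c.1 + c.2 + (c.1 - c.2 - 1) = 2 * c.1 + -1), zpow_add₀ (by norm_num),
      zpow_mul, ← exp_add, ← exp_add]
    norm_num
    congr 1; ring

theorem theta_neg (τ x : ℂ) : theta τ (-x) = -theta τ x := by
  unfold theta
  have h : ∀ n : ℕ, (1 - cexp (2 * Real.pi * I * τ) ^ (n + 1)) *
        (1 - cexp (2 * Real.pi * I * τ) ^ (n + 1) * cexp (2 * Real.pi * I * -x)) *
        (1 - cexp (2 * Real.pi * I * τ) ^ (n + 1) / cexp (2 * Real.pi * I * -x)) =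
      (1 - cexp (2 * Real.pi * I * τ) ^ (n + 1)) *
        (1 - cexp (2 * Real.pi * I * τ) ^ (n + 1) * cexp (2 * Real.pi * I * x)) *
        (1 - cexp (2 * Real.pi * I * τ) ^ (n + 1) / cexp (2 * Real.pi * I * x)) := fun n => by
    rw [mul_neg, exp_neg, div_inv_eq_mul, div_eq_mul_inv]; ring
  simp only [h]
  simp only [mul_neg, sin_neg, neg_mul]

theorem vtheta_neg (τ x : ℂ) : vtheta τ (-x) = -vtheta τ x := by
  rw [vtheta, theta_neg, neg_div, vtheta]

/-- The three-term relation of Weierstrass. -/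
theorem vtheta_three_term {τ : ℂ} (hτ : 0 < τ.im) (a b c d : ℂ) :
    vtheta τ (a + b) * vtheta τ (a - b) * (vtheta τ (c + d) * vtheta τ (c - d)) -
      vtheta τ (a + c) * vtheta τ (a - c) * (vtheta τ (b + d) * vtheta τ (b - d)) +
      vtheta τ (a + d) * vtheta τ (a - d) * (vtheta τ (b + c) * vtheta τ (b - c)) = 0 := by
  -- Each factor pair is a determinant of two of the four vectors `(thetaEven, thetaOdd)` at `a, b,
  -- c, d`, so the claim is the Plücker relation for four vectors in a plane.
  have h : ∀ x y, vtheta τ (x + y) * vtheta τ (x - y) =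
      (thetaEven τ x * thetaOdd τ y - thetaOdd τ x * thetaEven τ y) /
        deriv (theta τ) 0 ^ 2 := fun x y => by
    rw [← theta_mul_theta hτ, vtheta, vtheta, sq, div_mul_div_comm]
  simp only [h]
  ring

end EllipticLink
end

noncomputable section
namespace EllipticLink

/-! ## Identities between theta functions -/

/-- The three-term relation parametrised by the arguments of its first product, so that it can be
applied to given factors; the other arguments follow from the half-sum `s`. -/
theorem vtheta_four_term {τ : ℂ} (hτ : 0 < τ.im) {P Q R S s : ℂ} (hs : 2 * s = P + Q + R + S) :
    vtheta τ P * vtheta τ Q * (vtheta τ R * vtheta τ S) -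
      vtheta τ s * vtheta τ (s - R - S) * (vtheta τ (s - Q - S) * vtheta τ (s - Q - R)) +
      vtheta τ (s - S) * vtheta τ (s - R) * (vtheta τ (s - Q) * vtheta τ (P - s)) = 0 := by
  obtain rfl : P = 2 * s - Q - R - S := by rw [hs]; ring
  have := vtheta_three_term hτ ((2 * s - R - S) / 2) ((2 * s - 2 * Q - R - S) / 2) ((R + S) / 2)
    ((R - S) / 2)
  ring_nf at this ⊢
  exact this

/-- A single three-term relation after clearing denominators. It is the recursion of weight
functions restricted to the two cells affected at the level where the second position has a column
but no row yet. -/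
theorem delta_mul_vtheta_add {τ : ℂ} (hτ : 0 < τ.im) {X W h ν : ℂ} (hh : vtheta τ h ≠ 0)
    (hν : vtheta τ ν ≠ 0) (hhν : vtheta τ (h + ν) ≠ 0) (hWX : vtheta τ (W - X) ≠ 0) :
    delta τ (W - X) ν * (vtheta τ (X + (h + ν)) / vtheta τ (h + ν) * vtheta τ W) +
      delta τ (X - W) h * (vtheta τ X * (vtheta τ (W + (h + ν)) / vtheta τ (h + ν))) =
    vtheta τ (X + h) / vtheta τ h * (vtheta τ (W + ν) / vtheta τ ν) := by
  have key := vtheta_four_term hτ (P := X + h) (Q := W + ν) (R := W - X) (S := h + ν)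
    (s := W + h + ν) (by ring)
  rw [delta_eq_vtheta, delta_eq_vtheta, show X - W = -(W - X) by ring, vtheta_neg]
  rw [show W + h + ν - (W - X) - (h + ν) = X by ring, show W + h + ν - (W + ν) - (h + ν) = -ν by
    ring, show W + h + ν - (W + ν) - (W - X) = -(W - X) + h by ring, vtheta_neg,
    show W + h + ν - (h + ν) = W by ring, show W + h + ν - (W - X) = X + (h + ν) by ring,
    show W + h + ν - (W + ν) = h by ring, show X + h - (W + h + ν) = -(W - X + ν) by ring,
    vtheta_neg, show W + h + ν = W + (h + ν) by ring] at key
  field_simp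
  linear_combination -key

/-- The exchange relation behind the intertwining property of Demazure operations, `Y`- and
`y`-variables being permuted on the two sides. -/
theorem delta_exchange {τ : ℂ} (hτ : 0 < τ.im) {y₁ y₂ Y₁ Y₂ D₁ D₂ ν h : ℂ} (hνD : ν = D₁ - D₂)
    (hh : vtheta τ h ≠ 0) (hν : vtheta τ ν ≠ 0)
    (hy : vtheta τ (y₂ - y₁) ≠ 0) (hY : vtheta τ (Y₂ - Y₁) ≠ 0) :
    delta τ (y₂ - y₁) ν * (vtheta τ (Y₁ - y₁ + D₂) * vtheta τ (Y₂ - y₂ + D₁) *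
        (vtheta τ (Y₂ - y₁) * vtheta τ (Y₁ - y₂ + h))) +
      delta τ (y₁ - y₂) h * (vtheta τ (Y₁ - y₂ + D₂) * vtheta τ (Y₂ - y₁ + D₁) *
        (vtheta τ (Y₂ - y₂) * vtheta τ (Y₁ - y₁ + h))) =
    delta τ (Y₂ - Y₁) ν * (vtheta τ (Y₁ - y₁ + D₁) * vtheta τ (Y₂ - y₂ + D₂) *
        (vtheta τ (Y₂ - y₁) * vtheta τ (Y₁ - y₂ + h))) +
      delta τ (Y₁ - Y₂) h * (vtheta τ (Y₂ - y₁ + D₁) * vtheta τ (Y₁ - y₂ + D₂) *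
        (vtheta τ (Y₁ - y₁) * vtheta τ (Y₂ - y₂ + h))) := by
  subst hνD
  obtain ⟨a, ha⟩ : ∃ a, a = Y₁ - y₁ := ⟨_, rfl⟩
  obtain ⟨b, hb⟩ : ∃ b, b = Y₂ - y₂ := ⟨_, rfl⟩
  obtain ⟨d, hd⟩ : ∃ d, d = Y₁ - y₂ := ⟨_, rfl⟩
  have hc : Y₂ - y₁ = a + b - d := by rw [ha, hb, hd]; ring
  have h1 : y₂ - y₁ = a - d := by rw [ha, hd]; ring
  have h2 : y₁ - y₂ = -(a - d) := by rw [ha, hd]; ring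
  have h3 : Y₂ - Y₁ = b - d := by rw [hb, hd]; ring
  have h4 : Y₁ - Y₂ = -(b - d) := by rw [hb, hd]; ring
  rw [h1] at hy
  rw [h3] at hY
  rw [← ha, ← hb, ← hd, hc, h1, h2, h3, h4]
  simp only [delta_eq_vtheta, vtheta_neg]
  have k1 := vtheta_four_term hτ (P := -(a - d) + h) (Q := b) (R := a + h) (S := -(b - d))
    (s := d + h) (by ring)
  rw [show d + h - (a + h) - -(b - d) = b - a by ring, show d + h - b - -(b - d) = h by ring,
    show d + h - b - (a + h) = -(a + b - d) by ring, show d + h - -(b - d) = b + h by ring,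
    show d + h - (a + h) = -(a - d) by ring, show d + h - b = -(b - d) + h by ring,
    show -(a - d) + h - (d + h) = -a + (d - d) by ring] at k1
  simp only [sub_self, add_zero, vtheta_neg] at k1
  have k2 := vtheta_four_term hτ (P := a - d + (D₁ - D₂)) (Q := b - d) (R := a + D₂) (S := b + D₁)
    (s := a + b - d + D₁) (by ring)
  rw [show a + b - d + D₁ - (a + D₂) - (b + D₁) = -(d + D₂) by ring,
    show a + b - d + D₁ - (b - d) - (b + D₁) = -(b - a) by ring,
    show a + b - d + D₁ - (b - d) - (a + D₂) = D₁ - D₂ by ring,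
    show a + b - d + D₁ - (b + D₁) = a - d by ring,
    show a + b - d + D₁ - (a + D₂) = b - d + (D₁ - D₂) by ring,
    show a + b - d + D₁ - (b - d) = a + D₁ by ring,
    show a - d + (D₁ - D₂) - (a + b - d + D₁) = -(b + D₂) by ring] at k2
  simp only [vtheta_neg] at k2
  field_simp
  -- Both relations contain a term with `ϑ(b - a)`, which does not occur in the claim; the
  -- multipliers are chosen so that these two terms cancel.
  linear_combination vtheta τ h * vtheta τ (a + b - d) * vtheta τ (d + h) * k2 +
    vtheta τ (D₁ - D₂) * vtheta τ (a + b - d + D₁) * vtheta τ (d + D₂) * k1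

end EllipticLink
end

noncomputable section
namespace EllipticLink

/-! ## Weight functions indexed by positions

The rows and columns of every level are indexed by the positions `j < k` instead of the sorted
values `ω j`; the permutation is given by the sequence `v` of its values. -/

/-- The dynamical parameter of the position `j` at the level `k`. -/
def posParam (h : ℂ) (v : ℕ → ℕ) (μ : ℕ → ℂ) (k j : ℕ) : ℂ :=
  (if v k < v j then 0 else h) + μ k - μ j

/-- The factor of the weight function attached to the positions `j` and `l`. -/
def cell (τ h : ℂ) (v : ℕ → ℕ) (μ : ℕ → ℂ) (k j l : ℕ) (x : ℂ) : ℂ :=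
  if v l < v j then vtheta τ (x + h) / vtheta τ h
  else if l = j then vtheta τ (x + posParam h v μ k j) / vtheta τ (posParam h v μ k j)
  else vtheta τ x

/-- The factor of the weight function attached to the variables of two consecutive levels. -/
def levelFactor (τ h : ℂ) (v : ℕ → ℕ) (μ : ℕ → ℂ) (k : ℕ) (y : Fin k → ℂ) (Y : Fin (k + 1) → ℂ) :
    ℂ :=
  (∏ j : Fin k, ∏ l : Fin (k + 1), cell τ h v μ k j l (Y l - y j)) *
    ∏ j : Fin k, ∏ l : Fin k, if v j < v l then delta τ (y l - y j) h else 1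

/-- Symmetrisation of a product of factors of consecutive levels. -/
def symSum (lev : (k : ℕ) → (Fin k → ℂ) → (Fin (k + 1) → ℂ) → ℂ) (t : (k : ℕ) → Fin k → ℂ) :
    (k : ℕ) → (Fin k → ℂ) → ℂ
  | 0, _ => 1
  | k + 1, Y => ∑ s : Equiv.Perm (Fin k), symSum lev t k (t k ∘ s) * lev k (t k ∘ s) Y

theorem prod_prod_eq_mul_prod {ι κ : Type*} [Fintype ι] [Fintype κ] [DecidableEq ι]
    [DecidableEq κ] (S : Finset (ι × κ)) (F : ι → κ → ℂ) :
    ∏ j, ∏ l, F j l = (∏ j, ∏ l, if (j, l) ∈ S then 1 else F j l) * ∏ c ∈ S, F c.1 c.2 := by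
  have : ∏ c ∈ S, F c.1 c.2 = ∏ j, ∏ l, if (j, l) ∈ S then F j l else 1 := by
    rw [← Fintype.prod_prod_type' (fun j l => if (j, l) ∈ S then F j l else 1)]
    simp
  rw [this, ← Finset.prod_mul_distrib]
  refine Finset.prod_congr rfl fun j _ => ?_
  rw [← Finset.prod_mul_distrib]
  refine Finset.prod_congr rfl fun l _ => ?_
  split_ifs <;> simp

section swap

variable {v : ℕ → ℕ} {p q : ℕ}

/-- No value lies strictly between two consecutive ones. Hence the rows of `p` and `q`, and likewise
their columns, carry the same factors outside of the square they span; everything about exchanging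
`p` and `q` rests on this. -/
theorem lt_iff_of_adjacent (hv : v.Injective) (hpq : v q = v p + 1) {c : ℕ} (hp : c ≠ p)
    (hq : c ≠ q) : (v c < v p ↔ v c < v q) ∧ (v p < v c ↔ v q < v c) := by
  have h1 := hv.ne hp
  have h2 := hv.ne hq
  omega

theorem swap_lt_swap_iff (hv : v.Injective) (hpq : v q = v p + 1) {a b : ℕ} (ha : a ≠ q)
    (hb : b ≠ q) : v (Equiv.swap p q a) < v (Equiv.swap p q b) ↔ v a < v b := by
  by_cases h1 : a = p <;> by_cases h2 : b = p
  · simp [h1, h2]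
  · rw [h1, Equiv.swap_apply_left, Equiv.swap_apply_of_ne_of_ne h2 hb]
    exact (lt_iff_of_adjacent hv hpq h2 hb).2.symm
  · rw [h2, Equiv.swap_apply_left, Equiv.swap_apply_of_ne_of_ne h1 ha]
    exact (lt_iff_of_adjacent hv hpq h1 ha).1.symm
  · rw [Equiv.swap_apply_of_ne_of_ne h1 ha, Equiv.swap_apply_of_ne_of_ne h2 hb]

theorem cell_swap_of_lt (hv : v.Injective) (hpq : v q = v p + 1) (τ h : ℂ) (μ : ℕ → ℂ)
    {k j l : ℕ} (hk : k ≠ q) (hj : j ≠ q) (hl : l ≠ q) :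
    cell τ h (v ∘ Equiv.swap p q) μ k j l = cell τ h v μ k j l := by
  funext x
  simp only [cell, posParam, Function.comp_apply, swap_lt_swap_iff hv hpq hl hj,
    swap_lt_swap_iff hv hpq hk hj]

/-- Below the level `q + 1` only the position `p` is present, and replacing its value by the
adjacent one changes no comparison. -/
theorem levelFactor_swap_of_lt (hv : v.Injective) (hpq : v q = v p + 1) (τ h : ℂ) (μ : ℕ → ℂ)
    {k : ℕ} (hk : k < q) :
    levelFactor τ h (v ∘ Equiv.swap p q) μ k = levelFactor τ h v μ k := by
  funext y Y
  unfold levelFactor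
  congr 1
  · refine Finset.prod_congr rfl fun j _ => Finset.prod_congr rfl fun l _ => ?_
    rw [cell_swap_of_lt hv hpq τ h μ (by omega) (by omega) (by omega)]
  · refine Finset.prod_congr rfl fun j _ => Finset.prod_congr rfl fun l _ => ?_
    simp only [Function.comp_apply, swap_lt_swap_iff hv hpq (a := j) (b := l) (by omega) (by omega)]

theorem swap_fin_coe {k : ℕ} (a b c : Fin k) :
    ((Equiv.swap a b c : Fin k) : ℕ) = Equiv.swap (a : ℕ) b c := by
  simp only [Equiv.swap_apply_def, Fin.ext_iff]
  split_ifs <;> rfl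

/-- Once rows exist for both positions, exchanging their values is a renaming of the positions. The
variables `μ` are attached to positions, so the renaming reappears as an exchange of `μ p` and `μ
q`. -/
theorem levelFactor_swap_comp_swap (τ h : ℂ) (v : ℕ → ℕ) (μ : ℕ → ℂ) {p q k : ℕ} (hp : p < k)
    (hq : q < k) (y : Fin k → ℂ) (Y : Fin (k + 1) → ℂ) :
    levelFactor τ h (v ∘ Equiv.swap p q) μ k (y ∘ Equiv.swap ⟨p, hp⟩ ⟨q, hq⟩)
      (Y ∘ Equiv.swap ⟨p, by omega⟩ ⟨q, by omega⟩) =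
    levelFactor τ h v (μ ∘ Equiv.swap p q) k y Y := by
  unfold levelFactor
  have hk : Equiv.swap p q k = k := Equiv.swap_apply_of_ne_of_ne (by omega) (by omega)
  congr 1
  · rw [← Equiv.prod_comp (Equiv.swap (⟨p, hp⟩ : Fin k) ⟨q, hq⟩)]
    refine Finset.prod_congr rfl fun j _ => ?_
    rw [← Equiv.prod_comp (Equiv.swap (⟨p, by omega⟩ : Fin (k + 1)) ⟨q, by omega⟩)]
    refine Finset.prod_congr rfl fun l _ => ?_
    simp only [cell, posParam, Function.comp_apply, swap_fin_coe, Equiv.swap_apply_self, hk,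
      (Equiv.swap p q).injective.eq_iff]
  · rw [← Equiv.prod_comp (Equiv.swap (⟨p, hp⟩ : Fin k) ⟨q, hq⟩)]
    refine Finset.prod_congr rfl fun j _ => ?_
    rw [← Equiv.prod_comp (Equiv.swap (⟨p, hp⟩ : Fin k) ⟨q, hq⟩)]
    refine Finset.prod_congr rfl fun l _ => ?_
    simp only [Function.comp_apply, swap_fin_coe, Equiv.swap_apply_self]

/-- The interesting part of the factor of a level containing two adjacent values. -/
def squareFactor (τ h D₁ D₂ y₁ y₂ Y₁ Y₂ : ℂ) : ℂ :=
  vtheta τ (Y₁ - y₁ + D₁) / vtheta τ D₁ * vtheta τ (Y₂ - y₁) *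
    (vtheta τ (Y₁ - y₂ + h) / vtheta τ h * (vtheta τ (Y₂ - y₂ + D₂) / vtheta τ D₂)) *
      delta τ (y₂ - y₁) h

/-- By adjacency of the values, the part `R` outside of the square on `p, q` is symmetric in the two
variables `y` and, separately, in the two variables `Y`. Since `μ` enters through diagonal cells
only, exchanging `μ p` and `μ q` affects only the square. This reduces the exchange relation to four
variables. -/
theorem levelFactor_eq_mul_squareFactor (hv : v.Injective) (hpq : v q = v p + 1) (τ h : ℂ)
    (μ : ℕ → ℂ) {k : ℕ} (hp : p < k) (hq : q < k) :
    ∃ R : (Fin k → ℂ) → (Fin (k + 1) → ℂ) → ℂ,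
      (∀ y Y, R (y ∘ Equiv.swap ⟨p, hp⟩ ⟨q, hq⟩) Y = R y Y) ∧
      (∀ y Y, R y (Y ∘ Equiv.swap ⟨p, by omega⟩ ⟨q, by omega⟩) = R y Y) ∧
      (∀ y Y, levelFactor τ h v μ k y Y = R y Y *
        squareFactor τ h (posParam h v μ k p) (posParam h v μ k q) (y ⟨p, hp⟩) (y ⟨q, hq⟩)
          (Y ⟨p, by omega⟩) (Y ⟨q, by omega⟩)) ∧
      ∀ y Y, levelFactor τ h v (μ ∘ Equiv.swap p q) k y Y = R y Y *
        squareFactor τ h (posParam h v μ k q) (posParam h v μ k p) (y ⟨p, hp⟩) (y ⟨q, hq⟩)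
          (Y ⟨p, by omega⟩) (Y ⟨q, by omega⟩) := by
  have hne : p ≠ q := by rintro rfl; omega
  set P : Fin k := ⟨p, hp⟩ with hP
  set Q : Fin k := ⟨q, hq⟩ with hQ
  set P' : Fin (k + 1) := ⟨p, by omega⟩ with hP'
  set Q' : Fin (k + 1) := ⟨q, by omega⟩ with hQ'
  have hPQ : P ≠ Q := by simpa [hP, hQ] using hne
  have hPQ' : P' ≠ Q' := by simpa [hP', hQ'] using hne
  let S : Finset (Fin k × Fin (k + 1)) := {P, Q} ×ˢ {P', Q'}
  let T : Finset (Fin k × Fin k) := {P, Q} ×ˢ {P, Q}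
  have hkp : v k < v p ↔ v k < v q := (lt_iff_of_adjacent hv hpq (by omega) (by omega)).1
  have hP1 : ∀ j : Fin k, j = P ↔ (j : ℕ) = p := fun j => by simp [hP, Fin.ext_iff]
  have hQ1 : ∀ j : Fin k, j = Q ↔ (j : ℕ) = q := fun j => by simp [hQ, Fin.ext_iff]
  have hP1' : ∀ j : Fin (k + 1), j = P' ↔ (j : ℕ) = p := fun j => by simp [hP', Fin.ext_iff]
  have hQ1' : ∀ j : Fin (k + 1), j = Q' ↔ (j : ℕ) = q := fun j => by simp [hQ', Fin.ext_iff]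
  have hsw : ∀ j : Fin k, Equiv.swap P Q j = P ∨ Equiv.swap P Q j = Q ↔ j = P ∨ j = Q := by
    intro j
    rw [Equiv.swap_apply_eq_iff, Equiv.swap_apply_eq_iff, Equiv.swap_apply_left,
      Equiv.swap_apply_right, or_comm]
  have hsw' : ∀ j : Fin (k + 1),
      Equiv.swap P' Q' j = P' ∨ Equiv.swap P' Q' j = Q' ↔ j = P' ∨ j = Q' := by
    intro j
    rw [Equiv.swap_apply_eq_iff, Equiv.swap_apply_eq_iff, Equiv.swap_apply_left,
      Equiv.swap_apply_right, or_comm]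
  have hS : ∀ j l, (j, l) ∈ S ↔ (j = P ∨ j = Q) ∧ (l = P' ∨ l = Q') := fun j l => by
    simp [S]
  have hT : ∀ j l, (j, l) ∈ T ↔ (j = P ∨ j = Q) ∧ (l = P ∨ l = Q) := fun j l => by
    simp [T]
  have hrow : ∀ l : Fin (k + 1), ¬(l = P' ∨ l = Q') → cell τ h v μ k p l = cell τ h v μ k q l := by
    intro l hl
    rw [hP1', hQ1', not_or] at hl
    funext x
    simp only [cell, (lt_iff_of_adjacent hv hpq hl.1 hl.2).1, hl.1, hl.2, if_false]
  have hcol : ∀ j : Fin k, ¬(j = P ∨ j = Q) → cell τ h v μ k j p = cell τ h v μ k j q := by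
    intro j hj
    rw [hP1, hQ1, not_or] at hj
    funext x
    simp only [cell, (lt_iff_of_adjacent hv hpq hj.1 hj.2).2, Ne.symm hj.1, Ne.symm hj.2, if_false]
  have hμ : ∀ (j : Fin k) (l : Fin (k + 1)), (j, l) ∉ S →
      cell τ h v (μ ∘ Equiv.swap p q) k j l = cell τ h v μ k j l := by
    intro j l hjl
    rw [hS, hP1, hQ1, hP1', hQ1'] at hjl
    funext x
    by_cases hlj : (l : ℕ) = j
    · have : Equiv.swap p q j = j := Equiv.swap_apply_of_ne_of_ne (by omega) (by omega)
      have hk : Equiv.swap p q k = k := Equiv.swap_apply_of_ne_of_ne (by omega) (by omega)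
      simp only [cell, posParam, Function.comp_apply, this, hk]
    · simp only [cell, hlj, if_false]
  let C : Fin k → Fin (k + 1) → ℂ → ℂ := fun j l x =>
    if (j, l) ∈ S then 1 else cell τ h v μ k j l x
  let d : Fin k → Fin k → ℂ → ℂ := fun j l x =>
    if (j, l) ∈ T then 1 else if v j < v l then delta τ x h else 1
  have hC1 : ∀ j l, C (Equiv.swap P Q j) l = C j l := by
    intro j l
    funext x
    simp only [C, hS, hsw]
    by_cases hl : l = P' ∨ l = Q'
    · by_cases hj : j = P ∨ j = Q
      · simp [hl, hj]
      · rw [not_or] at hj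
        rw [Equiv.swap_apply_of_ne_of_ne hj.1 hj.2]
    · simp only [hl, and_false, if_false]
      by_cases hj : j = P
      · rw [hj, Equiv.swap_apply_left]
        exact (congrFun (hrow l hl) x).symm
      · by_cases hj' : j = Q
        · rw [hj', Equiv.swap_apply_right]
          exact congrFun (hrow l hl) x
        · rw [Equiv.swap_apply_of_ne_of_ne hj hj']
  have hC2 : ∀ j l, C j (Equiv.swap P' Q' l) = C j l := by
    intro j l
    funext x
    simp only [C, hS, hsw']
    by_cases hj : j = P ∨ j = Q
    · by_cases hl : l = P' ∨ l = Q'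
      · simp [hl, hj]
      · rw [not_or] at hl
        rw [Equiv.swap_apply_of_ne_of_ne hl.1 hl.2]
    · simp only [hj, false_and, if_false]
      by_cases hl : l = P'
      · rw [hl, Equiv.swap_apply_left]
        exact (congrFun (hcol j hj) x).symm
      · by_cases hl' : l = Q'
        · rw [hl', Equiv.swap_apply_right]
          exact congrFun (hcol j hj) x
        · rw [Equiv.swap_apply_of_ne_of_ne hl hl']
  have hlt : ∀ j l : Fin k, (j, l) ∉ T →
      (v (Equiv.swap P Q j : Fin k) < v (Equiv.swap P Q l : Fin k) ↔ v j < v l) := by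
    intro j l hjl
    simp only [swap_fin_coe]
    change v (Equiv.swap p q j) < v (Equiv.swap p q l) ↔ _
    by_cases hj : (j : ℕ) = p ∨ (j : ℕ) = q
    · have hl : (l : ℕ) ≠ p ∧ (l : ℕ) ≠ q := by
        rw [hT, hP1, hQ1, hP1, hQ1] at hjl
        omega
      rw [Equiv.swap_apply_of_ne_of_ne hl.1 hl.2]
      have := lt_iff_of_adjacent hv hpq hl.1 hl.2
      rcases hj with hj | hj <;> rw [hj]
      · rw [Equiv.swap_apply_left]; exact this.2.symm
      · rw [Equiv.swap_apply_right]; exact this.2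
    · rw [not_or] at hj
      rw [Equiv.swap_apply_of_ne_of_ne hj.1 hj.2]
      have := lt_iff_of_adjacent hv hpq hj.1 hj.2
      by_cases hl : (l : ℕ) = p
      · rw [hl, Equiv.swap_apply_left]; exact this.1.symm
      · by_cases hl' : (l : ℕ) = q
        · rw [hl', Equiv.swap_apply_right]; exact this.1
        · rw [Equiv.swap_apply_of_ne_of_ne hl hl']
  have hd : ∀ j l, d (Equiv.swap P Q j) (Equiv.swap P Q l) = d j l := by
    intro j l
    funext x
    simp only [d]
    by_cases hjl : (j, l) ∈ T
    · rw [if_pos hjl, if_pos]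
      rwa [hT, hsw, hsw, ← hT]
    · rw [if_neg hjl, if_neg]
      · simp only [hlt j l hjl]
      · rwa [hT, hsw, hsw, ← hT]
  have hlev : ∀ (ρ : ℕ → ℂ), (∀ (j : Fin k) (l : Fin (k + 1)), (j, l) ∉ S →
      cell τ h v ρ k j l = cell τ h v μ k j l) → ∀ y Y, levelFactor τ h v ρ k y Y =
      ((∏ j, ∏ l, C j l (Y l - y j)) * ∏ j, ∏ l, d j l (y l - y j)) *
        squareFactor τ h (posParam h v ρ k p) (posParam h v ρ k q) (y P) (y Q) (Y P') (Y Q') := by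
    intro ρ hρ y Y
    unfold levelFactor
    rw [prod_prod_eq_mul_prod S, prod_prod_eq_mul_prod T, Finset.prod_product,
      Finset.prod_product, Finset.prod_pair hPQ, Finset.prod_pair hPQ', Finset.prod_pair hPQ',
      Finset.prod_pair hPQ, Finset.prod_pair hPQ, Finset.prod_pair hPQ]
    have e1 : (∏ j : Fin k, ∏ l : Fin (k + 1), if (j, l) ∈ S then 1 else
        cell τ h v ρ k j l (Y l - y j)) = ∏ j, ∏ l, C j l (Y l - y j) := by
      refine Finset.prod_congr rfl fun j _ => Finset.prod_congr rfl fun l _ => ?_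
      simp only [C]
      split_ifs with hjl
      · rfl
      · rw [hρ j l hjl]
    have hpq' : v p < v q := by omega
    rw [e1]
    simp only [hP, hQ, hP', hQ', cell, lt_irrefl, hpq', hpq'.not_gt, if_true, if_false, hne,
      hne.symm, squareFactor, d]
    ring
  clear_value C d
  refine ⟨fun y Y => (∏ j, ∏ l, C j l (Y l - y j)) * ∏ j, ∏ l, d j l (y l - y j),
    fun y Y => ?_, fun y Y => ?_, hlev μ fun _ _ _ => rfl, fun y Y => ?_⟩
  · refine congrArg₂ (· * ·) ?_ ?_
    · rw [← Equiv.prod_comp (Equiv.swap P Q)]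
      refine Finset.prod_congr rfl fun j _ => Finset.prod_congr rfl fun l _ => ?_
      rw [hC1, Function.comp_apply, Equiv.swap_apply_self]
    · rw [← Equiv.prod_comp (Equiv.swap P Q)]
      refine Finset.prod_congr rfl fun j _ => ?_
      rw [← Equiv.prod_comp (Equiv.swap P Q)]
      refine Finset.prod_congr rfl fun l _ => ?_
      rw [hd, Function.comp_apply, Function.comp_apply, Equiv.swap_apply_self,
        Equiv.swap_apply_self]
  · refine congrArg (· * _) ?_
    refine Finset.prod_congr rfl fun j _ => ?_
    rw [← Equiv.prod_comp (Equiv.swap P' Q')]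
    refine Finset.prod_congr rfl fun l _ => ?_
    rw [hC2, Function.comp_apply, Equiv.swap_apply_self]
  · rw [hlev _ hμ]
    have hk : Equiv.swap p q k = k := Equiv.swap_apply_of_ne_of_ne (by omega) (by omega)
    simp only [posParam, Function.comp_apply, hk, Equiv.swap_apply_left, Equiv.swap_apply_right,
      hkp]

/-- Each square contains its own factor `δ(y_2 - y_1, h)`, and the one with exchanged `y` contains
`δ(y_1 - y_2, h)`. Taking out the common factor `δ(y_2 - y_1, h)` therefore leaves exactly
`delta_exchange`, which explains the sign in the second coefficient on the left. -/
theorem squareFactor_exchange {τ : ℂ} (hτ : 0 < τ.im) {y₁ y₂ Y₁ Y₂ D₁ D₂ ν h : ℂ}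
    (hνD : ν = D₁ - D₂) (hh : vtheta τ h ≠ 0) (hν : vtheta τ ν ≠ 0)
    (hy : vtheta τ (y₂ - y₁) ≠ 0) (hY : vtheta τ (Y₂ - Y₁) ≠ 0) :
    delta τ (y₂ - y₁) ν * squareFactor τ h D₂ D₁ y₁ y₂ Y₁ Y₂ +
      delta τ (y₂ - y₁) h * squareFactor τ h D₂ D₁ y₂ y₁ Y₁ Y₂ =
    delta τ (Y₂ - Y₁) ν * squareFactor τ h D₁ D₂ y₁ y₂ Y₁ Y₂ +
      delta τ (Y₁ - Y₂) h * squareFactor τ h D₁ D₂ y₁ y₂ Y₂ Y₁ := by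
  have key := delta_exchange hτ hνD hh hν hy hY
  simp only [squareFactor]
  linear_combination (delta τ (y₂ - y₁) h / (vtheta τ D₁ * vtheta τ D₂ * vtheta τ h)) * key

/-- A level intertwines the operation in its lower variables `y` with the one in its upper variables
`Y`. Both dynamical parameters involve `h` in the same way, so their difference is `μ q - μ p` at
every level. -/
theorem levelFactor_exchange (hv : v.Injective) (hpq : v q = v p + 1) {τ : ℂ} (hτ : 0 < τ.im)
    {h : ℂ} {μ : ℕ → ℂ} (hh : vtheta τ h ≠ 0) (hμ : vtheta τ (μ q - μ p) ≠ 0)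
    {k : ℕ} (hp : p < k) (hq : q < k) {y : Fin k → ℂ} {Y : Fin (k + 1) → ℂ}
    (hy : vtheta τ (y ⟨q, hq⟩ - y ⟨p, hp⟩) ≠ 0)
    (hY : vtheta τ (Y ⟨q, by omega⟩ - Y ⟨p, by omega⟩) ≠ 0) :
    delta τ (y ⟨q, hq⟩ - y ⟨p, hp⟩) (μ q - μ p) *
        levelFactor τ h v (μ ∘ Equiv.swap p q) k y Y +
      delta τ (y ⟨q, hq⟩ - y ⟨p, hp⟩) h *
        levelFactor τ h v (μ ∘ Equiv.swap p q) k (y ∘ Equiv.swap ⟨p, hp⟩ ⟨q, hq⟩) Y =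
    delta τ (Y ⟨q, by omega⟩ - Y ⟨p, by omega⟩) (μ q - μ p) * levelFactor τ h v μ k y Y +
      delta τ (Y ⟨p, by omega⟩ - Y ⟨q, by omega⟩) h *
        levelFactor τ h v μ k y (Y ∘ Equiv.swap ⟨p, by omega⟩ ⟨q, by omega⟩) := by
  obtain ⟨R, h1, h2, h3, h4⟩ := levelFactor_eq_mul_squareFactor hv hpq τ h μ hp hq
  simp only [h3, h4, h1, h2, Function.comp_apply, Equiv.swap_apply_left, Equiv.swap_apply_right]
  have hne : p ≠ q := by rintro rfl; omega
  have hD : μ q - μ p = posParam h v μ k p - posParam h v μ k q := by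
    simp only [posParam, (lt_iff_of_adjacent hv hpq (c := k) (by omega) (by omega)).1]
    ring
  have key := squareFactor_exchange hτ hD hh hμ hy hY
  linear_combination R y Y * key

end swap

end EllipticLink
end

/-! ### Exchange of two adjacent values in the symmetrised weight functions. -/

noncomputable section
namespace EllipticLink

section swap

variable {v : ℕ → ℕ} {p q : ℕ}

/-- The start of the recursion: at this level `q` is the newest column and has no row. Only the
cells of row `p` in the columns `p` and `q` are affected, and there the claim is
`delta_mul_vtheta_add`. -/
theorem levelFactor_swap_eq (hv : v.Injective) (hpq : v q = v p + 1) (hlt : p < q) {τ : ℂ}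
    (hτ : 0 < τ.im) {h : ℂ} {μ : ℕ → ℂ} (hh : vtheta τ h ≠ 0) (hμ : vtheta τ (μ q - μ p) ≠ 0)
    (hμ' : vtheta τ (h + (μ q - μ p)) ≠ 0) (y : Fin q → ℂ) {Y : Fin (q + 1) → ℂ}
    (hY : vtheta τ (Y ⟨q, by omega⟩ - Y ⟨p, by omega⟩) ≠ 0) :
    levelFactor τ h (v ∘ Equiv.swap p q) μ q y (Y ∘ Equiv.swap ⟨p, by omega⟩ ⟨q, by omega⟩) =
    delta τ (Y ⟨q, by omega⟩ - Y ⟨p, by omega⟩) (μ q - μ p) * levelFactor τ h v μ q y Y +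
      delta τ (Y ⟨p, by omega⟩ - Y ⟨q, by omega⟩) h *
        levelFactor τ h v μ q y (Y ∘ Equiv.swap ⟨p, by omega⟩ ⟨q, by omega⟩) := by
  have hne : p ≠ q := hlt.ne
  set P : Fin q := ⟨p, hlt⟩ with hP
  set P' : Fin (q + 1) := ⟨p, by omega⟩ with hP'
  set Q' : Fin (q + 1) := ⟨q, by omega⟩ with hQ'
  have hPQ' : P' ≠ Q' := by simpa [hP', hQ'] using hne
  let S : Finset (Fin q × Fin (q + 1)) := {P} ×ˢ {P', Q'}
  have hP1 : ∀ j : Fin q, j = P ↔ (j : ℕ) = p := fun j => by simp [hP, Fin.ext_iff]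
  have hP1' : ∀ j : Fin (q + 1), j = P' ↔ (j : ℕ) = p := fun j => by simp [hP', Fin.ext_iff]
  have hQ1' : ∀ j : Fin (q + 1), j = Q' ↔ (j : ℕ) = q := fun j => by simp [hQ', Fin.ext_iff]
  have hsw' : ∀ j : Fin (q + 1),
      Equiv.swap P' Q' j = P' ∨ Equiv.swap P' Q' j = Q' ↔ j = P' ∨ j = Q' := by
    intro j
    rw [Equiv.swap_apply_eq_iff, Equiv.swap_apply_eq_iff, Equiv.swap_apply_left,
      Equiv.swap_apply_right, or_comm]
  have hS : ∀ j l, (j, l) ∈ S ↔ j = P ∧ (l = P' ∨ l = Q') := fun j l => by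
    simp [S, and_or_left]
  have hcol : ∀ j : Fin q, j ≠ P → cell τ h v μ q j p = cell τ h v μ q j q := by
    intro j hj
    rw [Ne, hP1] at hj
    have hj' : (j : ℕ) ≠ q := by omega
    funext x
    simp only [cell, (lt_iff_of_adjacent hv hpq hj hj').2, Ne.symm hj, Ne.symm hj', if_false]
  have hswap : ∀ (j : Fin q) (l : Fin (q + 1)), (j, l) ∉ S →
      cell τ h (v ∘ Equiv.swap p q) μ q j (Equiv.swap P' Q' l : Fin (q + 1)) =
        cell τ h v μ q j l := by
    intro j l hjl
    rw [hS, hP1, hP1', hQ1'] at hjl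
    funext x
    rw [swap_fin_coe]
    change cell τ h (v ∘ Equiv.swap p q) μ q j (Equiv.swap p q l) x = _
    have hjq : (j : ℕ) ≠ q := by omega
    by_cases hj : (j : ℕ) = p
    · have hl : (l : ℕ) ≠ p ∧ (l : ℕ) ≠ q := by omega
      simp only [cell, Function.comp_apply, Equiv.swap_apply_self, hj, Equiv.swap_apply_left,
        (lt_iff_of_adjacent hv hpq hl.1 hl.2).1]
      rw [Equiv.swap_apply_of_ne_of_ne hl.1 hl.2]
      simp only [hl.1, if_false]
    · have hs : Equiv.swap p q j = j := Equiv.swap_apply_of_ne_of_ne hj hjq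
      have hs' : Equiv.swap p q l = j ↔ (l : ℕ) = j := by
        rw [Equiv.swap_apply_eq_iff, hs]
      simp only [cell, posParam, Function.comp_apply, Equiv.swap_apply_self, hs, hs',
        Equiv.swap_apply_right, (lt_iff_of_adjacent hv hpq hj hjq).2]
  let C : Fin q → Fin (q + 1) → ℂ → ℂ := fun j l x =>
    if (j, l) ∈ S then 1 else cell τ h v μ q j l x
  have hC : ∀ j l, C j (Equiv.swap P' Q' l) = C j l := by
    intro j l
    funext x
    simp only [C, hS, hsw']
    by_cases hj : j = P
    · by_cases hl : l = P' ∨ l = Q'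
      · simp [hl, hj]
      · rw [not_or] at hl
        rw [Equiv.swap_apply_of_ne_of_ne hl.1 hl.2]
    · simp only [hj, false_and, if_false]
      by_cases hl : l = P'
      · rw [hl, Equiv.swap_apply_left]
        exact (congrFun (hcol j hj) x).symm
      · by_cases hl' : l = Q'
        · rw [hl', Equiv.swap_apply_right]
          exact congrFun (hcol j hj) x
        · rw [Equiv.swap_apply_of_ne_of_ne hl hl']
  have hpq' : v p < v q := by omega
  let d : ℂ := ∏ j : Fin q, ∏ l : Fin q, if v j < v l then delta τ (y l - y j) h else 1
  have hlev : ∀ Y, levelFactor τ h v μ q y Y = (∏ j, ∏ l, C j l (Y l - y j)) * d *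
      (vtheta τ (Y P' - y P + (h + (μ q - μ p))) / vtheta τ (h + (μ q - μ p)) *
        vtheta τ (Y Q' - y P)) := by
    intro Y
    unfold levelFactor
    rw [prod_prod_eq_mul_prod S, Finset.prod_product, Finset.prod_singleton,
      Finset.prod_pair hPQ']
    simp only [hP, hP', hQ', cell, posParam, lt_irrefl, hpq'.not_gt, if_true, if_false,
      hne.symm, C, d, add_sub_assoc]
    ring
  have hlev' : levelFactor τ h (v ∘ Equiv.swap p q) μ q y (Y ∘ Equiv.swap P' Q') =
      (∏ j, ∏ l, C j l (Y l - y j)) * d *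
      (vtheta τ (Y P' - y P + h) / vtheta τ h *
        (vtheta τ (Y Q' - y P + (μ q - μ p)) / vtheta τ (μ q - μ p))) := by
    have e : ∏ j : Fin q, ∏ l : Fin (q + 1), cell τ h (v ∘ Equiv.swap p q) μ q j l
        ((Y ∘ Equiv.swap P' Q') l - y j) = ∏ j : Fin q, ∏ l : Fin (q + 1),
          cell τ h (v ∘ Equiv.swap p q) μ q j (Equiv.swap P' Q' l : Fin (q + 1)) (Y l - y j) := by
      refine Finset.prod_congr rfl fun j _ => ?_
      rw [← Equiv.prod_comp (Equiv.swap P' Q')]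
      refine Finset.prod_congr rfl fun l _ => ?_
      rw [Function.comp_apply, Equiv.swap_apply_self]
    have e' : (∏ j : Fin q, ∏ l : Fin q,
        if (v ∘ Equiv.swap p q) j < (v ∘ Equiv.swap p q) l then delta τ (y l - y j) h else 1) =
        d := by
      refine Finset.prod_congr rfl fun j _ => Finset.prod_congr rfl fun l _ => ?_
      simp only [Function.comp_apply,
        swap_lt_swap_iff hv hpq (a := j) (b := l) (by omega) (by omega)]
    unfold levelFactor
    rw [e, e', prod_prod_eq_mul_prod S, Finset.prod_product, Finset.prod_singleton,
      Finset.prod_pair hPQ', Equiv.swap_apply_left, Equiv.swap_apply_right]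
    have e1 : (∏ j : Fin q, ∏ l : Fin (q + 1), if (j, l) ∈ S then 1 else
        cell τ h (v ∘ Equiv.swap p q) μ q j (Equiv.swap P' Q' l : Fin (q + 1)) (Y l - y j)) =
        ∏ j, ∏ l, C j l (Y l - y j) := by
      refine Finset.prod_congr rfl fun j _ => Finset.prod_congr rfl fun l _ => ?_
      simp only [C]
      split_ifs with hjl
      · rfl
      · rw [hswap j l hjl]
    rw [e1]
    simp only [hP, hP', hQ', cell, posParam, Function.comp_apply, Equiv.swap_apply_left,
      Equiv.swap_apply_right, lt_irrefl, hpq', if_true, if_false, zero_add]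
    ring
  have hR : ∏ j, ∏ l, C j l ((Y ∘ Equiv.swap P' Q') l - y j) = ∏ j, ∏ l, C j l (Y l - y j) := by
    refine Finset.prod_congr rfl fun j _ => ?_
    rw [← Equiv.prod_comp (Equiv.swap P' Q')]
    refine Finset.prod_congr rfl fun l _ => ?_
    rw [hC, Function.comp_apply, Equiv.swap_apply_self]
  have key := delta_mul_vtheta_add hτ (X := Y P' - y P) (W := Y Q' - y P) hh hμ hμ'
    (by rwa [sub_sub_sub_cancel_right])
  rw [sub_sub_sub_cancel_right, sub_sub_sub_cancel_right] at key
  rw [hlev', hlev, hlev, hR]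
  simp only [Function.comp_apply, Equiv.swap_apply_left, Equiv.swap_apply_right]
  linear_combination (-(∏ j, ∏ l, C j l (Y l - y j)) * d) * key

theorem symSum_swap_of_le (hv : v.Injective) (hpq : v q = v p + 1) (τ h : ℂ) (μ : ℕ → ℂ)
    (t : (k : ℕ) → Fin k → ℂ) {k : ℕ} (hk : k ≤ q) (Y : Fin k → ℂ) :
    symSum (levelFactor τ h (v ∘ Equiv.swap p q) μ) t k Y =
      symSum (levelFactor τ h v μ) t k Y := by
  induction k with
  | zero => simp only [symSum]
  | succ k ih =>
    simp only [symSum]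
    refine Finset.sum_congr rfl fun s _ => ?_
    rw [ih (by omega), levelFactor_swap_of_lt hv hpq τ h μ (by omega)]

/-- The recursion in the last variables for weight functions. -/
theorem symSum_swap (hv : v.Injective) (hpq : v q = v p + 1) (hlt : p < q) {τ : ℂ}
    (hτ : 0 < τ.im) {h : ℂ} {μ : ℕ → ℂ} (hh : vtheta τ h ≠ 0) (hμ : vtheta τ (μ q - μ p) ≠ 0)
    (hμ' : vtheta τ (h + (μ q - μ p)) ≠ 0) {t : (k : ℕ) → Fin k → ℂ} {n : ℕ}
    (ht : ∀ k, k < n → ∀ a b, a ≠ b → vtheta τ (t k a - t k b) ≠ 0) {k : ℕ} (hk : k ≤ n)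
    (hq : q < k) {Y : Fin k → ℂ}
    (hY : vtheta τ (Y ⟨q, hq⟩ - Y ⟨p, by omega⟩) ≠ 0) :
    symSum (levelFactor τ h (v ∘ Equiv.swap p q) μ) t k
        (Y ∘ Equiv.swap ⟨p, by omega⟩ ⟨q, hq⟩) =
      delta τ (Y ⟨q, hq⟩ - Y ⟨p, by omega⟩) (μ q - μ p) * symSum (levelFactor τ h v μ) t k Y +
      delta τ (Y ⟨p, by omega⟩ - Y ⟨q, hq⟩) h *
        symSum (levelFactor τ h v μ) t k (Y ∘ Equiv.swap ⟨p, by omega⟩ ⟨q, hq⟩) := by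
  induction k with
  | zero => omega
  | succ k ih =>
    simp only [symSum]
    rcases Nat.lt_succ_iff_lt_or_eq.1 hq with hqk | rfl
    · set σ : Equiv.Perm (Fin k) := Equiv.swap ⟨p, by omega⟩ ⟨q, hqk⟩ with hσ
      have hinj : ∀ s : Equiv.Perm (Fin k),
          vtheta τ ((t k ∘ s) ⟨q, hqk⟩ - (t k ∘ s) ⟨p, by omega⟩) ≠ 0 := fun s =>
        ht k (by omega) _ _ (s.injective.ne (by simpa using hlt.ne'))
      have hre : ∀ F : Equiv.Perm (Fin k) → ℂ, ∑ s, F (s * σ) = ∑ s, F s := fun F =>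
        Equiv.sum_comp (Equiv.mulRight σ) F
      have hcoe : ∀ s : Equiv.Perm (Fin k), t k ∘ ⇑(s * σ) = (t k ∘ s) ∘ σ := fun s => by
        rw [Equiv.Perm.coe_mul, Function.comp_assoc]
      rw [← hre]
      have e1 : ∀ s : Equiv.Perm (Fin k), symSum (levelFactor τ h (v ∘ Equiv.swap p q) μ) t k
          (t k ∘ ⇑(s * σ)) *
          levelFactor τ h (v ∘ Equiv.swap p q) μ k
            (t k ∘ ⇑(s * σ))
            (Y ∘ Equiv.swap ⟨p, by omega⟩ ⟨q, hq⟩) =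
          delta τ ((t k ∘ s) ⟨q, hqk⟩ - (t k ∘ s) ⟨p, by omega⟩) (μ q - μ p) *
            symSum (levelFactor τ h v μ) t k (t k ∘ s) *
            levelFactor τ h v (μ ∘ Equiv.swap p q) k (t k ∘ s) Y +
          delta τ ((t k ∘ s) ⟨p, by omega⟩ - (t k ∘ s) ⟨q, hqk⟩) h *
            symSum (levelFactor τ h v μ) t k (t k ∘ s ∘ σ) *
            levelFactor τ h v (μ ∘ Equiv.swap p q) k (t k ∘ s) Y := fun s => by
        rw [hcoe, ih (by omega) hqk (hinj s), levelFactor_swap_comp_swap τ h v μ _ hqk]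
        simp only [hσ, Function.comp_assoc, add_mul]
      simp only [e1]
      rw [Finset.sum_add_distrib]
      -- A second substitution, in this half only, gives both halves the same factor from the lower
      -- levels. The exchange relation then applies to each summand.
      have e2 : ∑ s : Equiv.Perm (Fin k),
          delta τ ((t k ∘ s) ⟨p, by omega⟩ - (t k ∘ s) ⟨q, hqk⟩) h *
            symSum (levelFactor τ h v μ) t k (t k ∘ s ∘ σ) *
            levelFactor τ h v (μ ∘ Equiv.swap p q) k (t k ∘ s) Y =
          ∑ s : Equiv.Perm (Fin k),
          delta τ ((t k ∘ s) ⟨q, hqk⟩ - (t k ∘ s) ⟨p, by omega⟩) h *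
            symSum (levelFactor τ h v μ) t k (t k ∘ s) *
            levelFactor τ h v (μ ∘ Equiv.swap p q) k ((t k ∘ s) ∘ σ) Y := by
        rw [← hre]
        refine Finset.sum_congr rfl fun s _ => ?_
        have a2 : t k ∘ ⇑(s * σ) ∘ σ = t k ∘ s := by
          funext j
          simp [hσ]
        rw [a2, hcoe]
        simp only [hσ, Function.comp_apply, Equiv.swap_apply_left, Equiv.swap_apply_right]
      rw [e2, ← Finset.sum_add_distrib, Finset.mul_sum, Finset.mul_sum, ← Finset.sum_add_distrib]
      refine Finset.sum_congr rfl fun s _ => ?_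
      have key := levelFactor_exchange hv hpq hτ hh hμ (k := k) (by omega) hqk (hinj s) hY
      linear_combination symSum (levelFactor τ h v μ) t k (t k ∘ s) * key
    · rw [Finset.mul_sum, Finset.mul_sum, ← Finset.sum_add_distrib]
      refine Finset.sum_congr rfl fun s _ => ?_
      rw [symSum_swap_of_le hv hpq τ h μ t le_rfl,
        levelFactor_swap_eq hv hpq hlt hτ hh hμ hμ' _ hY]
      ring

end swap

end EllipticLink
end

/-! ### From the sorted indexing of the definition to the indexing by positions. -/

noncomputable section
namespace EllipticLink

theorem symSum_congr (lev : (k : ℕ) → (Fin k → ℂ) → (Fin (k + 1) → ℂ) → ℂ)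
    {t t' : (k : ℕ) → Fin k → ℂ} {k : ℕ} (ht : ∀ i, i < k → t i = t' i) (Y : Fin k → ℂ) :
    symSum lev t k Y = symSum lev t' k Y := by
  induction k with
  | zero => simp only [symSum]
  | succ k ih =>
    simp only [symSum]
    refine Finset.sum_congr rfl fun s _ => ?_
    rw [ht k (Nat.lt_succ_self k), ih fun i hi => ht i (by omega)]

theorem permuteT_snoc {n : ℕ} (s : (k : Fin n) → Equiv.Perm (Fin k)) (σ : Equiv.Perm (Fin n))
    (t : (k : ℕ) → Fin k → ℂ) {k : ℕ} (hk : k ≤ n) :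
    permuteT (n := n + 1) (Fin.snoc (α := fun k : Fin (n + 1) => Equiv.Perm (Fin k)) s σ) t k =
      permuteT s (Function.update t n (t n ∘ σ)) k := by
  funext a
  rcases hk.lt_or_eq with h | rfl
  · have e : (⟨k, Nat.lt_succ_of_lt h⟩ : Fin (n + 1)) = Fin.castSucc ⟨k, h⟩ := rfl
    have e2 : Function.update t n (t n ∘ σ) k = t k := Function.update_of_ne h.ne _ _
    simp only [permuteT, Nat.lt_succ_of_lt h, h, dif_pos]
    rw [e2]
    congr 1
    have := Fin.snoc_castSucc (α := fun k : Fin (n + 1) => Equiv.Perm (Fin k)) σ s ⟨k, h⟩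
    exact congrArg (fun f : Equiv.Perm (Fin k) => f a) this
  · have e2 : Function.update t k (t k ∘ σ) k = t k ∘ σ := Function.update_self _ _ _
    simp only [permuteT, Nat.lt_succ_self, lt_irrefl, dif_pos, dif_neg, not_false_eq_true]
    rw [e2]
    have := Fin.snoc_last (α := fun j : Fin (k + 1) => Equiv.Perm (Fin j)) σ s
    exact congrArg (fun f : Equiv.Perm (Fin k) => t k (f a)) this

/-- The sum over all families of permutations as an iterated symmetrisation. -/
theorem sum_prod_permuteT (lev : (k : ℕ) → (Fin k → ℂ) → (Fin (k + 1) → ℂ) → ℂ) (n : ℕ)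
    (t : (k : ℕ) → Fin k → ℂ) :
    ∑ s : (k : Fin n) → Equiv.Perm (Fin k),
      ∏ k : Fin n, lev k (permuteT s t k) (permuteT s t (k + 1)) = symSum lev t n (t n) := by
  induction n generalizing t with
  | zero => simp [symSum]
  | succ n ih =>
    rw [← Equiv.sum_comp (Fin.snocEquiv fun k : Fin (n + 1) => Equiv.Perm (Fin k)),
      Fintype.sum_prod_type, symSum]
    refine Finset.sum_congr rfl fun σ _ => ?_
    -- The permutation of the top level is absorbed into the variables, so that the induction
    -- hypothesis sees it only through `t n ∘ σ`.
    have h1 := ih (Function.update t n (t n ∘ σ))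
    rw [Function.update_self, symSum_congr lev (t' := t)
      (fun i hi => Function.update_of_ne hi.ne _ _)] at h1
    change Equiv.Perm (Fin n) at σ
    rw [← h1, Finset.sum_mul]
    refine Finset.sum_congr rfl fun s _ => ?_
    rw [Fin.prod_univ_castSucc]
    refine congrArg₂ (· * ·) ?_ ?_
    · refine Finset.prod_congr rfl fun k _ => ?_
      exact congrArg₂ (lev k) (permuteT_snoc s σ t k.2.le) (permuteT_snoc s σ t k.2)
    · have e1 : permuteT (n := n + 1) (Fin.snoc (α := fun k : Fin (n + 1) => Equiv.Perm (Fin k))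
          s σ) t n = t n ∘ σ := by
        rw [permuteT_snoc s σ t le_rfl]
        funext a
        simp [permuteT]
      have e2 : permuteT (n := n + 1) (Fin.snoc (α := fun k : Fin (n + 1) => Equiv.Perm (Fin k))
          s σ) t (n + 1) = t (n + 1) := by
        funext a
        simp [permuteT]
      exact congrArg₂ (lev n) e1 e2

/-- Renaming the indices of an inner level is absorbed by the sum over its permutations; only the
renaming of the uppermost, unsymmetrised variables remains visible. -/
theorem symSum_reindex {lev₁ lev₂ : (k : ℕ) → (Fin k → ℂ) → (Fin (k + 1) → ℂ) → ℂ}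
    (t : (k : ℕ) → Fin k → ℂ) (π : (k : ℕ) → Equiv.Perm (Fin k)) {n : ℕ}
    (h : ∀ k, k < n → ∀ y Y, lev₁ k (y ∘ π k) (Y ∘ π (k + 1)) = lev₂ k y Y) {k : ℕ} (hk : k ≤ n)
    (Y : Fin k → ℂ) : symSum lev₁ t k (Y ∘ π k) = symSum lev₂ t k Y := by
  induction k with
  | zero => simp only [symSum]
  | succ k ih =>
    simp only [symSum]
    have hre : ∀ F : Equiv.Perm (Fin k) → ℂ, ∑ s, F (s * π k) = ∑ s, F s := fun F =>
      Equiv.sum_comp (Equiv.mulRight (π k)) F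
    rw [← hre]
    refine Finset.sum_congr rfl fun s _ => ?_
    have : t k ∘ ⇑(s * π k) = (t k ∘ s) ∘ π k := by
      rw [Equiv.Perm.coe_mul, Function.comp_assoc]
    rw [this, ih (by omega), h k hk]

/-- The values of a permutation as an injective sequence of natural numbers. -/
def valSeq {n : ℕ} (ω : Equiv.Perm (Fin n)) (j : ℕ) : ℕ :=
  if h : j < n then ω ⟨j, h⟩ else j

theorem valSeq_injective {n : ℕ} (ω : Equiv.Perm (Fin n)) : (valSeq ω).Injective := by
  intro a b hab
  unfold valSeq at hab
  split_ifs at hab with h1 h2 h2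
  · simpa using ω.injective (Fin.ext hab)
  · have := (ω ⟨a, h1⟩).2; omega
  · have := (ω ⟨b, h2⟩).2; omega
  · exact hab

theorem valSeq_coe {n : ℕ} (ω : Equiv.Perm (Fin n)) (j : Fin n) : valSeq ω j = ω j := by
  simp [valSeq]

/-- A finite sequence extended by zero. -/
def extendSeq {n : ℕ} (μ : Fin n → ℂ) (j : ℕ) : ℂ := if h : j < n then μ ⟨j, h⟩ else 0

theorem extendSeq_coe {n : ℕ} (μ : Fin n → ℂ) (j : Fin n) : extendSeq μ j = μ j := by
  simp [extendSeq]

theorem symm_sortedValue_lt {n : ℕ} (ω : Equiv.Perm (Fin n)) {k : ℕ} (hk : k ≤ n) (a : Fin k) :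
    (ω.symm (sortedValue ω hk a) : ℕ) < k := by
  have : sortedValue ω hk a ∈ firstValues ω k := Finset.orderEmbOfFin_mem _ _ _
  simp only [firstValues, Finset.mem_map, Finset.mem_filter, Finset.mem_univ, true_and,
    Equiv.coe_toEmbedding] at this
  obtain ⟨j, hj, hj'⟩ := this
  rwa [← hj', Equiv.symm_apply_apply]

/-- The position of the `a`-th smallest of the first `k` values. -/
def positionPerm {n : ℕ} (ω : Equiv.Perm (Fin n)) (k : ℕ) : Equiv.Perm (Fin k) :=
  if hk : k ≤ n then
    Equiv.ofBijective (fun a => ⟨ω.symm (sortedValue ω hk a), symm_sortedValue_lt ω hk a⟩)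
      (Finite.injective_iff_bijective.1 fun a b hab => by
        have := ω.symm.injective (Fin.ext (Fin.mk.inj hab))
        exact (Finset.orderEmbOfFin _ _).injective this)
  else 1

theorem positionPerm_coe {n : ℕ} (ω : Equiv.Perm (Fin n)) {k : ℕ} (hk : k ≤ n) (a : Fin k) :
    (positionPerm ω k a : ℕ) = ω.symm (sortedValue ω hk a) := by
  simp [positionPerm, hk]

theorem valSeq_positionPerm {n : ℕ} (ω : Equiv.Perm (Fin n)) {k : ℕ} (hk : k ≤ n) (a : Fin k) :
    valSeq ω (positionPerm ω k a) = sortedValue ω hk a := by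
  rw [positionPerm_coe ω hk, valSeq_coe, Equiv.apply_symm_apply]

/-- All values are present at the top level, so sorting them changes nothing. This is how `z ∘ ω`
arises as the top variables. -/
theorem positionPerm_self {n : ℕ} (ω : Equiv.Perm (Fin n)) : positionPerm ω n = ω.symm := by
  ext a
  rw [positionPerm_coe ω le_rfl]
  have : id = ⇑((firstValues ω n).orderEmbOfFin (card_firstValues ω le_rfl)) :=
    Finset.orderEmbOfFin_unique _ (fun x => by simp [firstValues]) strictMono_id
  rw [sortedValue, ← this, id]

theorem prod_psi_eq_levelFactor {n : ℕ} (τ h : ℂ) (μ : Fin n → ℂ) (ω : Equiv.Perm (Fin n)) {k : ℕ}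
    (hk : k < n) (y : Fin k → ℂ) (Y : Fin (k + 1) → ℂ) :
    ∏ a : Fin k, ((∏ b : Fin (k + 1), psi τ h μ ω k hk a b
        ((Y ∘ positionPerm ω (k + 1)) b - (y ∘ positionPerm ω k) a)) *
      ∏ b : Fin k, if a < b then
        delta τ ((y ∘ positionPerm ω k) b - (y ∘ positionPerm ω k) a) h else 1) =
    levelFactor τ h (valSeq ω) (extendSeq μ) k y Y := by
  rw [Finset.prod_mul_distrib, levelFactor]
  refine congrArg₂ (· * ·) (Eq.symm ?_) (Eq.symm ?_)
  · rw [← Equiv.prod_comp (positionPerm ω k)]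
    refine Finset.prod_congr rfl fun a _ => ?_
    rw [← Equiv.prod_comp (positionPerm ω (k + 1))]
    refine Finset.prod_congr rfl fun b _ => ?_
    have h1 := valSeq_positionPerm ω hk.le a
    have h2 := valSeq_positionPerm ω (Nat.succ_le_of_lt hk) b
    have h3 : valSeq ω k = ω ⟨k, hk⟩ := valSeq_coe ω ⟨k, hk⟩
    have h4 : extendSeq μ k = μ ⟨k, hk⟩ := extendSeq_coe μ ⟨k, hk⟩
    have h5 : extendSeq μ (positionPerm ω k a) = μ (ω.symm (sortedValue ω hk.le a)) := by
      rw [positionPerm_coe ω hk.le, extendSeq_coe]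
    have h6 : (positionPerm ω (k + 1) b : ℕ) = positionPerm ω k a ↔
        sortedValue ω (Nat.succ_le_of_lt hk) b = sortedValue ω hk.le a := by
      rw [positionPerm_coe ω hk.le, positionPerm_coe ω (Nat.succ_le_of_lt hk), ← Fin.ext_iff,
        ω.symm.injective.eq_iff]
    simp only [psi, cell, posParam, dynParam, h1, h2, h3, h4, h5, h6, Fin.lt_def,
      Function.comp_apply]
  · rw [← Equiv.prod_comp (positionPerm ω k)]
    refine Finset.prod_congr rfl fun a _ => ?_
    rw [← Equiv.prod_comp (positionPerm ω k)]
    refine Finset.prod_congr rfl fun b _ => ?_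
    simp only [valSeq_positionPerm ω hk.le, ← Fin.lt_def, sortedValue, OrderEmbedding.lt_iff_lt, Function.comp_apply]

theorem sum_weightU {n : ℕ} (τ h : ℂ) (μ : Fin n → ℂ) (ω : Equiv.Perm (Fin n))
    (t : (k : ℕ) → Fin k → ℂ) :
    ∑ s : (k : Fin n) → Equiv.Perm (Fin k), weightU τ h μ ω (permuteT s t) =
      symSum (levelFactor τ h (valSeq ω) (extendSeq μ)) t n (t n ∘ ω) := by
  let lev : (k : ℕ) → (Fin k → ℂ) → (Fin (k + 1) → ℂ) → ℂ := fun k y Y =>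
    if hk : k < n then ∏ a : Fin k, ((∏ b : Fin (k + 1), psi τ h μ ω k hk a b (Y b - y a)) *
      ∏ b : Fin k, if a < b then delta τ (y b - y a) h else 1) else 1
  have h1 : ∀ s : (k : Fin n) → Equiv.Perm (Fin k), weightU τ h μ ω (permuteT s t) =
      ∏ k : Fin n, lev k (permuteT s t k) (permuteT s t (k + 1)) := fun s => by
    simp [weightU, lev]
  simp only [h1]
  have h2 := symSum_reindex (lev₁ := lev) (lev₂ := levelFactor τ h (valSeq ω) (extendSeq μ)) t
    (positionPerm ω) (n := n) (fun k hk y Y => by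
      simp only [lev, hk, dif_pos]
      exact prod_psi_eq_levelFactor τ h μ ω hk y Y) le_rfl (t n ∘ ω)
  rw [positionPerm_self, Function.comp_assoc, Equiv.self_comp_symm, Function.comp_id] at h2
  rw [sum_prod_permuteT lev n t, h2]

variable {r : ℕ}

/-- The variables `t^{(k)} = (γ_1, …, γ_k)`. -/
def gammaVars (γ : Fin r → ℂ) (k : ℕ) (a : Fin k) : ℂ := extendSeq γ a

/-- The denominator of the weight function. -/
def weightDenom (τ h : ℂ) (γ : Fin r → ℂ) : ℂ :=
  ∏ k : Fin (r + 1), ∏ a : Fin k, ∏ b : Fin k,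
    if a ≠ b then vtheta τ (h + gammaVars γ k a - gammaVars γ k b) / vtheta τ h else 1

theorem weightFunction_eq (τ h : ℂ) (z : Fin (r + 1) → ℂ) (γ : Fin r → ℂ) (μ : Fin (r + 1) → ℂ)
    (ω : Equiv.Perm (Fin (r + 1))) :
    weightFunction τ h z γ μ ω =
      symSum (levelFactor τ h (valSeq ω) (extendSeq μ)) (gammaVars γ) (r + 1) (z ∘ ω) /
        weightDenom τ h γ := by
  have ht : ∀ k, k < r + 1 → (fun a : Fin k => if hk : k ≤ r then γ ⟨a, by omega⟩ else
      if hk' : k = r + 1 then z ⟨a, by omega⟩ else 0) = gammaVars γ k := fun k hk => by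
    funext a
    have h1 : k ≤ r := by omega
    have h2 : (a : ℕ) < r := by omega
    simp [gammaVars, extendSeq, h1, h2]
  rw [weightFunction, weightT, sum_weightU]
  refine congrArg₂ (· / ·) ?_ ?_
  · rw [symSum_congr _ (t' := gammaVars γ) ht]
    congr 2
    funext a
    simp
  · refine Finset.prod_congr rfl fun k _ => Finset.prod_congr rfl fun a _ =>
      Finset.prod_congr rfl fun b _ => ?_
    rw [← congrFun (ht k k.2) a, ← congrFun (ht k k.2) b]

theorem gammaVars_ne {τ : ℂ} {γ : Fin r → ℂ}
    (hγ : ∀ i j, i ≠ j → vtheta τ (γ i - γ j) ≠ 0) {k : ℕ} (hk : k < r + 1) (a b : Fin k)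
    (hab : a ≠ b) : vtheta τ (gammaVars γ k a - gammaVars γ k b) ≠ 0 := by
  have h1 : (a : ℕ) < r := by omega
  have h2 : (b : ℕ) < r := by omega
  simp only [gammaVars, extendSeq, h1, h2, dif_pos]
  exact hγ _ _ fun h => hab (Fin.ext (Fin.mk.inj h))

/-- The recursion in the `z`-variables for elliptic weight functions. -/
theorem weightFunction_swap {τ : ℂ} (hτ : 0 < τ.im) {h : ℂ} {z : Fin (r + 1) → ℂ}
    {γ : Fin r → ℂ} {μ : Fin (r + 1) → ℂ} (ω : Equiv.Perm (Fin (r + 1))) (i : Fin r)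
    (hω : ω.symm i.castSucc < ω.symm i.succ) (hh : vtheta τ h ≠ 0)
    (hz : ∀ i j, i ≠ j → vtheta τ (z i - z j) ≠ 0)
    (hγ : ∀ i j, i ≠ j → vtheta τ (γ i - γ j) ≠ 0)
    (hμ : ∀ i j, i < j → vtheta τ (μ j - μ i) ≠ 0 ∧ vtheta τ (h + μ j - μ i) ≠ 0) :
    weightFunction τ h z γ μ (Equiv.swap i.castSucc i.succ * ω) =
      delta τ (z i.succ - z i.castSucc) (μ (ω.symm i.succ) - μ (ω.symm i.castSucc)) *
        weightFunction τ h z γ μ ω +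
      delta τ (z i.castSucc - z i.succ) h *
        weightFunction τ h (z ∘ Equiv.swap i.castSucc i.succ) γ μ ω := by
  obtain ⟨p, hp⟩ : ∃ p, p = ω.symm i.castSucc := ⟨_, rfl⟩
  obtain ⟨q, hq⟩ : ∃ q, q = ω.symm i.succ := ⟨_, rfl⟩
  have hωp : ω p = i.castSucc := by rw [hp, Equiv.apply_symm_apply]
  have hωq : ω q = i.succ := by rw [hq, Equiv.apply_symm_apply]
  rw [← hp, ← hq] at hω ⊢
  -- Exchanging the values `i, i + 1` after `ω` is exchanging the positions `p < q` before `ω`, so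
  -- the recursion by positions applies.
  have hswap : Equiv.swap i.castSucc i.succ * ω = ω * Equiv.swap p q := by
    rw [Equiv.mul_swap_eq_swap_mul, hωp, hωq]
  have hval : valSeq (ω * Equiv.swap p q) = valSeq ω ∘ Equiv.swap (p : ℕ) q := by
    funext j
    by_cases hj : j < r + 1
    · have := valSeq_coe (ω * Equiv.swap p q) ⟨j, hj⟩
      rw [Equiv.Perm.mul_apply, ← valSeq_coe ω, swap_fin_coe] at this
      exact this
    · have e : Equiv.swap (p : ℕ) q j = j :=
        Equiv.swap_apply_of_ne_of_ne (by omega) (by omega)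
      simp [valSeq, hj, e]
  have hpq : valSeq ω q = valSeq ω p + 1 := by
    rw [valSeq_coe, valSeq_coe, hωp, hωq]; simp
  have hz1 : z ∘ ⇑(ω * Equiv.swap p q) = (z ∘ ω) ∘ Equiv.swap p q := by
    rw [Equiv.Perm.coe_mul, Function.comp_assoc]
  have hz2 : (z ∘ ⇑(Equiv.swap i.castSucc i.succ)) ∘ ω = (z ∘ ω) ∘ Equiv.swap p q := by
    rw [← hz1, ← hswap, Equiv.Perm.coe_mul, Function.comp_assoc]
  have key := symSum_swap (valSeq_injective ω) hpq hω hτ (h := h) (μ := extendSeq μ) hh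
    (by rw [extendSeq_coe, extendSeq_coe]; exact (hμ _ _ hω).1)
    (by rw [extendSeq_coe, extendSeq_coe, ← add_sub_assoc]; exact (hμ _ _ hω).2)
    (t := gammaVars γ) (n := r + 1) (fun k hk => gammaVars_ne hγ hk) le_rfl q.2 (Y := z ∘ ω)
    (hz _ _ (ω.injective.ne (by simpa using hω.ne')))
  simp only [Fin.eta, Function.comp_apply, hωp, hωq, extendSeq_coe] at key
  rw [weightFunction_eq, weightFunction_eq, weightFunction_eq, hswap, hval, hz1, hz2, key]
  ring

end EllipticLink
end

/-! ### The weight function of the identity permutation. -/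

noncomputable section
namespace EllipticLink

theorem vtheta_zero (τ : ℂ) : vtheta τ 0 = 0 := by
  have := vtheta_neg τ 0
  rw [neg_zero] at this
  linear_combination this / 2

theorem exists_lt_apply_of_ne_one {k : ℕ} {σ : Equiv.Perm (Fin k)} (hσ : σ ≠ 1) :
    ∃ j, j < σ j := by
  by_contra! hle
  refine hσ (Equiv.ext fun j => ?_)
  induction j using WellFoundedLT.induction with
  | ind j ih =>
    by_contra hne
    have hlt : σ j < j := lt_of_le_of_ne (hle j) hne
    exact hne (σ.injective (ih _ hlt))

/-- For the identity, a cell above the diagonal is `ϑ(Y_l - y_j)`. A nontrivial `σ` has some `j <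
σ⁻¹ j`, and the cell at `(j, σ⁻¹ j)` is `ϑ` of `g j - g j = 0`. -/
theorem levelFactor_id_eq_zero (τ h : ℂ) (μ : ℕ → ℂ) {k : ℕ} (g : ℕ → ℂ)
    {σ : Equiv.Perm (Fin (k + 1))} (hσ : σ ≠ 1) :
    levelFactor τ h id μ k (fun j => g j) ((fun j : Fin (k + 1) => g j) ∘ σ) = 0 := by
  obtain ⟨j, hj⟩ := exists_lt_apply_of_ne_one (inv_ne_one.2 hσ)
  have hjk : (j : ℕ) < k := by
    have := (σ⁻¹ j).2
    rw [Fin.lt_def] at hj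
    omega
  rw [levelFactor]
  refine mul_eq_zero_of_left (Finset.prod_eq_zero (Finset.mem_univ ⟨j, hjk⟩)
    (Finset.prod_eq_zero (Finset.mem_univ (σ⁻¹ j)) ?_)) _
  rw [Fin.lt_def] at hj
  have e : σ (σ⁻¹ j) = j := σ.apply_symm_apply j
  simp only [cell, id, hj.not_gt, hj.ne', if_false, Function.comp_apply, e, sub_self, vtheta_zero]

/-- All levels use initial segments of one sequence `g`. Inductively the lower levels vanish unless
`s = 1`, and then the next level vanishes unless `σ = 1`: one term of the whole symmetrisation
survives. -/
theorem symSum_id (τ h : ℂ) (μ g : ℕ → ℂ) (k : ℕ) (σ : Equiv.Perm (Fin k)) :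
    symSum (levelFactor τ h id μ) (fun _ j => g j) k ((fun j : Fin k => g j) ∘ σ) =
      if σ = 1 then
        ∏ i ∈ Finset.range k, levelFactor τ h id μ i (fun j => g j) (fun j => g j) else 0 := by
  induction k with
  | zero =>
    rw [if_pos (Subsingleton.elim _ _)]
    simp only [symSum, Finset.range_zero, Finset.prod_empty]
  | succ k ih =>
    simp only [symSum, ih]
    rw [Finset.sum_eq_single 1]
    · rw [if_pos rfl, Finset.prod_range_succ]
      split_ifs with h1
      · rw [h1]; rfl
      · rw [Equiv.Perm.coe_one, Function.comp_id, levelFactor_id_eq_zero _ _ _ _ h1, mul_zero]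
    · intro s _ hs
      rw [if_neg hs, zero_mul]
    · simp

theorem symSum_id_succ (τ h : ℂ) (μ g : ℕ → ℂ) (k : ℕ) (Y : Fin (k + 1) → ℂ) :
    symSum (levelFactor τ h id μ) (fun _ j => g j) (k + 1) Y =
      (∏ i ∈ Finset.range k, levelFactor τ h id μ i (fun j => g j) (fun j => g j)) *
        levelFactor τ h id μ k (fun j => g j) Y := by
  simp only [symSum, symSum_id]
  rw [Finset.sum_eq_single 1]
  · rw [if_pos rfl]; rfl
  · intro s _ hs
    rw [if_neg hs, zero_mul]
  · simp

theorem levelFactor_id_eq (τ h : ℂ) (μ g : ℕ → ℂ) {k : ℕ}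
    (hg : ∀ i j : Fin k, i ≠ j → vtheta τ (g i - g j) ≠ 0) (Y : Fin (k + 1) → ℂ) :
    levelFactor τ h id μ k (fun j => g j) Y *
      ∏ j : Fin k, ∏ l : Fin k, (if j < l then vtheta τ (g l - g j) else 1) =
    (∏ j : Fin k, ∏ l : Fin (k + 1), cell τ h id μ k j l (Y l - g j)) *
      ∏ j : Fin k, ∏ l : Fin k, (if j < l then vtheta τ (h + g l - g j) / vtheta τ h else 1) := by
  rw [levelFactor, mul_assoc, ← Finset.prod_mul_distrib]
  congr 1
  refine Finset.prod_congr rfl fun j _ => ?_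
  rw [← Finset.prod_mul_distrib]
  refine Finset.prod_congr rfl fun l _ => ?_
  simp only [id, Fin.val_fin_lt]
  split_ifs with hjl
  · have := hg l j hjl.ne'
    rw [delta_eq_vtheta, show g l - g j + h = h + g l - g j by ring]
    field_simp
  · simp

theorem prod_ne_eq_mul {k : ℕ} (F : Fin k → Fin k → ℂ) :
    (∏ a : Fin k, ∏ b : Fin k, if a ≠ b then F a b else 1) =
      (∏ j : Fin k, ∏ l : Fin k, if j < l then F l j else 1) *
        ∏ j : Fin k, ∏ l : Fin k, if j < l then F j l else 1 := by
  rw [Finset.prod_comm (f := fun j l : Fin k => if j < l then F l j else 1),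
    ← Finset.prod_mul_distrib]
  refine Finset.prod_congr rfl fun a _ => ?_
  rw [← Finset.prod_mul_distrib]
  refine Finset.prod_congr rfl fun b _ => ?_
  rcases lt_trichotomy a b with h | h | h
  · simp [h, h.ne, h.not_gt]
  · simp [h]
  · simp [h, h.ne', h.not_gt]

/-- When both adjacent levels are specialised to `g`, the diagonal cells become `1` and the cells
above the diagonal cancel the denominators of the `δ`-factors, except for the last column. The rest
is precisely the normalising denominator of this level. -/
theorem levelFactor_id_gamma (τ h : ℂ) (μ g : ℕ → ℂ) {k : ℕ}
    (hg : ∀ i j : Fin k, i ≠ j → vtheta τ (g i - g j) ≠ 0)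
    (hμ : ∀ j : Fin k, vtheta τ (h + μ k - μ j) ≠ 0) :
    levelFactor τ h id μ k (fun j => g j) (fun j => g j) =
      (∏ a : Fin k, ∏ b : Fin k, if a ≠ b then vtheta τ (h + g a - g b) / vtheta τ h else 1) *
        ∏ j : Fin k, vtheta τ (g k - g j) := by
  have hne : ∏ j : Fin k, ∏ l : Fin k, (if j < l then vtheta τ (g l - g j) else 1) ≠ 0 := by
    refine Finset.prod_ne_zero_iff.2 fun j _ => Finset.prod_ne_zero_iff.2 fun l _ => ?_
    split_ifs with hjl
    · exact hg l j hjl.ne'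
    · exact one_ne_zero
  refine mul_right_cancel₀ hne ?_
  rw [levelFactor_id_eq τ h μ g hg, prod_ne_eq_mul fun a b => vtheta τ (h + g a - g b) / vtheta τ h]
  have : ∏ j : Fin k, ∏ l : Fin (k + 1), cell τ h id μ k j l (g l - g j) =
      (∏ j : Fin k, ∏ l : Fin k, if j < l then vtheta τ (h + g j - g l) / vtheta τ h else 1) *
      (∏ j : Fin k, ∏ l : Fin k, if j < l then vtheta τ (g l - g j) else 1) *
        ∏ j : Fin k, vtheta τ (g k - g j) := by
    rw [Finset.prod_comm (f := fun j l : Fin k => if j < l then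
      vtheta τ (h + g j - g l) / vtheta τ h else 1), ← Finset.prod_mul_distrib,
      ← Finset.prod_mul_distrib]
    refine Finset.prod_congr rfl fun j _ => ?_
    rw [Fin.prod_univ_castSucc, ← Finset.prod_mul_distrib]
    refine congrArg₂ (· * ·) (Finset.prod_congr rfl fun l _ => ?_) ?_
    · have hkj : ¬ k < (j : ℕ) := by omega
      simp only [cell, posParam, id, Fin.val_castSucc, Fin.val_fin_lt]
      rcases lt_trichotomy l j with hlj | hlj | hlj
      · simp only [hlj, hlj.not_gt, if_true, if_false, mul_one,
          show g l - g j + h = h + g l - g j by ring]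
      · have := hμ j
        simp [hlj, hkj, this]
      · have hne : (l : ℕ) ≠ j := by omega
        simp [hlj, hlj.not_gt, hne]
    · have hkj : ¬ k < (j : ℕ) := by omega
      have hkj' : k ≠ (j : ℕ) := by omega
      simp [cell, hkj, hkj']
  rw [this]
  ring

variable {r : ℕ}

theorem prod_range_prod_fin (F : ℕ → ℕ → ℂ) (r : ℕ) :
    ∏ k ∈ Finset.range r, ∏ j : Fin k, F k j =
      ∏ j : Fin r, ∏ l : Fin r, if j < l then F l j else 1 := by
  rw [Finset.prod_comm, Finset.prod_range]
  refine Finset.prod_congr rfl fun k _ => ?_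
  have e : (∏ j : Fin r, if j < k then F k j else 1) =
      ∏ j ∈ Finset.range r, if j < (k : ℕ) then F k j else 1 :=
    (Finset.prod_range (fun j => if j < (k : ℕ) then F k j else 1)).symm
  rw [e, ← Finset.prod_range (fun j => F k j), ← Finset.prod_filter]
  refine Finset.prod_congr (Finset.ext fun j => ?_) fun _ _ => rfl
  simp only [Finset.mem_range, Finset.mem_filter]
  omega

/-- The weight function of the identity. -/
theorem weightFunction_one {τ h : ℂ} {z : Fin (r + 1) → ℂ} {γ : Fin r → ℂ} {μ : Fin (r + 1) → ℂ}
    (hh : vtheta τ h ≠ 0) (hγ : ∀ i j, i ≠ j →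
      vtheta τ (γ i - γ j) ≠ 0 ∧ vtheta τ (h + γ i - γ j) ≠ 0)
    (hμ : ∀ i j, i < j → vtheta τ (h + μ j - μ i) ≠ 0) :
    weightFunction τ h z γ μ 1 = (∏ j : Fin r, ∏ l : Fin (r + 1),
      if (l : ℕ) < j then vtheta τ (z l - γ j + h) / vtheta τ h
      else if (l : ℕ) = j then vtheta τ (z l - γ j + (h + μ (Fin.last r) - μ j.castSucc)) /
        vtheta τ (h + μ (Fin.last r) - μ j.castSucc)
      else vtheta τ (z l - γ j)) / chernB τ h γ := by
  have hval : valSeq (1 : Equiv.Perm (Fin (r + 1))) = id := by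
    funext j
    simp [valSeq]
  have hg : ∀ k, k ≤ r → ∀ i j : Fin k, i ≠ j →
      vtheta τ (extendSeq γ i - extendSeq γ j) ≠ 0 ∧
        vtheta τ (h + extendSeq γ i - extendSeq γ j) ≠ 0 := by
    intro k hk i j hij
    have h1 : (i : ℕ) < r := by omega
    have h2 : (j : ℕ) < r := by omega
    simp only [extendSeq, h1, h2, dif_pos]
    exact hγ _ _ fun h => hij (Fin.ext (Fin.mk.inj h))
  have hμ' : ∀ k, k ≤ r → ∀ j : Fin k,
      vtheta τ (h + extendSeq μ k - extendSeq μ j) ≠ 0 := by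
    intro k hk j
    have h1 : k < r + 1 := by omega
    have h2 : (j : ℕ) < r + 1 := by omega
    simp only [extendSeq, h1, h2, dif_pos]
    exact hμ _ _ (by rw [Fin.lt_def]; exact j.2)
  have hden : ∀ k, k ≤ r → (∏ a : Fin k, ∏ b : Fin k, if a ≠ b then
      vtheta τ (h + extendSeq γ a - extendSeq γ b) / vtheta τ h else 1) ≠ 0 := by
    intro k hk
    refine Finset.prod_ne_zero_iff.2 fun a _ => Finset.prod_ne_zero_iff.2 fun b _ => ?_
    split_ifs with hab
    · exact div_ne_zero (hg k hk a b hab).2 hh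
    · exact one_ne_zero
  have hB : chernB τ h γ = ∏ j : Fin r, ∏ l : Fin r, if j < l then
      vtheta τ (h + extendSeq γ j - extendSeq γ l) / vtheta τ h else 1 := by
    refine Finset.prod_congr rfl fun j _ => Finset.prod_congr rfl fun l _ => ?_
    rw [extendSeq_coe, extendSeq_coe, show γ j - γ l + h = h + γ j - γ l by ring]
  have hb : (∏ j : Fin r, ∏ l : Fin r, if j < l then
      vtheta τ (extendSeq γ l - extendSeq γ j) else 1) ≠ 0 := by
    refine Finset.prod_ne_zero_iff.2 fun j _ => Finset.prod_ne_zero_iff.2 fun l _ => ?_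
    split_ifs with hjl
    · exact (hg r le_rfl l j hjl.ne').1
    · exact one_ne_zero
  have hprod : ∏ i ∈ Finset.range r, levelFactor τ h id (extendSeq μ) i
      (fun j => extendSeq γ j) (fun j => extendSeq γ j) =
      (∏ k ∈ Finset.range r, ∏ a : Fin k, ∏ b : Fin k, if a ≠ b then
        vtheta τ (h + extendSeq γ a - extendSeq γ b) / vtheta τ h else 1) *
      ∏ j : Fin r, ∏ l : Fin r, if j < l then
        vtheta τ (extendSeq γ l - extendSeq γ j) else 1 := by
    rw [← prod_range_prod_fin (fun k j => vtheta τ (extendSeq γ k - extendSeq γ j)),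
      ← Finset.prod_mul_distrib]
    refine Finset.prod_congr rfl fun k hk => ?_
    have hk := (Finset.mem_range.1 hk).le
    exact levelFactor_id_gamma τ h (extendSeq μ) (extendSeq γ)
      (fun i j hij => (hg k hk i j hij).1) (hμ' k hk)
  have htop := levelFactor_id_eq τ h (extendSeq μ) (extendSeq γ)
    (fun i j hij => (hg r le_rfl i j hij).1) z
  have hcell : ∏ j : Fin r, ∏ l : Fin (r + 1),
      cell τ h id (extendSeq μ) r j l (z l - extendSeq γ j) =
      ∏ j : Fin r, ∏ l : Fin (r + 1),
      if (l : ℕ) < j then vtheta τ (z l - γ j + h) / vtheta τ h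
      else if (l : ℕ) = j then vtheta τ (z l - γ j + (h + μ (Fin.last r) - μ j.castSucc)) /
        vtheta τ (h + μ (Fin.last r) - μ j.castSucc)
      else vtheta τ (z l - γ j) := by
    refine Finset.prod_congr rfl fun j _ => Finset.prod_congr rfl fun l _ => ?_
    have e1 : extendSeq μ r = μ (Fin.last r) := extendSeq_coe μ (Fin.last r)
    have e2 : extendSeq μ j = μ j.castSucc := extendSeq_coe μ j.castSucc
    have e3 : ¬ r < (j : ℕ) := by omega
    simp only [cell, posParam, id, e1, e2, e3, extendSeq_coe, if_false]
  rw [weightFunction_eq, hval, Equiv.Perm.coe_one, Function.comp_id]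
  have hdenr := hden r le_rfl
  rw [prod_ne_eq_mul fun a b : Fin r =>
    vtheta τ (h + extendSeq γ a - extendSeq γ b) / vtheta τ h, ← hB] at hdenr
  have hDen : weightDenom τ h γ = (∏ k ∈ Finset.range r, ∏ a : Fin k, ∏ b : Fin k, if a ≠ b then
      vtheta τ (h + extendSeq γ a - extendSeq γ b) / vtheta τ h else 1) *
      ((∏ j : Fin r, ∏ l : Fin r, if j < l then
        vtheta τ (h + extendSeq γ l - extendSeq γ j) / vtheta τ h else 1) * chernB τ h γ) := by
    rw [hB, ← prod_ne_eq_mul fun a b : Fin r =>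
      vtheta τ (h + extendSeq γ a - extendSeq γ b) / vtheta τ h, ← Finset.prod_range_succ]
    exact (Finset.prod_range fun k => ∏ a : Fin k, ∏ b : Fin k, if a ≠ b then
      vtheta τ (h + extendSeq γ a - extendSeq γ b) / vtheta τ h else 1).symm
  have hsym : symSum (levelFactor τ h id (extendSeq μ)) (gammaVars γ) (r + 1) z =
      (∏ i ∈ Finset.range r, levelFactor τ h id (extendSeq μ) i (fun j => extendSeq γ j)
        (fun j => extendSeq γ j)) * levelFactor τ h id (extendSeq μ) r (fun j => extendSeq γ j) z :=
    symSum_id_succ τ h (extendSeq μ) (extendSeq γ) r z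
  -- The denominators of the levels below the top cancel. The leftover last columns multiply up to
  -- the denominators of the `δ`-factors at the top, and the numerators of those cancel one half of
  -- the top normalisation; the other half is `chernB`.
  rw [← hcell, hsym, hDen, hprod]
  have hK : (∏ k ∈ Finset.range r, ∏ a : Fin k, ∏ b : Fin k, if a ≠ b then
      vtheta τ (h + extendSeq γ a - extendSeq γ b) / vtheta τ h else 1) ≠ 0 :=
    Finset.prod_ne_zero_iff.2 fun k hk => hden k (Finset.mem_range.1 hk).le
  rw [mul_assoc, mul_comm _ (levelFactor _ _ _ _ _ _ _), htop, mul_div_mul_left _ _ hK,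
    mul_comm _ (chernB τ h γ), mul_div_mul_right _ _ (left_ne_zero_of_mul hdenr)]

end EllipticLink
end

noncomputable section
namespace EllipticLink

/-! ## Types and admissible parameters -/

variable {m r : ℕ}

theorem deltaType_apply (χ ψ : Character m r) (v w : Var m r) :
    deltaType χ ψ v w = χ v * ψ w + ψ v * χ w := by
  simp only [deltaType, thetaType, Matrix.sub_apply, Matrix.vecMulVec_apply, Pi.add_apply]
  ring

theorem deltaType_add_left (χ χ' ψ : Character m r) :
    deltaType (χ + χ') ψ = deltaType χ ψ + deltaType χ' ψ := by
  ext v w; simp only [deltaType_apply, Matrix.add_apply, Pi.add_apply]; ring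

theorem deltaType_sub_left (χ χ' ψ : Character m r) :
    deltaType (χ - χ') ψ = deltaType χ ψ - deltaType χ' ψ := by
  ext v w; simp only [deltaType_apply, Matrix.sub_apply, Pi.sub_apply]; ring

theorem deltaType_add_right (χ ψ ψ' : Character m r) :
    deltaType χ (ψ + ψ') = deltaType χ ψ + deltaType χ ψ' := by
  ext v w; simp only [deltaType_apply, Matrix.add_apply, Pi.add_apply]; ring

theorem deltaType_sub_right (χ ψ ψ' : Character m r) :
    deltaType χ (ψ - ψ') = deltaType χ ψ - deltaType χ ψ' := by
  ext v w; simp only [deltaType_apply, Matrix.sub_apply, Pi.sub_apply]; ring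

theorem deltaType_zero_right (χ : Character m r) : deltaType χ 0 = 0 := by
  ext v w; simp [deltaType_apply]

theorem deltaType_smul_right (χ ψ : Character m r) (n : ℤ) :
    deltaType χ (n • ψ) = n • deltaType χ ψ := by
  ext v w; simp only [deltaType_apply, Matrix.smul_apply, Pi.smul_apply, smul_eq_mul]; ring

theorem deltaType_sum_right {ι : Type*} (s : Finset ι) (χ : Character m r)
    (ψ : ι → Character m r) : deltaType χ (∑ i ∈ s, ψ i) = ∑ i ∈ s, deltaType χ (ψ i) := by
  classical
  induction s using Finset.induction_on with
  | empty => simp [deltaType_zero_right]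
  | insert a s ha ih => rw [Finset.sum_insert ha, Finset.sum_insert ha, deltaType_add_right, ih]

/-- The node `i`. -/
def nodeL (i : Fin (m - 1)) : Fin m := ⟨i, by omega⟩

/-- The node `i + 1`. -/
def nodeR (i : Fin (m - 1)) : Fin m := ⟨i + 1, by omega⟩

theorem xL_eq (i : Fin (m - 1)) : (xL i : Var m r) = .x (nodeL i) := rfl

theorem xR_eq (i : Fin (m - 1)) : (xR i : Var m r) = .x (nodeR i) := rfl

theorem simple_eq (i : Fin (m - 1)) : simple i = Equiv.swap (nodeL i) (nodeR i) := rfl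

theorem nodeL_ne_nodeR (i : Fin (m - 1)) : nodeL i ≠ nodeR i := by
  simp [nodeL, nodeR, Fin.ext_iff]

/-- The first character has coefficient `1` at `x_{i+1}`: the diagonal entry there is `2
ν(x_{i+1})`, and the remaining entries of that row then determine `ν`. -/
theorem deltaType_left_injective (i : Fin (m - 1)) {ν ν' : Character m r}
    (h : deltaType (char (xR i) - char (xL i)) ν = deltaType (char (xR i) - char (xL i)) ν') :
    ν = ν' := by
  have hχ : (char (xR i) - char (xL i) : Character m r) (xR i) = 1 := by
    have := nodeL_ne_nodeR i
    simp [char, xR_eq, xL_eq, this.symm]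
  have h1 := congrFun (congrFun h (xR i)) (xR i)
  simp only [deltaType_apply, hχ] at h1
  have h2 : ν (xR i) = ν' (xR i) := by omega
  funext w
  have h3 := congrFun (congrFun h (xR i)) w
  simp only [deltaType_apply, hχ, h2] at h3
  linarith

/-- The type `u a + ∑_v x_v (ℓ_v - v h)`. -/
def patternType (a : Character m r) (ℓ : Fin m → Character m r) :
    Matrix (Var m r) (Var m r) ℤ :=
  deltaType (char .u) a + ∑ v, deltaType (char (.x v)) (ℓ v - (v : ℤ) • char .h)

/-- The type of the first half of a Demazure operation: adding `(x_{i+1} - x_i)(ℓ_i - ℓ_{i+1})`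
exchanges the weights of the two nodes. -/
theorem patternType_comp_simple (a : Character m r) (ℓ : Fin m → Character m r)
    (i : Fin (m - 1)) :
    deltaType (char (xR i) - char (xL i)) (ℓ (nodeL i) - ℓ (nodeR i)) + patternType a ℓ =
      patternType a (ℓ ∘ simple i) := by
  have key : ∑ v, (deltaType (char (.x v)) ((ℓ ∘ simple i) v - (v : ℤ) • char .h) -
      deltaType (char (.x v)) (ℓ v - (v : ℤ) • char .h)) =
      deltaType (char (xR i) - char (xL i)) (ℓ (nodeL i) - ℓ (nodeR i)) := by
    rw [Fintype.sum_eq_add (nodeL i) (nodeR i) (nodeL_ne_nodeR i) fun v hv => ?_]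
    · simp only [simple_eq, Function.comp_apply, Equiv.swap_apply_left, Equiv.swap_apply_right,
        deltaType_sub_left, deltaType_sub_right, xL_eq, xR_eq]
      abel
    · simp only [simple_eq, Function.comp_apply, Equiv.swap_apply_of_ne_of_ne hv.1 hv.2, sub_self]
  rw [Finset.sum_sub_distrib] at key
  rw [← key, patternType, patternType]
  abel

/-- A character not involving the variables `x`. -/
def XFree (χ : Character m r) : Prop := ∀ v, χ (.x v) = 0

theorem XFree.apply_permX {χ : Character m r} (hχ : XFree χ) (w : Equiv.Perm (Fin m))
    (v : Var m r) : χ (permX w v) = χ v := by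
  cases v with
  | x i => rw [hχ i]; exact hχ (w i)
  | u => rfl
  | h => rfl
  | mu k => rfl

theorem char_permX (i : Fin (m - 1)) (v : Fin m) (y : Var m r) :
    char (.x v) (permX (simple i) y) = char (.x (simple i v)) y := by
  have e : simple i = (simple i).symm := by rw [simple_eq, Equiv.symm_swap]
  cases y with
  | x j =>
    have : simple i j = v ↔ j = simple i v := by
      rw [← Equiv.eq_symm_apply, ← e]
    simp [char, permX, Pi.single_apply, this]
  | u => simp [char, permX]
  | h => simp [char, permX]
  | mu k => simp [char, permX]

theorem type_cons (c : Character m r × Character m r) (t : Term m r) :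
    Term.type (c :: t) = deltaType c.1 c.2 + Term.type t := by
  simp [Term.type]

theorem type_reflect (i : Fin (m - 1)) (t : Term m r) :
    Term.type (Term.reflect i t) = (Term.type t).submatrix (permX (simple i)) (permX (simple i)) := by
  induction t with
  | nil => rfl
  | cons c t ih =>
    have : Term.reflect i (c :: t) =
      (fun v => c.1 (permX (simple i) v), fun v => c.2 (permX (simple i) v)) ::
        Term.reflect i t := rfl
    rw [this, type_cons, type_cons, ih]
    ext v w
    simp only [Matrix.add_apply, Matrix.submatrix_apply, deltaType_apply]

theorem xfree_char_h : XFree (char .h : Character m r) := fun v => by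
  simp [char]

theorem xfree_char_u : XFree (char .u : Character m r) := fun v => by
  simp [char]

/-- The type of the second half: reflection exchanges the two weights, but also the summands `-v h`,
and the factor `δ(x_i / x_{i+1}, h)` restores the latter. The shift by `v h` in `patternType` is
made for this. -/
theorem patternType_submatrix {a : Character m r} {ℓ : Fin m → Character m r} (ha : XFree a)
    (hℓ : ∀ v, XFree (ℓ v)) (i : Fin (m - 1)) :
    deltaType (char (xL i) - char (xR i)) (char .h) +
      (patternType a ℓ).submatrix (permX (simple i)) (permX (simple i)) =
      patternType a (ℓ ∘ simple i) := by
  have h1 : (patternType a ℓ).submatrix (permX (simple i)) (permX (simple i)) =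
      deltaType (char .u) a +
        ∑ v, deltaType (char (.x v)) (ℓ (simple i v) - (simple i v : ℤ) • char .h) := by
    rw [← Equiv.sum_comp (simple i)]
    ext y w
    have e : ∀ v, simple i (simple i v) = v := fun v => by
      rw [simple_eq, Equiv.swap_apply_self]
    simp only [patternType, Matrix.submatrix_apply, Matrix.add_apply, Matrix.sum_apply,
      deltaType_apply, Pi.sub_apply, Pi.smul_apply, ha.apply_permX, (hℓ _).apply_permX,
      xfree_char_h.apply_permX, xfree_char_u.apply_permX, char_permX, e]
  have key : ∑ v, (deltaType (char (.x v)) (ℓ (simple i v) - (simple i v : ℤ) • char .h) -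
      deltaType (char (.x v)) ((ℓ ∘ simple i) v - (v : ℤ) • char .h)) =
      - deltaType (char (xL i) - char (xR i) : Character m r) (char .h) := by
    rw [Fintype.sum_eq_add (nodeL i) (nodeR i) (nodeL_ne_nodeR i) fun v hv => ?_]
    · simp only [simple_eq, Function.comp_apply, Equiv.swap_apply_left, Equiv.swap_apply_right,
        deltaType_sub_left, deltaType_sub_right, deltaType_smul_right, xL_eq, xR_eq]
      have e1 : ((nodeR i : ℕ) : ℤ) = (nodeL i : ℕ) + 1 := by simp [nodeL, nodeR]
      rw [e1, add_smul, one_smul, add_smul, one_smul]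
      abel
    · simp only [simple_eq, Function.comp_apply, Equiv.swap_apply_of_ne_of_ne hv.1 hv.2, sub_self]
  rw [Finset.sum_sub_distrib] at key
  rw [h1, patternType, eq_add_of_sub_eq key]
  abel

/-- The second half has the type with exchanged weights whatever `ν` is, so purity is one equation
for `ν`, with a unique solution. Uniqueness needs a summand to compare, hence `F ≠ []`. -/
theorem demazure_isPure_iff {a : Character m r} {ℓ : Fin m → Character m r} (ha : XFree a)
    (hℓ : ∀ v, XFree (ℓ v)) {F : Combination m r} (hF : F ≠ [])
    (hF' : ∀ t ∈ F, Term.type t = patternType a ℓ) (i : Fin (m - 1)) (ν : Character m r) :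
    (demazure i ν F).IsPure ↔ ν = ℓ (nodeL i) - ℓ (nodeR i) := by
  constructor
  · rintro ⟨Q, hQ⟩
    obtain ⟨t, ht⟩ := List.exists_mem_of_ne_nil F hF
    have h1 := hQ ((char (xR i) - char (xL i), ν) :: t) (List.mem_append_left _
      (List.mem_map.2 ⟨t, ht, rfl⟩))
    have h2 := hQ ((char (xL i) - char (xR i), char .h) :: Term.reflect i t)
      (List.mem_append_right _ (List.mem_map.2 ⟨t, ht, rfl⟩))
    rw [type_cons, hF' t ht] at h1
    rw [type_cons, type_reflect, hF' t ht, patternType_submatrix ha hℓ,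
      ← patternType_comp_simple] at h2
    exact deltaType_left_injective i (add_right_cancel (h1.trans h2.symm))
  · rintro rfl
    refine ⟨patternType a (ℓ ∘ simple i), fun t ht => ?_⟩
    rcases List.mem_append.1 ht with ht | ht <;> obtain ⟨t', ht', rfl⟩ := List.mem_map.1 ht
    · rw [type_cons, hF' t' ht', patternType_comp_simple]
    · rw [type_cons, type_reflect, hF' t' ht', patternType_submatrix ha hℓ]

theorem type_of_mem_demazure {a : Character m r} {ℓ : Fin m → Character m r} (ha : XFree a)
    (hℓ : ∀ v, XFree (ℓ v)) {F : Combination m r}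
    (hF' : ∀ t ∈ F, Term.type t = patternType a ℓ) (i : Fin (m - 1)) :
    ∀ t ∈ demazure i (ℓ (nodeL i) - ℓ (nodeR i)) F,
      Term.type t = patternType a (ℓ ∘ simple i) := by
  intro t ht
  rcases List.mem_append.1 ht with ht | ht <;> obtain ⟨t', ht', rfl⟩ := List.mem_map.1 ht
  · rw [type_cons, hF' t' ht', patternType_comp_simple]
  · rw [type_cons, type_reflect, hF' t' ht', patternType_submatrix ha hℓ]

theorem demazure_ne_nil {F : Combination m r} (hF : F ≠ []) (i : Fin (m - 1))
    (ν : Character m r) : demazure i ν F ≠ [] := by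
  simp [demazure, hF]

/-- The Demazure operations on functions of the variables `x`, the parameters being given by
weights of the nodes, which are permuted. -/
def wordStep (τ h : ℂ) (i : Fin (m - 1)) (S : (Fin m → ℂ) × ((Fin m → ℂ) → ℂ)) :
    (Fin m → ℂ) × ((Fin m → ℂ) → ℂ) :=
  (S.1 ∘ simple i, fun x =>
    delta τ (x (nodeR i) - x (nodeL i)) (S.1 (nodeL i) - S.1 (nodeR i)) * S.2 x +
      delta τ (x (nodeL i) - x (nodeR i)) h * S.2 (x ∘ simple i))

/-- The composition of the operations of a word. -/
def wordEval (τ h : ℂ) (L : List (Fin (m - 1))) (S : (Fin m → ℂ) × ((Fin m → ℂ) → ℂ)) :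
    (Fin m → ℂ) × ((Fin m → ℂ) → ℂ) :=
  L.foldr (wordStep τ h) S

/-- Replacing the variables `x`. -/
def withX (p : Point m r) (x : Fin m → ℂ) : Point m r
  | .x i => x i
  | v => p v

theorem eval_permX {χ : Character m r} (hχ : XFree χ) (i : Fin (m - 1)) (p : Point m r) :
    χ.eval (fun v => p (permX (simple i) v)) = χ.eval p := by
  rw [← eval_reflect]
  congr 1
  funext v
  exact hχ.apply_permX _ v

/-- Uniqueness of the admissible parameters along a word. -/
theorem Diamond.eval_eq {a : Character m r} {ℓ : Fin m → Character m r} (ha : XFree a)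
    (hℓ : ∀ v, XFree (ℓ v)) {F₀ : Combination m r} (hF₀ : F₀ ≠ [])
    (hF₀' : ∀ t ∈ F₀, Term.type t = patternType a ℓ) (τ : ℂ) {L : List (Fin (m - 1))}
    {F : Combination m r} (hD : Diamond F₀ L F) :
    F ≠ [] ∧ ∃ ℓ' : Fin m → Character m r, (∀ v, XFree (ℓ' v)) ∧
      (∀ t ∈ F, Term.type t = patternType a ℓ') ∧ ∀ p : Point m r,
      (fun v => (ℓ' v).eval p, F.eval τ p) =
        Prod.map id (fun f => f fun v => p (.x v)) (wordEval τ (p .h) L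
          (fun v => (ℓ v).eval p, fun x => F₀.eval τ (withX p x))) := by
  induction hD with
  | nil =>
    refine ⟨hF₀, ℓ, hℓ, hF₀', fun p => ?_⟩
    have : withX p (fun v => p (.x v)) = p := by
      funext v; cases v <;> rfl
    simp [wordEval, this]
  | @cons L F i ν hD hpure ih =>
    obtain ⟨hne, ℓ', hℓ', htype, hev⟩ := ih
    obtain rfl := (demazure_isPure_iff ha hℓ' hne htype i ν).1 hpure
    refine ⟨demazure_ne_nil hne i _, ℓ' ∘ simple i, fun v => hℓ' _,
      type_of_mem_demazure ha hℓ' htype i, fun p => ?_⟩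
    have h1 := hev p
    -- The second half of the operation evaluates at the reflected point; the weights do not involve
    -- the variables `x`, so they have the same values there.
    have h2 := hev (fun v => p (permX (simple i) v))
    have e1 : ∀ x, withX (fun v => p (permX (simple i) v)) x = withX p x := fun x => by
      funext v; cases v <;> rfl
    simp only [eval_permX (hℓ _), e1] at h2
    have h1a := congrArg Prod.fst h1
    have h1b := congrArg Prod.snd h1
    have h2b := congrArg Prod.snd h2
    simp only [Prod.map_fst, Prod.map_snd, id] at h1a h1b h2b
    rw [eval_demazure]
    refine Prod.ext ?_ ?_
    · simp only [Prod.map_fst, wordEval, List.foldr_cons, wordStep, id]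
      rw [← wordEval, ← h1a]
      rfl
    · simp only [Prod.map_snd, wordEval, List.foldr_cons, wordStep]
      rw [← wordEval, ← h1a]
      simp only [demazureFun, eval_sub]
      rw [h1b, h2b]
      rfl

/-- Existence of the admissible parameters along a word. -/
theorem exists_diamond {a : Character m r} {ℓ : Fin m → Character m r} (ha : XFree a)
    (hℓ : ∀ v, XFree (ℓ v)) {F₀ : Combination m r} (hF₀ : F₀ ≠ [])
    (hF₀' : ∀ t ∈ F₀, Term.type t = patternType a ℓ) (L : List (Fin (m - 1))) :
    ∃ F, Diamond F₀ L F := by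
  induction L with
  | nil => exact ⟨F₀, .nil⟩
  | cons i L ih =>
    obtain ⟨F, hF⟩ := ih
    obtain ⟨hne, ℓ', hℓ', htype, -⟩ := hF.eval_eq ha hℓ hF₀ hF₀' 0
    exact ⟨_, .cons i _ hF ((demazure_isPure_iff ha hℓ' hne htype i _).2 rfl)⟩

end EllipticLink
end

/-! ### Type and values of the minimal class. -/

noncomputable section
namespace EllipticLink

variable {m r : ℕ}

theorem prod_map_filter {α M : Type*} [CommMonoid M] (p : α → Prop) [DecidablePred p] (g : α → M)
    (l : List α) : ((l.filter p).map g).prod = (l.map fun j => if p j then g j else 1).prod := by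
  induction l with
  | nil => rfl
  | cons a l ih => by_cases h : p a <;> simp [h, ih]

theorem sum_map_filter {α M : Type*} [AddCommMonoid M] (p : α → Prop) [DecidablePred p]
    (g : α → M) (l : List α) :
    ((l.filter p).map g).sum = (l.map fun j => if p j then g j else 0).sum := by
  induction l with
  | nil => rfl
  | cons a l ih => by_cases h : p a <;> simp [h, ih]

/-- The characters by which the type of the minimal class depends on the variables `x`. -/
def minWeight (hr : 2 * r ≤ m) (v : Fin m) : Character m r :=
  (v : ℤ) • char .h +
    ((∑ i, if v = (minPattern hr).target i then
        char (.mu i) + ∑ j, (if i < j then char .h else 0) else 0) -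
      ∑ j, if v = (minPattern hr).source j then
        char (.mu j) + ∑ i, (if i < j then char .h else 0) else 0)

theorem xfree_add {χ ψ : Character m r} (hχ : XFree χ) (hψ : XFree ψ) : XFree (χ + ψ) :=
  fun v => by rw [Pi.add_apply, hχ, hψ, add_zero]

theorem xfree_sub {χ ψ : Character m r} (hχ : XFree χ) (hψ : XFree ψ) : XFree (χ - ψ) :=
  fun v => by rw [Pi.sub_apply, hχ, hψ, sub_zero]

theorem xfree_zero : XFree (0 : Character m r) := fun _ => rfl

theorem xfree_sum {ι : Type*} {s : Finset ι} {χ : ι → Character m r}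
    (h : ∀ i ∈ s, XFree (χ i)) : XFree (∑ i ∈ s, χ i) := fun v => by
  rw [Finset.sum_apply]
  exact Finset.sum_eq_zero fun i hi => h i hi v

theorem xfree_char_mu (k : Fin r) : XFree (char (.mu k) : Character m r) := fun v => by
  simp [char]

theorem xfree_mu_add (k : Fin r) (P : Fin r → Prop) [DecidablePred P] :
    XFree (char (.mu k) + ∑ j, (if P j then char .h else 0) : Character m r) :=
  xfree_add (xfree_char_mu k) (xfree_sum fun j _ => by
    split_ifs
    · exact xfree_char_h
    · exact xfree_zero)

theorem xfree_minWeight (hr : 2 * r ≤ m) (v : Fin m) : XFree (minWeight hr v) := by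
  refine xfree_add (fun w => ?_) (xfree_sub (xfree_sum fun i _ => ?_) (xfree_sum fun i _ => ?_))
  · rw [Pi.smul_apply, xfree_char_h, smul_zero]
  · split_ifs
    · exact xfree_mu_add i _
    · exact xfree_zero
  · split_ifs
    · exact xfree_mu_add i fun j => j < i
    · exact xfree_zero

theorem type_flatMap {α : Type*} (l : List α) (f : α → Term m r) :
    Term.type (l.flatMap f) = (l.map fun i => Term.type (f i)).sum := by
  induction l with
  | nil => rfl
  | cons a l ih =>
    rw [List.flatMap_cons, List.map_cons, List.sum_cons, ← ih]
    simp only [Term.type, List.map_append, List.sum_append]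

/-- By bilinearity each factor `δ(u x_t / x_s, ψ)` contributes `(u + x_t - x_s) ψ`; collecting the
coefficient of each node gives `minWeight`, whose summand `v h` only compensates the shift in
`patternType`. -/
theorem type_minClass (hr : 2 * r ≤ m) : ∀ t ∈ minClass hr, Term.type t =
    patternType (∑ i, (char (.mu i) + ∑ j, if i < j then char .h else 0)) (minWeight hr) := by
  intro t ht
  rw [minClass, List.mem_singleton] at ht
  subst ht
  have h1 : ∀ v, deltaType (char (.x v)) (minWeight hr v - (v : ℤ) • char .h : Character m r) =
      (∑ i, if v = (minPattern hr).target i then deltaType (char (.x v))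
        (char (.mu i) + ∑ j, (if i < j then char .h else 0)) else 0) -
      ∑ j, if v = (minPattern hr).source j then deltaType (char (.x v))
        (char (.mu j) + ∑ i, (if i < j then char .h else 0)) else 0 := by
    intro v
    rw [minWeight, add_sub_cancel_left, deltaType_sub_right, deltaType_sum_right,
      deltaType_sum_right]
    simp only [apply_ite (deltaType (char (.x v))), deltaType_zero_right]
  rw [type_flatMap, patternType]
  simp only [h1]
  rw [Finset.sum_sub_distrib, Finset.sum_comm, Finset.sum_comm (f := fun v j =>
    if v = (minPattern hr).source j then deltaType (char (.x v))
        (char (.mu j) + ∑ i, (if i < j then char .h else 0) : Character m r) else 0)]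
  simp only [Finset.sum_ite_eq', Finset.mem_univ, if_true]
  rw [← Fin.sum_univ_def]
  have hmap : ∀ (i : Fin r) (g : Fin r → Character m r × Character m r),
      Term.type (((List.finRange r).filter fun j => i < j).map g) =
        ∑ j, if i < j then deltaType (g j).1 (g j).2 else 0 := fun i g => by
    rw [Term.type, List.map_map, sum_map_filter, ← Fin.sum_univ_def]
    rfl
  simp only [type_cons, hmap]
  simp only [deltaType_add_left, deltaType_sub_left, deltaType_add_right,
    deltaType_sum_right, apply_ite (deltaType _), deltaType_zero_right]
  have h2 : ∀ i j : Fin r, (if i < j then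
      deltaType (char .u) (char .h) + deltaType (char (.x ((minPattern hr).target i))) (char .h) -
        deltaType (char (.x ((minPattern hr).source j))) (char .h) else 0 :
        Matrix (Var m r) (Var m r) ℤ) =
      (if i < j then deltaType (char .u) (char .h) else 0) +
      (if i < j then deltaType (char (.x ((minPattern hr).target i))) (char .h) else 0) -
      (if i < j then deltaType (char (.x ((minPattern hr).source j))) (char .h) else 0) := by
    intro i j; split_ifs <;> simp
  simp only [h2, Finset.sum_add_distrib, Finset.sum_sub_distrib]
  rw [Finset.sum_comm (f := fun i j : Fin r =>
    if i < j then deltaType (char (.x ((minPattern hr).source j))) (char .h) else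
      (0 : Matrix (Var m r) (Var m r) ℤ))]
  abel

theorem eval_add (χ ψ : Character m r) (p : Point m r) :
    Character.eval (χ + ψ) p = χ.eval p + ψ.eval p := by
  simp [Character.eval, add_mul, Finset.sum_add_distrib]

theorem eval_zero (p : Point m r) : Character.eval (0 : Character m r) p = 0 := by
  simp [Character.eval]

theorem eval_zsmul (n : ℤ) (χ : Character m r) (p : Point m r) :
    Character.eval (n • χ) p = n * χ.eval p := by
  simp [Character.eval, Finset.mul_sum, mul_assoc]

theorem eval_sum {ι : Type*} (s : Finset ι) (χ : ι → Character m r) (p : Point m r) :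
    Character.eval (∑ i ∈ s, χ i) p = ∑ i ∈ s, (χ i).eval p := by
  classical
  induction s using Finset.induction_on with
  | empty => simp [eval_zero]
  | insert a s ha ih => rw [Finset.sum_insert ha, Finset.sum_insert ha, eval_add, ih]

/-- The targets of the minimal pattern. -/
def tgt (i : Fin r) : Fin (2 * r + 1) := ⟨i, by omega⟩

/-- The sources of the minimal pattern. -/
def src (i : Fin r) : Fin (2 * r + 1) := ⟨r + 1 + i, by omega⟩

theorem minPattern_target (hr : 2 * r ≤ 2 * r + 1) (i : Fin r) :
    (minPattern hr).target i = tgt i := rfl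

theorem minPattern_source (hr : 2 * r ≤ 2 * r + 1) (i : Fin r) :
    (minPattern hr).source i = src i := by
  ext; simp only [minPattern, src]; omega

theorem src_injective : Function.Injective (src (r := r)) := fun i j h => by
  simpa [src, Fin.ext_iff] using h

theorem tgt_injective : Function.Injective (tgt (r := r)) := fun i j h => by
  simpa [tgt, Fin.ext_iff] using h

theorem tgt_ne_src (i j : Fin r) : tgt i ≠ src j := by
  simp only [tgt, src, Ne, Fin.ext_iff]; omega

/-- The weights of the nodes of the minimal pattern. -/
def nodeWeight (h : ℂ) (μ : Fin r → ℂ) (v : Fin (2 * r + 1)) : ℂ :=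
  if hv : (v : ℕ) < r then μ ⟨v, hv⟩ + (r - 1) * h
  else if hv : (v : ℕ) = r then r * h
  else (r + 1) * h - μ ⟨v - (r + 1), by omega⟩

theorem sum_ite_gt (h : ℂ) (i : Fin r) :
    ∑ j : Fin r, (if i < j then h else 0) = (r - 1 - i) * h := by
  rw [← Finset.sum_filter, Finset.sum_const, nsmul_eq_mul]
  congr 1
  have : (Finset.univ.filter fun j => i < j).card = r - 1 - i := by
    rw [← Fin.card_Ioi]; congr 1; ext; simp
  rw [this]
  have := i.2
  rw [Nat.cast_sub (by omega), Nat.cast_sub (by omega)]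
  simp

theorem sum_ite_lt (h : ℂ) (j : Fin r) :
    ∑ i : Fin r, (if i < j then h else 0) = j * h := by
  rw [← Finset.sum_filter, Finset.sum_const, nsmul_eq_mul]
  congr 2
  rw [← Fin.card_Iio]; congr 1; ext; simp

/-- The number of factors with `h` at a node compensates its index: `i h + (r - 1 - i) h` at a
target and `(r + 1 + i) h - i h` at a source. So within each block the weight depends on the node
only through the `μ`-variable of its arrow, which allows trading permutations of nodes for
permutations of labels. -/
theorem eval_minWeight (hr : 2 * r ≤ 2 * r + 1) (v : Fin (2 * r + 1)) (p : Point (2 * r + 1) r) :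
    (minWeight hr v).eval p = nodeWeight (p .h) (fun i => p (.mu i)) v := by
  have e : ∀ (P : Prop) [Decidable P] (χ : Character (2 * r + 1) r),
      Character.eval (if P then χ else 0) p = if P then χ.eval p else 0 := fun P _ χ => by
    split_ifs
    · rfl
    · exact eval_zero p
  simp only [minWeight, eval_add, eval_sub, eval_sum, eval_zsmul, eval_char, e, sum_ite_gt,
    sum_ite_lt]
  simp only [minPattern_target, minPattern_source]
  by_cases h1 : (v : ℕ) < r
  · obtain ⟨i, rfl⟩ : ∃ i, v = tgt i := ⟨⟨v, h1⟩, rfl⟩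
    simp only [tgt_injective.eq_iff, tgt_ne_src, if_false, Finset.sum_const_zero,
      Finset.sum_ite_eq, Finset.mem_univ, if_true]
    have h2 : ((tgt i : Fin (2 * r + 1)) : ℕ) = i := rfl
    simp [nodeWeight, h2]
    ring
  · by_cases h2 : (v : ℕ) = r
    · have h3 : ∀ i, v ≠ tgt i := fun i => by simp only [tgt, Ne, Fin.ext_iff]; omega
      have h4 : ∀ i, v ≠ src i := fun i => by simp only [src, Ne, Fin.ext_iff]; omega
      simp [nodeWeight, h2, h3, h4]
    · obtain ⟨i, rfl⟩ : ∃ i, v = src i := ⟨⟨v - (r + 1), by omega⟩, by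
        simp only [src, Fin.ext_iff]; omega⟩
      simp only [src_injective.eq_iff, (tgt_ne_src _ _).symm, if_false, Finset.sum_const_zero,
        Finset.sum_ite_eq, Finset.mem_univ, if_true]
      have h3 : ((src i : Fin (2 * r + 1)) : ℕ) = r + 1 + i := rfl
      simp [nodeWeight, h3]
      split_ifs <;> (first | omega | ring)

/-- The minimal class as a function of `x`, with `u = 1`. -/
def minFun (τ h : ℂ) (μ : Fin r → ℂ) (x : Fin (2 * r + 1) → ℂ) : ℂ :=
  ∏ i : Fin r, ∏ j : Fin r, if i = j then delta τ (x (tgt i) - x (src j)) (μ i)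
    else if i < j then delta τ (x (tgt i) - x (src j)) h else 1

theorem eval_minClass (hr : 2 * r ≤ 2 * r + 1) (τ : ℂ) (p : Point (2 * r + 1) r)
    (hu : p .u = 0) (x : Fin (2 * r + 1) → ℂ) :
    (minClass hr).eval τ (withX p x) = minFun τ (p .h) (fun i => p (.mu i)) x := by
  have hflat : ∀ (l : List (Fin r)) (f : Fin r → Term (2 * r + 1) r)
      (g : Character (2 * r + 1) r × Character (2 * r + 1) r → ℂ),
      ((l.flatMap f).map g).prod = (l.map fun i => ((f i).map g).prod).prod := by
    intro l f g
    induction l with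
    | nil => rfl
    | cons a l ih => simp [ih]
  rw [minClass, Combination.eval, List.map_singleton, List.sum_singleton, hflat,
    ← Fin.prod_univ_def]
  refine Finset.prod_congr rfl fun i _ => ?_
  rw [List.map_cons, List.prod_cons, List.map_map, prod_map_filter, ← Fin.prod_univ_def]
  simp only [Function.comp_apply, eval_sub, eval_add, eval_char, minPattern_target,
    minPattern_source, withX, hu, zero_add]
  have h1 : delta τ (x (tgt i) - x (src i)) (p (.mu i)) =
      ∏ j, if i = j then delta τ (x (tgt i) - x (src j)) (p (.mu i)) else 1 := by
    rw [Finset.prod_ite_eq]; simp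
  rw [h1, ← Finset.prod_mul_distrib]
  refine Finset.prod_congr rfl fun j _ => ?_
  by_cases hij : i = j
  · simp [hij]
  · simp [hij]

end EllipticLink
end

noncomputable section
namespace EllipticLink

/-! ## Words in simple transpositions -/

section words

variable {m : ℕ}

/-- The permutation given by a word. -/
def wordPerm (L : List (Fin (m - 1))) : Equiv.Perm (Fin m) := (L.map simple).prod

theorem wordPerm_cons (i : Fin (m - 1)) (L : List (Fin (m - 1))) :
    wordPerm (i :: L) = simple i * wordPerm L := by
  simp [wordPerm]

theorem wordPerm_append (L L' : List (Fin (m - 1))) :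
    wordPerm (L ++ L') = wordPerm L * wordPerm L' := by
  simp [wordPerm]

theorem simple_mul_self (i : Fin (m - 1)) : simple i * simple i = 1 := by
  rw [simple_eq, Equiv.swap_mul_self]

theorem simple_apply_val (i : Fin (m - 1)) (v : Fin m) : (simple i v : ℕ) =
    if (v : ℕ) = (i : ℕ) then (i : ℕ) + 1 else if (v : ℕ) = (i : ℕ) + 1 then (i : ℕ) else v := by
  rw [simple_eq, Equiv.swap_apply_def]
  simp only [nodeL, nodeR, Fin.ext_iff]
  split_ifs <;> simp

/-- A word is ascending if every letter creates a new inversion. -/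
def Ascending : List (Fin (m - 1)) → Prop
  | [] => True
  | i :: L => (wordPerm L).symm (nodeL i) < (wordPerm L).symm (nodeR i) ∧ Ascending L

/-- The exchange condition. -/
theorem exists_swap_mul_wordPerm (L : List (Fin (m - 1))) {a b : Fin m} (hab : a < b)
    (h : (wordPerm L).symm b < (wordPerm L).symm a) :
    ∃ L', L'.length + 1 = L.length ∧ Equiv.swap a b * wordPerm L = wordPerm L' := by
  induction L generalizing a b with
  | nil =>
    have : (wordPerm ([] : List (Fin (m - 1)))) = 1 := by simp [wordPerm]
    rw [this] at h
    exact absurd h hab.not_gt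
  | cons j L ih =>
    have hsymm : ∀ c, (wordPerm (j :: L)).symm c = (wordPerm L).symm (simple j c) := fun c => by
      rw [wordPerm_cons, Equiv.symm_apply_eq, Equiv.Perm.mul_apply, Equiv.apply_symm_apply,
        simple_eq, Equiv.swap_apply_self]
    rw [hsymm, hsymm] at h
    -- If the transposition is the first letter itself, that letter is deleted. Otherwise the letter
    -- preserves the order of `a` and `b`, and the transposition is conjugated past it.
    by_cases hj : a = nodeL j ∧ b = nodeR j
    · refine ⟨L, rfl, ?_⟩
      rw [hj.1, hj.2, wordPerm_cons, ← mul_assoc, ← simple_eq, simple_mul_self, one_mul]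
    · have hab' : simple j a < simple j b := by
        rw [Fin.lt_def, simple_apply_val, simple_apply_val]
        simp only [nodeL, nodeR, Fin.ext_iff] at hj
        rw [Fin.lt_def] at hab
        split_ifs <;> omega
      obtain ⟨L', hlen, hL'⟩ := ih hab' h
      refine ⟨j :: L', by simp [hlen], ?_⟩
      rw [wordPerm_cons, wordPerm_cons, ← hL', ← mul_assoc, ← mul_assoc,
        Equiv.mul_swap_eq_swap_mul]
      have e : ∀ c, simple j (simple j c) = c := fun c => by
        rw [simple_eq, Equiv.swap_apply_self]
      rw [e, e]

/-- A letter removing an inversion could be cancelled against an earlier one by the exchange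
condition, giving a shorter word for the same permutation. -/
theorem ascending_of_length_le (L : List (Fin (m - 1)))
    (h : ∀ L', wordPerm L' = wordPerm L → L.length ≤ L'.length) : Ascending L := by
  induction L with
  | nil => trivial
  | cons i L ih =>
    refine ⟨?_, ih fun L' hL' => ?_⟩
    · by_contra hlt
      have hne : (wordPerm L).symm (nodeL i) ≠ (wordPerm L).symm (nodeR i) :=
        (wordPerm L).symm.injective.ne (nodeL_ne_nodeR i)
      have hlt' := lt_of_le_of_ne (not_lt.1 hlt) hne.symm
      obtain ⟨L', hlen, hL'⟩ := exists_swap_mul_wordPerm L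
        (by simp [nodeL, nodeR, Fin.lt_def]) hlt'
      have := h L' (by rw [wordPerm_cons, ← hL', simple_eq])
      rw [List.length_cons] at this
      omega
    · have := h (i :: L') (by rw [wordPerm_cons, wordPerm_cons, hL'])
      simpa using this

theorem wordPerm_apply_le_iff {c : ℕ} {L : List (Fin (m - 1))} (hL : ∀ i ∈ L, (i : ℕ) ≠ c)
    (v : Fin m) : (wordPerm L v : ℕ) ≤ c ↔ (v : ℕ) ≤ c := by
  induction L with
  | nil => simp [wordPerm]
  | cons i L ih =>
    rw [wordPerm_cons, Equiv.Perm.mul_apply, ← ih fun j hj => hL j (List.mem_cons_of_mem _ hj),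
      simple_apply_val]
    have := hL i List.mem_cons_self
    split_ifs <;> omega

/-- An ascending word containing the letter `c` has an inversion across `c`. -/
theorem Ascending.exists_inversion {c : ℕ} {L : List (Fin (m - 1))} (hA : Ascending L)
    (hc : ∃ i ∈ L, (i : ℕ) = c) :
    ∃ a b : Fin m, (a : ℕ) ≤ c ∧ c < b ∧ wordPerm L b < wordPerm L a := by
  induction L with
  | nil => simp at hc
  | cons i L ih =>
    by_cases hL : ∃ i ∈ L, (i : ℕ) = c
    · obtain ⟨a, b, ha, hb, hlt⟩ := ih hA.2 hL
      refine ⟨a, b, ha, hb, ?_⟩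
      -- An ascending letter never undoes an inversion which is already present.
      have hne : ¬(wordPerm L b = nodeL i ∧ wordPerm L a = nodeR i) := by
        rintro ⟨h1, h2⟩
        have := hA.1
        rw [← h1, ← h2, Equiv.symm_apply_apply, Equiv.symm_apply_apply, Fin.lt_def] at this
        omega
      simp only [nodeL, nodeR, Fin.ext_iff] at hne
      rw [Fin.lt_def] at hlt
      rw [wordPerm_cons, Equiv.Perm.mul_apply, Equiv.Perm.mul_apply, Fin.lt_def,
        simple_apply_val, simple_apply_val]
      split_ifs <;> omega
    · have hi : (i : ℕ) = c := by
        obtain ⟨j, hj, hj'⟩ := hc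
        rcases List.mem_cons.1 hj with rfl | hj
        · exact hj'
        · exact absurd ⟨j, hj, hj'⟩ hL
      -- The remaining letters preserve the set of nodes up to `c`, so the letter `c` exchanges the
      -- images of two nodes on different sides of `c`.
      push Not at hL
      refine ⟨(wordPerm L).symm (nodeL i), (wordPerm L).symm (nodeR i), ?_, ?_, ?_⟩
      · rw [← wordPerm_apply_le_iff hL, Equiv.apply_symm_apply]
        simp [nodeL, hi]
      · rw [← not_le, ← wordPerm_apply_le_iff hL, Equiv.apply_symm_apply]
        simp [nodeR, hi]
      · rw [wordPerm_cons, Equiv.Perm.mul_apply, Equiv.Perm.mul_apply, Equiv.apply_symm_apply,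
          Equiv.apply_symm_apply, simple_eq, Equiv.swap_apply_left, Equiv.swap_apply_right,
          Fin.lt_def]
        simp [nodeL, nodeR]

/-- Letters which are not neighbours. -/
def Far (i j : Fin (m - 1)) : Prop := (i : ℕ) + 1 < j ∨ (j : ℕ) + 1 < i

theorem Far.simple_nodeL {i j : Fin (m - 1)} (h : Far i j) : simple j (nodeL i) = nodeL i := by
  unfold Far at h
  rw [Fin.ext_iff, simple_apply_val, if_neg (by simp only [nodeL]; omega),
    if_neg (by simp only [nodeL]; omega)]

theorem Far.simple_nodeR {i j : Fin (m - 1)} (h : Far i j) : simple j (nodeR i) = nodeR i := by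
  unfold Far at h
  rw [Fin.ext_iff, simple_apply_val, if_neg (by simp only [nodeR]; omega),
    if_neg (by simp only [nodeR]; omega)]

theorem Far.symm {i j : Fin (m - 1)} (h : Far i j) : Far j i := Or.symm h

theorem Far.simple_mul_simple {i j : Fin (m - 1)} (h : Far i j) :
    simple i * simple j = simple j * simple i := by
  rw [simple_eq i, Equiv.swap_mul_eq_mul_swap, simple_eq j, Equiv.swap_inv,
    ← simple_eq j, h.simple_nodeL, h.simple_nodeR]

theorem wordPerm_cons_of_far {i : Fin (m - 1)} {L : List (Fin (m - 1))} (h : ∀ j ∈ L, Far i j) :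
    wordPerm (i :: L) = wordPerm (L ++ [i]) := by
  induction L with
  | nil => rfl
  | cons j L ih =>
    have ih := ih fun k hk => h k (List.mem_cons_of_mem _ hk)
    rw [List.cons_append, wordPerm_cons j, ← ih, wordPerm_cons, wordPerm_cons, wordPerm_cons,
      ← mul_assoc, ← mul_assoc, (h j List.mem_cons_self).simple_mul_simple]

theorem Far.wordStep_wordStep {i j : Fin (m - 1)} (h : Far i j) (τ η : ℂ)
    (S : (Fin m → ℂ) × ((Fin m → ℂ) → ℂ)) :
    wordStep τ η i (wordStep τ η j S) = wordStep τ η j (wordStep τ η i S) := by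
  have hc : ∀ v, simple i (simple j v) = simple j (simple i v) := fun v =>
    congrArg (fun w : Equiv.Perm (Fin m) => w v) h.simple_mul_simple
  refine Prod.ext ?_ ?_
  · funext v
    simp only [wordStep, Function.comp_apply, hc]
  · funext x
    have hx : (x ∘ simple i) ∘ simple j = (x ∘ simple j) ∘ simple i := by
      funext v
      simp only [Function.comp_apply, hc]
    simp only [wordStep, Function.comp_apply, h.simple_nodeL, h.simple_nodeR, h.symm.simple_nodeL,
      h.symm.simple_nodeR, hx]
    ring

theorem wordEval_cons (τ h : ℂ) (i : Fin (m - 1)) (L : List (Fin (m - 1)))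
    (S : (Fin m → ℂ) × ((Fin m → ℂ) → ℂ)) :
    wordEval τ h (i :: L) S = wordStep τ h i (wordEval τ h L S) := rfl

theorem wordEval_append (τ h : ℂ) (L L' : List (Fin (m - 1)))
    (S : (Fin m → ℂ) × ((Fin m → ℂ) → ℂ)) :
    wordEval τ h (L ++ L') S = wordEval τ h L (wordEval τ h L' S) := by
  simp [wordEval]

theorem wordEval_cons_of_far {i : Fin (m - 1)} {L : List (Fin (m - 1))} (h : ∀ j ∈ L, Far i j)
    (τ η : ℂ) (S : (Fin m → ℂ) × ((Fin m → ℂ) → ℂ)) :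
    wordEval τ η (i :: L) S = wordEval τ η (L ++ [i]) S := by
  induction L with
  | nil => rfl
  | cons j L ih =>
    have ih := ih fun k hk => h k (List.mem_cons_of_mem _ hk)
    rw [List.cons_append, wordEval_cons _ _ j, ← ih, wordEval_cons, wordEval_cons, wordEval_cons,
      (h j List.mem_cons_self).wordStep_wordStep]

/-- Points whose coordinates are pairwise different modulo the lattice. -/
def Generic (τ : ℂ) (x : Fin m → ℂ) : Prop := ∀ a b, a ≠ b → vtheta τ (x a - x b) ≠ 0

theorem Generic.comp {τ : ℂ} {x : Fin m → ℂ} (hx : Generic τ x) (w : Equiv.Perm (Fin m)) :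
    Generic τ (x ∘ w) := fun _ _ hab => hx _ _ (w.injective.ne hab)

/-- Equality at generic points. -/
def GenericEq (τ : ℂ) (S S' : (Fin m → ℂ) × ((Fin m → ℂ) → ℂ)) : Prop :=
  S.1 = S'.1 ∧ ∀ x, Generic τ x → S.2 x = S'.2 x

theorem GenericEq.refl (τ : ℂ) (S : (Fin m → ℂ) × ((Fin m → ℂ) → ℂ)) : GenericEq τ S S :=
  ⟨rfl, fun _ _ => rfl⟩

theorem GenericEq.trans {τ : ℂ} {S S' S'' : (Fin m → ℂ) × ((Fin m → ℂ) → ℂ)}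
    (h : GenericEq τ S S') (h' : GenericEq τ S' S'') : GenericEq τ S S'' :=
  ⟨h.1.trans h'.1, fun x hx => (h.2 x hx).trans (h'.2 x hx)⟩

theorem GenericEq.wordStep {τ : ℂ} {S S' : (Fin m → ℂ) × ((Fin m → ℂ) → ℂ)}
    (hS : GenericEq τ S S') (h : ℂ) (i : Fin (m - 1)) :
    GenericEq τ (wordStep τ h i S) (wordStep τ h i S') := by
  refine ⟨?_, fun x hx => ?_⟩
  · simp only [EllipticLink.wordStep, hS.1]
  · simp only [EllipticLink.wordStep, hS.1, hS.2 x hx, hS.2 _ (hx.comp (simple i))]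

theorem GenericEq.wordEval {τ : ℂ} {S S' : (Fin m → ℂ) × ((Fin m → ℂ) → ℂ)}
    (hS : GenericEq τ S S') (h : ℂ) (L : List (Fin (m - 1))) :
    GenericEq τ (wordEval τ h L S) (wordEval τ h L S') := by
  induction L with
  | nil => exact hS
  | cons i L ih => exact ih.wordStep h i

end words

end EllipticLink
end

/-! ### Trading permutations of sources for permutations of targets. -/

noncomputable section
namespace EllipticLink

section rectangle

variable {r : ℕ}

theorem node_cases (v : Fin (2 * r + 1)) :
    (∃ i, v = tgt i) ∨ (v : ℕ) = r ∨ ∃ i, v = src i := by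
  rcases lt_trichotomy (v : ℕ) r with hv | hv | hv
  · exact Or.inl ⟨⟨v, hv⟩, rfl⟩
  · exact Or.inr (Or.inl hv)
  · exact Or.inr (Or.inr ⟨⟨v - (r + 1), by omega⟩, by simp only [src, Fin.ext_iff]; omega⟩)

theorem nodeWeight_tgt (h : ℂ) (μ : Fin r → ℂ) (i : Fin r) :
    nodeWeight h μ (tgt i) = μ i + (r - 1) * h := by
  have : ((tgt i : Fin (2 * r + 1)) : ℕ) = i := rfl
  simp [nodeWeight, this]

theorem nodeWeight_src (h : ℂ) (μ : Fin r → ℂ) (i : Fin r) :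
    nodeWeight h μ (src i) = (r + 1) * h - μ i := by
  have : ((src i : Fin (2 * r + 1)) : ℕ) = r + 1 + i := rfl
  simp only [nodeWeight, this]
  rw [dif_neg (by omega), dif_neg (by omega)]
  congr 2
  ext
  simp

theorem nodeWeight_of_eq (h : ℂ) (μ : Fin r → ℂ) {v : Fin (2 * r + 1)} (hv : (v : ℕ) = r) :
    nodeWeight h μ v = r * h := by
  simp [nodeWeight, hv]

/-- The simple transposition of two targets of the minimal pattern. -/
def lowLetter (A B : Fin r) (hAB : (B : ℕ) = A + 1) : Fin (2 * r + 1 - 1) := ⟨A, by omega⟩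

/-- The simple transposition of two sources of the minimal pattern. -/
def highLetter (A B : Fin r) (hAB : (B : ℕ) = A + 1) : Fin (2 * r + 1 - 1) :=
  ⟨r + 1 + A, by omega⟩

section letters

variable {A B : Fin r}

theorem nodeL_lowLetter (hAB : (B : ℕ) = A + 1) : nodeL (lowLetter A B hAB) = tgt A := rfl

theorem nodeR_lowLetter (hAB : (B : ℕ) = A + 1) : nodeR (lowLetter A B hAB) = tgt B := by
  simp only [nodeR, lowLetter, tgt, hAB]

theorem nodeL_highLetter (hAB : (B : ℕ) = A + 1) : nodeL (highLetter A B hAB) = src A := rfl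

theorem nodeR_highLetter (hAB : (B : ℕ) = A + 1) : nodeR (highLetter A B hAB) = src B := by
  simp only [nodeR, highLetter, src, hAB, add_assoc]

theorem simple_lowLetter (hAB : (B : ℕ) = A + 1) : simple (lowLetter A B hAB) = Equiv.swap (tgt A) (tgt B) := by
  rw [simple_eq, nodeL_lowLetter, nodeR_lowLetter]

theorem simple_highLetter (hAB : (B : ℕ) = A + 1) : simple (highLetter A B hAB) = Equiv.swap (src A) (src B) := by
  rw [simple_eq, nodeL_highLetter, nodeR_highLetter]

theorem swap_tgt_src (A B i : Fin r) : Equiv.swap (tgt A) (tgt B) (src i) = src i :=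
  Equiv.swap_apply_of_ne_of_ne (tgt_ne_src _ _).symm (tgt_ne_src _ _).symm

theorem swap_src_tgt (A B i : Fin r) : Equiv.swap (src A) (src B) (tgt i) = tgt i :=
  Equiv.swap_apply_of_ne_of_ne (tgt_ne_src _ _) (tgt_ne_src _ _)

theorem swap_tgt_tgt (A B i : Fin r) :
    Equiv.swap (tgt A) (tgt B) (tgt i) = tgt (Equiv.swap A B i) := tgt_injective.swap_apply _ _ _

theorem swap_src_src (A B i : Fin r) :
    Equiv.swap (src A) (src B) (src i) = src (Equiv.swap A B i) := src_injective.swap_apply _ _ _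

/-- Exchanging two sources amounts to exchanging their labels and then their targets; this is the
version for weights. -/
theorem nodeWeight_comp_swap (h : ℂ) (μ : Fin r → ℂ) (A B : Fin r) :
    nodeWeight h μ ∘ Equiv.swap (src A) (src B) =
      nodeWeight h (μ ∘ Equiv.swap A B) ∘ Equiv.swap (tgt A) (tgt B) := by
  funext v
  simp only [Function.comp_apply]
  rcases node_cases v with ⟨i, rfl⟩ | hv | ⟨i, rfl⟩
  · rw [swap_src_tgt, swap_tgt_tgt, nodeWeight_tgt, nodeWeight_tgt, Function.comp_apply,
      Equiv.swap_apply_self]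
  · have h1 : ∀ i, v ≠ tgt i := fun i => by simp only [tgt, Ne, Fin.ext_iff]; omega
    have h2 : ∀ i, v ≠ src i := fun i => by simp only [src, Ne, Fin.ext_iff]; omega
    rw [Equiv.swap_apply_of_ne_of_ne (h2 _) (h2 _), Equiv.swap_apply_of_ne_of_ne (h1 _) (h1 _),
      nodeWeight_of_eq _ _ hv, nodeWeight_of_eq _ _ hv]
  · rw [swap_src_src, swap_tgt_src, nodeWeight_src, nodeWeight_src, Function.comp_apply]

/-- The factors of the minimal class outside of a square. -/
def minFunOff (τ h : ℂ) (A B : Fin r) (μ : Fin r → ℂ) (x : Fin (2 * r + 1) → ℂ) : ℂ :=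
  ∏ i : Fin r, ∏ j : Fin r, if (i, j) ∈ (({A, B} : Finset (Fin r)) ×ˢ {A, B}) then 1 else
    if i = j then delta τ (x (tgt i) - x (src j)) (μ i)
    else if i < j then delta τ (x (tgt i) - x (src j)) h else 1

theorem minFun_eq (hAB : (B : ℕ) = A + 1) (τ h : ℂ) (μ : Fin r → ℂ)
    (x : Fin (2 * r + 1) → ℂ) :
    minFun τ h μ x = minFunOff τ h A B μ x * (delta τ (x (tgt A) - x (src A)) (μ A) *
      delta τ (x (tgt A) - x (src B)) h * delta τ (x (tgt B) - x (src B)) (μ B)) := by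
  have hlt : A < B := by rw [Fin.lt_def]; omega
  rw [minFun, prod_prod_eq_mul_prod (({A, B} : Finset (Fin r)) ×ˢ {A, B}), minFunOff,
    Finset.prod_product, Finset.prod_pair hlt.ne, Finset.prod_pair hlt.ne,
    Finset.prod_pair hlt.ne]
  simp [hlt, hlt.ne, hlt.ne', hlt.not_gt]

theorem minFunOff_congr (τ h : ℂ) (A B : Fin r) {μ μ' : Fin r → ℂ}
    (hμ : ∀ i, i ≠ A → i ≠ B → μ i = μ' i) (x : Fin (2 * r + 1) → ℂ) :
    minFunOff τ h A B μ x = minFunOff τ h A B μ' x := by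
  refine Finset.prod_congr rfl fun i _ => Finset.prod_congr rfl fun j _ => ?_
  split_ifs with h1 h2
  · rfl
  · subst h2
    simp only [Finset.mem_product, Finset.mem_insert, Finset.mem_singleton, and_self, not_or] at h1
    rw [hμ i h1.1 h1.2]
  · rfl
  · rfl

theorem swap_mem_pair (A B i : Fin r) :
    Equiv.swap A B i ∈ ({A, B} : Finset (Fin r)) ↔ i ∈ ({A, B} : Finset (Fin r)) := by
  rcases eq_or_ne i A with rfl | hA
  · simp
  rcases eq_or_ne i B with rfl | hB
  · simp
  rw [Equiv.swap_apply_of_ne_of_ne hA hB]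

theorem swap_lt_iff (hAB : (B : ℕ) = A + 1) {i j : Fin r}
    (hij : ¬(i ∈ ({A, B} : Finset (Fin r)) ∧ j ∈ ({A, B} : Finset (Fin r)))) :
    (i < Equiv.swap A B j ↔ i < j) ∧ (i = Equiv.swap A B j ↔ i = j) ∧
      (Equiv.swap A B i < j ↔ i < j) ∧ (Equiv.swap A B i = j ↔ i = j) := by
  simp only [Finset.mem_insert, Finset.mem_singleton, Fin.ext_iff] at hij
  simp only [Equiv.swap_apply_def, Fin.lt_def, Fin.ext_iff]
  split_ifs <;> omega

/-- As `A` and `B` are consecutive, no index outside of the square distinguishes them in the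
condition `i < j`, so their columns carry the same factors there. -/
theorem minFunOff_swap_src (hAB : (B : ℕ) = A + 1) (τ h : ℂ) (μ : Fin r → ℂ)
    (x : Fin (2 * r + 1) → ℂ) :
    minFunOff τ h A B μ (x ∘ Equiv.swap (src A) (src B)) = minFunOff τ h A B μ x := by
  unfold minFunOff
  refine Finset.prod_congr rfl fun i _ => ?_
  rw [← Equiv.prod_comp (Equiv.swap A B)]
  refine Finset.prod_congr rfl fun j _ => ?_
  simp only [Finset.mem_product, swap_mem_pair, Function.comp_apply, swap_src_tgt, swap_src_src,
    Equiv.swap_apply_self]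
  by_cases h1 : i ∈ ({A, B} : Finset (Fin r)) ∧ j ∈ ({A, B} : Finset (Fin r))
  · rw [if_pos h1, if_pos h1]
  · obtain ⟨e1, e2, e3, e4⟩ := swap_lt_iff hAB h1
    simp only [if_neg h1, e1, e2]

theorem minFunOff_swap_tgt (hAB : (B : ℕ) = A + 1) (τ h : ℂ) (μ : Fin r → ℂ)
    (x : Fin (2 * r + 1) → ℂ) :
    minFunOff τ h A B μ (x ∘ Equiv.swap (tgt A) (tgt B)) = minFunOff τ h A B μ x := by
  rw [minFunOff_congr τ h A B (μ' := μ ∘ Equiv.swap A B) (fun i hA hB => by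
    rw [Function.comp_apply, Equiv.swap_apply_of_ne_of_ne hA hB])]
  unfold minFunOff
  rw [← Equiv.prod_comp (Equiv.swap A B)]
  refine Finset.prod_congr rfl fun i _ => ?_
  refine Finset.prod_congr rfl fun j _ => ?_
  simp only [Finset.mem_product, swap_mem_pair, Function.comp_apply, swap_tgt_src, swap_tgt_tgt,
    Equiv.swap_apply_self]
  by_cases h1 : i ∈ ({A, B} : Finset (Fin r)) ∧ j ∈ ({A, B} : Finset (Fin r))
  · rw [if_pos h1, if_pos h1]
  · obtain ⟨e1, e2, e3, e4⟩ := swap_lt_iff hAB h1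
    simp only [if_neg h1, e3, e4]


/-- Outside of the square on `A, B` the minimal class is symmetric in the two sources and in the two
targets. On the square, clearing the denominators `ϑ(x_target / x_source)` leaves `delta_exchange`,
the sources being its lower and the targets its upper variables. -/
theorem wordStep_highLetter {τ : ℂ} (hτ : 0 < τ.im) (hAB : (B : ℕ) = A + 1) {h : ℂ}
    (hh : vtheta τ h ≠ 0) {μ : Fin r → ℂ} (hμ : ∀ i, vtheta τ (μ i) ≠ 0)
    (hμ' : ∀ i j, i ≠ j → vtheta τ (μ i - μ j) ≠ 0) :
    GenericEq τ (wordStep τ h (highLetter A B hAB) (nodeWeight h μ, minFun τ h μ))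
      (wordStep τ h (lowLetter A B hAB) (nodeWeight h (μ ∘ Equiv.swap A B),
        minFun τ h (μ ∘ Equiv.swap A B))) := by
  have hne : A ≠ B := fun e => by rw [e] at hAB; omega
  refine ⟨?_, fun x hx => ?_⟩
  · simp only [wordStep, simple_highLetter, simple_lowLetter, nodeWeight_comp_swap]
  · have hR : minFunOff τ h A B (μ ∘ Equiv.swap A B) x = minFunOff τ h A B μ x :=
      minFunOff_congr τ h A B (fun i hA hB => by
        rw [Function.comp_apply, Equiv.swap_apply_of_ne_of_ne hA hB]) x
    have key := delta_exchange hτ (y₁ := x (src A)) (y₂ := x (src B)) (Y₁ := x (tgt A))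
      (Y₂ := x (tgt B)) (D₁ := μ B) (D₂ := μ A) rfl hh (hμ' B A hne.symm)
      (hx _ _ (src_injective.ne hne.symm)) (hx _ _ (tgt_injective.ne hne.symm))
    simp only [wordStep, simple_highLetter, simple_lowLetter, nodeL_highLetter,
      nodeR_highLetter, nodeL_lowLetter, nodeR_lowLetter, nodeWeight_tgt, nodeWeight_src,
      minFun_eq hAB, minFunOff_swap_src hAB, minFunOff_swap_tgt hAB, hR, Function.comp_apply,
      swap_src_tgt, swap_tgt_src, Equiv.swap_apply_left, Equiv.swap_apply_right]
    have e1 : (r + 1) * h - μ A - ((r + 1) * h - μ B) = μ B - μ A := by ring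
    have e2 : μ B + (r - 1) * h - (μ A + (r - 1) * h) = μ B - μ A := by ring
    rw [e1, e2]
    have n11 := hx _ _ (tgt_ne_src A A)
    have n12 := hx _ _ (tgt_ne_src A B)
    have n21 := hx _ _ (tgt_ne_src B A)
    have n22 := hx _ _ (tgt_ne_src B B)
    have nA := hμ A
    have nB := hμ B
    simp only [delta_eq_vtheta τ (x (tgt _) - x (src _))]
    generalize delta τ (x (src B) - x (src A)) _ = d1 at *
    generalize delta τ (x (src A) - x (src B)) _ = d2 at *
    generalize delta τ (x (tgt B) - x (tgt A)) _ = d3 at *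
    generalize delta τ (x (tgt A) - x (tgt B)) _ = d4 at *
    generalize minFunOff τ h A B μ x = R at *
    generalize vtheta τ (x (tgt A) - x (src A)) = a11 at *
    generalize vtheta τ (x (tgt A) - x (src B)) = a12 at *
    generalize vtheta τ (x (tgt B) - x (src A)) = a21 at *
    generalize vtheta τ (x (tgt B) - x (src B)) = a22 at *
    generalize vtheta τ (μ A) = bA at *
    generalize vtheta τ (μ B) = bB at *
    generalize vtheta τ h = H at *
    field_simp
    linear_combination R * key

end letters

variable {m : ℕ}

theorem act_mul (σ : Equiv.Perm (Fin r)) (w w' : Equiv.Perm (Fin m)) (P : LinkPattern m r) :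
    P.act σ (w * w') = (P.act σ w').act 1 w := rfl

theorem act_highLetter {A B : Fin r} (hAB : (B : ℕ) = A + 1) (hr : 2 * r ≤ 2 * r + 1)
    (σ : Equiv.Perm (Fin r)) (w : Equiv.Perm (Fin (2 * r + 1))) :
    (minPattern hr).act σ (w * simple (highLetter A B hAB)) =
      (minPattern hr).act (σ * Equiv.swap A B) (w * simple (lowLetter A B hAB)) := by
  have e : ∀ k, (σ * Equiv.swap A B).symm k = Equiv.swap A B (σ.symm k) := fun k => rfl
  ext k
  · simp only [LinkPattern.act, minPattern_source, simple_highLetter, simple_lowLetter, e,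
      Equiv.Perm.mul_apply, swap_src_src, swap_tgt_src]
  · simp only [LinkPattern.act, minPattern_target, simple_highLetter, simple_lowLetter, e,
      Equiv.Perm.mul_apply, swap_src_tgt, swap_tgt_tgt, Equiv.swap_apply_self]

/-- The simple transpositions of the first `r + 1` nodes. -/
def lowEmb (i : Fin r) : Fin (2 * r + 1 - 1) := ⟨i, by omega⟩

/-- Words without the letter `r` reduce to words in the first `r` letters. -/
theorem exists_lowEmb_word (hr : 2 * r ≤ 2 * r + 1) (L : List (Fin (2 * r + 1 - 1)))
    (hL : ∀ i ∈ L, (i : ℕ) ≠ r) (σ : Equiv.Perm (Fin r)) :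
    ∃ (σ' : Equiv.Perm (Fin r)) (K : List (Fin r)), K.length = L.length ∧
      (minPattern hr).act σ (wordPerm L) = (minPattern hr).act σ' (wordPerm (K.map lowEmb)) ∧
      ∀ (τ : ℂ) (h : ℂ) (μ : Fin r → ℂ), 0 < τ.im → vtheta τ h ≠ 0 →
        (∀ i, vtheta τ (μ i) ≠ 0) → (∀ i j, i ≠ j → vtheta τ (μ i - μ j) ≠ 0) →
        GenericEq τ (wordEval τ h L (nodeWeight h (μ ∘ σ), minFun τ h (μ ∘ σ)))
          (wordEval τ h (K.map lowEmb) (nodeWeight h (μ ∘ σ'), minFun τ h (μ ∘ σ'))) := by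
  induction L with
  | nil => exact ⟨σ, [], rfl, rfl, fun τ h μ _ _ _ _ => GenericEq.refl τ _⟩
  | cons i L ih =>
    obtain ⟨σ', K, hlen, hact, hev⟩ := ih fun j hj => hL j (List.mem_cons_of_mem _ hj)
    have hi := hL i List.mem_cons_self
    rcases lt_or_gt_of_ne hi with hi | hi
    · have e : (⟨i, hi⟩ :: K : List (Fin r)).map lowEmb = i :: K.map lowEmb := rfl
      refine ⟨σ', ⟨i, hi⟩ :: K, by simp [hlen], ?_, fun τ h μ hτ hh hμ hμ' => ?_⟩
      · rw [e, wordPerm_cons, wordPerm_cons, act_mul, act_mul, hact]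
      · rw [e, wordEval_cons, wordEval_cons]
        exact (hev τ h μ hτ hh hμ hμ').wordStep h i
    · have hi2 := i.2
      obtain ⟨A, B, hAB, rfl⟩ : ∃ A B : Fin r, ∃ hAB : (B : ℕ) = A + 1,
          i = highLetter A B hAB :=
        ⟨⟨i - (r + 1), by omega⟩, ⟨i - (r + 1) + 1, by omega⟩, rfl, by
          simp only [highLetter, Fin.ext_iff]; omega⟩
      -- A letter moving sources is not a neighbour of any letter in `K.map lowEmb`, so it commutes
      -- past all of them and acts directly on the minimal class, where it can be traded.
      have hfar : ∀ j ∈ K.map lowEmb, Far (highLetter A B hAB) j := by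
        intro j hj
        obtain ⟨k, -, rfl⟩ := List.mem_map.1 hj
        right
        simp only [lowEmb, highLetter]
        omega
      have e : (K ++ [A]).map lowEmb = K.map lowEmb ++ [lowLetter A B hAB] := by
        rw [List.map_append]; rfl
      refine ⟨σ' * Equiv.swap A B, K ++ [A], by simp [hlen], ?_, fun τ h μ hτ hh hμ hμ' => ?_⟩
      · rw [wordPerm_cons, act_mul, hact, ← act_mul, ← wordPerm_cons, wordPerm_cons_of_far hfar,
          e, wordPerm_append, wordPerm_append, wordPerm_cons, wordPerm_cons]
        exact act_highLetter hAB hr σ' _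
      · rw [wordEval_cons]
        refine ((hev τ h μ hτ hh hμ hμ').wordStep h _).trans ?_
        rw [← wordEval_cons, wordEval_cons_of_far hfar, e, wordEval_append, wordEval_append]
        refine GenericEq.wordEval ?_ h _
        exact wordStep_highLetter hτ hAB hh (μ := μ ∘ σ') (fun i => hμ _)
          fun i j hij => hμ' _ _ (σ'.injective.ne hij)

end rectangle

end EllipticLink
end

/-! ### Comparison of the recursions on words in the first `n` nodes. -/

noncomputable section
namespace EllipticLink

section lowWords

variable {r : ℕ}

/-- The permutation of the first `r + 1` nodes given by a word. -/
def lowPerm (K : List (Fin r)) : Equiv.Perm (Fin (r + 1)) :=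
  (K.map fun i => Equiv.swap i.castSucc i.succ).prod

theorem lowPerm_cons (i : Fin r) (K : List (Fin r)) :
    lowPerm (i :: K) = Equiv.swap i.castSucc i.succ * lowPerm K := by
  simp [lowPerm]

/-- The first `r + 1` nodes. -/
def lowNode (v : Fin (r + 1)) : Fin (2 * r + 1) := ⟨v, by omega⟩

theorem lowNode_injective : Function.Injective (lowNode (r := r)) := fun v w h => by
  simpa [lowNode, Fin.ext_iff] using h

theorem lowNode_ne_src (v : Fin (r + 1)) (k : Fin r) : lowNode v ≠ src k := by
  simp only [lowNode, src, Ne, Fin.ext_iff]; omega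

theorem lowNode_castSucc (k : Fin r) : lowNode k.castSucc = tgt k := rfl

theorem lowNode_or_src (v : Fin (2 * r + 1)) : (∃ i, v = lowNode i) ∨ ∃ k, v = src k := by
  rcases lt_or_ge (v : ℕ) (r + 1) with hv | hv
  · exact Or.inl ⟨⟨v, hv⟩, rfl⟩
  · exact Or.inr ⟨⟨v - (r + 1), by omega⟩, by simp only [src, Fin.ext_iff]; omega⟩

theorem nodeL_lowEmb (i : Fin r) : nodeL (lowEmb i) = lowNode i.castSucc := rfl

theorem nodeR_lowEmb (i : Fin r) : nodeR (lowEmb i) = lowNode i.succ := rfl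

theorem simple_lowEmb (i : Fin r) :
    simple (lowEmb i) = Equiv.swap (lowNode i.castSucc) (lowNode i.succ) := rfl

theorem wordPerm_lowEmb_lowNode (K : List (Fin r)) (v : Fin (r + 1)) :
    wordPerm (K.map lowEmb) (lowNode v) = lowNode (lowPerm K v) := by
  induction K with
  | nil => simp [wordPerm, lowPerm]
  | cons i K ih =>
    rw [List.map_cons, wordPerm_cons, lowPerm_cons, Equiv.Perm.mul_apply, Equiv.Perm.mul_apply, ih,
      simple_lowEmb, lowNode_injective.swap_apply]

theorem wordPerm_lowEmb_src (K : List (Fin r)) (k : Fin r) :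
    wordPerm (K.map lowEmb) (src k) = src k := by
  induction K with
  | nil => simp [wordPerm]
  | cons i K ih =>
    rw [List.map_cons, wordPerm_cons, Equiv.Perm.mul_apply, ih, simple_lowEmb,
      Equiv.swap_apply_of_ne_of_ne (lowNode_ne_src _ _).symm (lowNode_ne_src _ _).symm]

theorem wordPerm_lowEmb_symm (K : List (Fin r)) (v : Fin (r + 1)) :
    (wordPerm (K.map lowEmb)).symm (lowNode v) = lowNode ((lowPerm K).symm v) := by
  rw [Equiv.symm_apply_eq, wordPerm_lowEmb_lowNode, Equiv.apply_symm_apply]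

theorem wordEval_fst {m : ℕ} (τ h : ℂ) (L : List (Fin (m - 1)))
    (S : (Fin m → ℂ) × ((Fin m → ℂ) → ℂ)) (v : Fin m) :
    (wordEval τ h L S).1 v = S.1 ((wordPerm L).symm v) := by
  induction L generalizing v with
  | nil => rfl
  | cons i L ih =>
    rw [wordEval_cons, wordStep, wordPerm_cons]
    simp only [Function.comp_apply, ih]
    rfl

/-- The point `(z, γ)`. -/
def joinPoint (z : Fin (r + 1) → ℂ) (γ : Fin r → ℂ) (v : Fin (2 * r + 1)) : ℂ :=
  if hv : (v : ℕ) < r + 1 then z ⟨v, hv⟩ else γ ⟨v - (r + 1), by omega⟩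

theorem joinPoint_lowNode (z : Fin (r + 1) → ℂ) (γ : Fin r → ℂ) (v : Fin (r + 1)) :
    joinPoint z γ (lowNode v) = z v := by
  have : ((lowNode v : Fin (2 * r + 1)) : ℕ) = v := rfl
  rw [joinPoint, dif_pos (by omega)]
  rfl

theorem joinPoint_src (z : Fin (r + 1) → ℂ) (γ : Fin r → ℂ) (k : Fin r) :
    joinPoint z γ (src k) = γ k := by
  have : ((src k : Fin (2 * r + 1)) : ℕ) = r + 1 + k := rfl
  rw [joinPoint, dif_neg (by omega)]
  congr 1
  ext
  simp [this]

theorem joinPoint_comp_simple (z : Fin (r + 1) → ℂ) (γ : Fin r → ℂ) (i : Fin r) :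
    joinPoint z γ ∘ simple (lowEmb i) = joinPoint (z ∘ Equiv.swap i.castSucc i.succ) γ := by
  funext v
  rw [Function.comp_apply, simple_lowEmb]
  rcases lowNode_or_src v with ⟨v, rfl⟩ | ⟨k, rfl⟩
  · rw [lowNode_injective.swap_apply, joinPoint_lowNode, joinPoint_lowNode, Function.comp_apply]
  · rw [Equiv.swap_apply_of_ne_of_ne (lowNode_ne_src _ _).symm (lowNode_ne_src _ _).symm,
      joinPoint_src, joinPoint_src]

theorem generic_joinPoint {τ : ℂ} {z : Fin (r + 1) → ℂ} {γ : Fin r → ℂ}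
    (hzγ : ∀ i j, vtheta τ (z i - γ j) ≠ 0) (hz : ∀ i j, i ≠ j → vtheta τ (z i - z j) ≠ 0)
    (hγ : ∀ i j, i ≠ j → vtheta τ (γ i - γ j) ≠ 0) : Generic τ (joinPoint z γ) := by
  intro a b hab
  rcases lowNode_or_src a with ⟨a, rfl⟩ | ⟨a, rfl⟩ <;>
    rcases lowNode_or_src b with ⟨b, rfl⟩ | ⟨b, rfl⟩
  · rw [joinPoint_lowNode, joinPoint_lowNode]
    exact hz _ _ fun e => hab (by rw [e])
  · rw [joinPoint_lowNode, joinPoint_src]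
    exact hzγ _ _
  · rw [joinPoint_lowNode, joinPoint_src, ← neg_sub, vtheta_neg, neg_ne_zero]
    exact hzγ _ _
  · rw [joinPoint_src, joinPoint_src]
    exact hγ _ _ fun e => hab (by rw [e])

theorem eulerM_comp_perm (τ : ℂ) (z : Fin (r + 1) → ℂ) (γ : Fin r → ℂ)
    (w : Equiv.Perm (Fin (r + 1))) : eulerM τ (z ∘ w) γ = eulerM τ z γ :=
  Equiv.prod_comp w fun i => ∏ j, vtheta τ (z i - γ j)

/-- The class of the minimal pattern and the weight function of the identity. -/
theorem minFun_mul_eulerM {τ h : ℂ} {z : Fin (r + 1) → ℂ} {γ : Fin r → ℂ} {μ : Fin (r + 1) → ℂ}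
    (hh : vtheta τ h ≠ 0) (hzγ : ∀ i j, vtheta τ (z i - γ j) ≠ 0)
    (hγ : ∀ i j, i ≠ j → vtheta τ (γ i - γ j) ≠ 0 ∧ vtheta τ (h + γ i - γ j) ≠ 0)
    (hμ : ∀ i j, i < j → vtheta τ (h + μ j - μ i) ≠ 0) :
    minFun τ h (fun k => h + μ (Fin.last r) - μ k.castSucc) (joinPoint z γ) * eulerM τ z γ /
      chernB τ h γ = weightFunction τ h z γ μ 1 := by
  rw [weightFunction_one hh hγ hμ, minFun, eulerM, Finset.prod_comm,
    Finset.prod_comm (s := Finset.univ (α := Fin (r + 1))), ← Finset.prod_mul_distrib]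
  congr 1
  refine Finset.prod_congr rfl fun j _ => ?_
  rw [Fin.prod_univ_castSucc, Fin.prod_univ_castSucc, ← mul_assoc, ← Finset.prod_mul_distrib]
  congr 1
  · refine Finset.prod_congr rfl fun i _ => ?_
    rw [← lowNode_castSucc, joinPoint_lowNode, joinPoint_src]
    have h1 := hzγ i.castSucc j
    simp only [Fin.val_castSucc, Fin.lt_def, Fin.ext_iff]
    rcases lt_trichotomy (i : ℕ) j with hij | hij | hij
    · rw [if_neg hij.ne, if_pos hij, if_pos hij, delta_eq_vtheta]
      field_simp
    · obtain rfl := Fin.ext hij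
      have h2 := hμ i.castSucc (Fin.last r) (Fin.castSucc_lt_last i)
      simp only [lt_irrefl, if_true, if_false, delta_eq_vtheta]
      field_simp
    · rw [if_neg hij.ne', if_neg hij.not_gt, if_neg hij.not_gt, if_neg hij.ne', one_mul]
  · have hj := j.2
    simp only [Fin.val_last]
    rw [if_neg (by omega), if_neg (by omega)]

/-- One letter on the side of classes is one use of `weightFunction_swap`: the coefficients agree,
the Euler class is symmetric in `z`, and the Chern class does not involve `z`. -/
theorem wordEval_mul_eulerM {τ h : ℂ} (hτ : 0 < τ.im) {γ : Fin r → ℂ} {μ : Fin (r + 1) → ℂ}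
    (hh : vtheta τ h ≠ 0)
    (hγ : ∀ i j, i ≠ j → vtheta τ (γ i - γ j) ≠ 0 ∧ vtheta τ (h + γ i - γ j) ≠ 0)
    (hμ : ∀ i j, i < j → vtheta τ (μ j - μ i) ≠ 0 ∧ vtheta τ (h + μ j - μ i) ≠ 0)
    {K : List (Fin r)} (hK : Ascending (K.map lowEmb)) (z : Fin (r + 1) → ℂ)
    (hzγ : ∀ i j, vtheta τ (z i - γ j) ≠ 0) (hz : ∀ i j, i ≠ j → vtheta τ (z i - z j) ≠ 0) :
    (wordEval τ h (K.map lowEmb)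
      (nodeWeight h fun k => h + μ (Fin.last r) - μ k.castSucc,
        minFun τ h fun k => h + μ (Fin.last r) - μ k.castSucc)).2 (joinPoint z γ) *
      eulerM τ z γ / chernB τ h γ = weightFunction τ h z γ μ (lowPerm K) := by
  induction K generalizing z with
  | nil => exact minFun_mul_eulerM hh hzγ hγ fun i j hij => (hμ i j hij).2
  | cons i K ih =>
    -- The letter creates an inversion, which is the order of positions under which the recursion of
    -- weight functions holds.
    have hi : (lowPerm K).symm i.castSucc < (lowPerm K).symm i.succ := by
      have := hK.1
      rwa [nodeL_lowEmb, nodeR_lowEmb, wordPerm_lowEmb_symm, wordPerm_lowEmb_symm] at this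
    -- The substitution `h μ_n / μ_j` is what makes this formula uniform: the free node of weight `r
    -- h` is covered by `j = n`, and the differences of weights are differences of the original `μ`.
    have hW : ∀ v : Fin (r + 1), (wordEval τ h (K.map lowEmb)
        (nodeWeight h fun k => h + μ (Fin.last r) - μ k.castSucc,
          minFun τ h fun k => h + μ (Fin.last r) - μ k.castSucc)).1 (lowNode v) =
        r * h + μ (Fin.last r) - μ ((lowPerm K).symm v) := fun v => by
      rw [wordEval_fst, wordPerm_lowEmb_symm]
      dsimp only
      induction (lowPerm K).symm v using Fin.lastCases with
      | last => rw [nodeWeight_of_eq h _ (rfl : ((lowNode (Fin.last r) : Fin (2 * r + 1)) : ℕ) = r)]; ring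
      | cast k => rw [lowNode_castSucc, nodeWeight_tgt]; ring
    rw [lowPerm_cons, weightFunction_swap hτ _ _ hi hh hz (fun i j hij => (hγ i j hij).1) hμ,
      ← ih hK.2 z hzγ hz, ← ih hK.2 (z ∘ Equiv.swap i.castSucc i.succ) (fun _ _ => hzγ _ _)
        fun a b hab => hz _ _ ((Equiv.injective _).ne hab), eulerM_comp_perm]
    rw [List.map_cons, wordEval_cons, wordStep]
    simp only [nodeL_lowEmb, nodeR_lowEmb, joinPoint_lowNode, hW, joinPoint_comp_simple]
    rw [show r * h + μ (Fin.last r) - μ ((lowPerm K).symm i.castSucc) -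
      (r * h + μ (Fin.last r) - μ ((lowPerm K).symm i.succ)) =
      μ ((lowPerm K).symm i.succ) - μ ((lowPerm K).symm i.castSucc) by ring]
    ring

end lowWords

end EllipticLink
end

/-! ### Existence of the classes, and patterns in the rectangle. -/

noncomputable section
namespace EllipticLink

section classes

variable {r : ℕ}

theorem presents_iff {m : ℕ} (hr : 2 * r ≤ m) (σ : Equiv.Perm (Fin r)) (L : List (Fin (m - 1)))
    (P : LinkPattern m r) : Presents hr σ L P ↔ P = (minPattern hr).act σ (wordPerm L) := Iff.rfl

theorem minClass_ne_nil {m : ℕ} (hr : 2 * r ≤ m) : minClass hr ≠ [] := List.cons_ne_nil _ _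

theorem xfree_minClass_u {m : ℕ} : XFree (∑ i, (char (.mu i) + ∑ j, if i < j then char .h else 0) :
    Character m r) := xfree_sum fun i _ => xfree_mu_add i _

theorem exists_wordPerm (w : Equiv.Perm (Fin (2 * r + 1))) :
    ∃ L : List (Fin (2 * r + 1 - 1)), wordPerm L = w := by
  have hw : w ∈ Submonoid.closure (Set.range fun i : Fin (2 * r) =>
      Equiv.swap i.castSucc i.succ) := by
    rw [Equiv.Perm.mclosure_swap_castSucc_succ]; trivial
  induction hw using Submonoid.closure_induction with
  | mem x hx =>
    obtain ⟨i, rfl⟩ := hx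
    exact ⟨[i], by rw [wordPerm, List.map_singleton, List.prod_singleton]; rfl⟩
  | one => exact ⟨[], rfl⟩
  | mul x y _ _ hx hy =>
    obtain ⟨L, rfl⟩ := hx
    obtain ⟨L', rfl⟩ := hy
    exact ⟨L ++ L', wordPerm_append L L'⟩

theorem exists_presents (hr : 2 * r ≤ 2 * r + 1) (P : LinkPattern (2 * r + 1) r) :
    ∃ L, Presents hr 1 L P := by
  obtain ⟨w, hw⟩ := Equiv.Perm.exists_extending_pair _ _ (minPattern hr).injective P.injective
  obtain ⟨L, rfl⟩ := exists_wordPerm w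
  refine ⟨L, ?_⟩
  rw [presents_iff]
  ext k
  · exact congrArg Fin.val (hw (.inl k)).symm
  · exact congrArg Fin.val (hw (.inr k)).symm

theorem exists_isEllipticClass (τ : ℂ) (hr : 2 * r ≤ 2 * r + 1)
    (P : LinkPattern (2 * r + 1) r) : ∃ f, IsEllipticClass τ hr P f := by
  classical
  have hex : ∃ n, ∃ σ L, Presents hr σ L P ∧ L.length = n := by
    obtain ⟨L, hL⟩ := exists_presents hr P
    exact ⟨_, 1, L, hL, rfl⟩
  obtain ⟨σ, L, hL, hlen⟩ := Nat.find_spec hex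
  obtain ⟨F, hF⟩ := exists_diamond xfree_minClass_u (xfree_minWeight hr) (minClass_ne_nil hr)
    (type_minClass hr) L
  exact ⟨_, σ, L, F, hL, fun σ' L' h' => hlen ▸ Nat.find_min' hex ⟨σ', L', h', rfl⟩, hF, rfl⟩

theorem eval_diamond_minClass {hr : 2 * r ≤ 2 * r + 1} {L : List (Fin (2 * r + 1 - 1))}
    {F : Combination (2 * r + 1) r} (hF : Diamond (minClass hr) L F) (τ : ℂ)
    (p : Point (2 * r + 1) r) (hu : p .u = 0) :
    F.eval τ p = (wordEval τ (p .h) L (nodeWeight (p .h) fun i => p (.mu i),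
      minFun τ (p .h) fun i => p (.mu i))).2 fun v => p (.x v) := by
  obtain ⟨-, ℓ', -, -, hev⟩ := hF.eval_eq xfree_minClass_u (xfree_minWeight hr)
    (minClass_ne_nil hr) (type_minClass hr) τ
  have h := congrArg Prod.snd (hev p)
  simp only [Prod.map_snd, eval_minWeight, eval_minClass hr τ p hu] at h
  exact h

/-- The nodes of the two blocks are not mixed by a minimal presentation. -/
theorem ne_of_mem_of_ascending {hr : 2 * r ≤ 2 * r + 1} {σ : Equiv.Perm (Fin r)}
    {L : List (Fin (2 * r + 1 - 1))} (hA : Ascending L)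
    (hP : ∀ k, r + 1 ≤ (((minPattern hr).act σ (wordPerm L)).source k : ℕ)) :
    ∀ i ∈ L, (i : ℕ) ≠ r := by
  intro i hi hir
  obtain ⟨a, b, ha, hb, hlt⟩ := hA.exists_inversion ⟨i, hi, hir⟩
  have hsrc : ∀ k, r < (wordPerm L (src k) : ℕ) := fun k => by
    have := hP (σ k)
    simp only [LinkPattern.act, Equiv.symm_apply_apply, minPattern_source] at this
    exact this
  have hS : ∀ v : Fin (2 * r + 1), r < (v : ℕ) → r < (wordPerm L v : ℕ) := fun v hv => by
    rcases lowNode_or_src v with ⟨v, rfl⟩ | ⟨k, rfl⟩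
    · simp only [lowNode] at hv; omega
    · exact hsrc k
  -- The last nodes are exactly the sources, so the permutation maps them onto themselves. The
  -- letter `r` would give an inversion across the blocks, forcing a node `a` of the first block
  -- into the second.
  let S : Finset (Fin (2 * r + 1)) := Finset.univ.filter fun v => r < (v : ℕ)
  have hmap : S.map (wordPerm L).toEmbedding = S := by
    refine Finset.eq_of_subset_of_card_le (fun v hv => ?_) (by simp)
    obtain ⟨c, hc, rfl⟩ := Finset.mem_map.1 hv
    exact Finset.mem_filter.2 ⟨Finset.mem_univ _, hS c (Finset.mem_filter.1 hc).2⟩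
  have haS : wordPerm L a ∈ S := by
    have := hS b hb
    rw [Fin.lt_def] at hlt
    exact Finset.mem_filter.2 ⟨Finset.mem_univ _, by omega⟩
  rw [← hmap] at haS
  obtain ⟨c, hc, hca⟩ := Finset.mem_map.1 haS
  rw [Equiv.coe_toEmbedding, (wordPerm L).injective.eq_iff] at hca
  have := (Finset.mem_filter.1 hc).2
  rw [hca] at this
  omega

/-- The arrows prescribe all values of `ω` except the last, which is then forced; hence `ω` does not
depend on the chosen presentation. -/
theorem eq_of_apply_castSucc {ω ω' : Equiv.Perm (Fin (r + 1))}
    (h : ∀ k : Fin r, ω k.castSucc = ω' k.castSucc) : ω = ω' := by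
  have hs : ∀ v, (ω'.symm * ω) v = v := by
    have hc : ∀ k : Fin r, (ω'.symm * ω) k.castSucc = k.castSucc := fun k => by
      rw [Equiv.Perm.mul_apply, h, Equiv.symm_apply_apply]
    intro v
    induction v using Fin.lastCases with
    | cast k => exact hc k
    | last =>
      obtain ⟨k, hk⟩ | hk := Fin.eq_castSucc_or_eq_last ((ω'.symm * ω) (Fin.last r))
      · rw [← hc k, (ω'.symm * ω).injective.eq_iff] at hk
        exact absurd hk (Fin.castSucc_lt_last k).ne'
      · exact hk
  ext v
  have := hs v
  rw [Equiv.Perm.mul_apply, Equiv.symm_apply_eq] at this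
  rw [this]

theorem sourceIndex_bijective (P : LinkPattern (2 * r + 1) r)
    (hP : ∀ k, r + 1 ≤ (P.source k : ℕ)) : Function.Bijective (sourceIndex P hP) := by
  refine Finite.injective_iff_bijective.1 fun k l hkl => ?_
  have h1 := hP k
  have h2 := hP l
  simp only [sourceIndex, Fin.ext_iff] at hkl
  have : P.source k = P.source l := by ext; omega
  exact Sum.inl_injective (P.injective (a₁ := .inl k) (a₂ := .inl l) this)

/-- The localized class of a pattern in the rectangle is a weight function. -/
theorem exists_weightFunction_of_isEllipticClass {τ : ℂ} (hτ : 0 < τ.im)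
    {hr : 2 * r ≤ 2 * r + 1} {P : LinkPattern (2 * r + 1) r}
    (hP : ∀ k, r + 1 ≤ (P.source k : ℕ)) {f : Point (2 * r + 1) r → ℂ}
    (hf : IsEllipticClass τ hr P f) :
    ∃ ω : Equiv.Perm (Fin (r + 1)),
      (∀ k, (P.target k : ℕ) = (ω (sourceIndex P hP k).castSucc : ℕ)) ∧
      ∀ (z : Fin (r + 1) → ℂ) (γ : Fin r → ℂ) (μ : Fin (r + 1) → ℂ) (h : ℂ),
        vtheta τ h ≠ 0 →
        (∀ i j, vtheta τ (z i - γ j) ≠ 0) →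
        (∀ i j, i ≠ j → vtheta τ (z i - z j) ≠ 0) →
        (∀ i j, i ≠ j → vtheta τ (γ i - γ j) ≠ 0 ∧ vtheta τ (h + γ i - γ j) ≠ 0) →
        (∀ i j, i < j → vtheta τ (μ j - μ i) ≠ 0 ∧ vtheta τ (h + μ j - μ i) ≠ 0) →
        f (substitution h z γ μ P hP) * eulerM τ z γ / chernB τ h γ =
          weightFunction τ h z γ μ ω := by
  obtain ⟨σ, L, F, hL, hmin, hF, rfl⟩ := hf
  rw [presents_iff] at hL
  have hA : Ascending L := ascending_of_length_le L fun L' hL' => hmin σ L' (by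
    rw [presents_iff, hL', hL])
  have hr' : ∀ i ∈ L, (i : ℕ) ≠ r := ne_of_mem_of_ascending hA (by rwa [← hL])
  obtain ⟨σ', K, hlen, hact, hev⟩ := exists_lowEmb_word hr L hr' σ
  -- The reduced word presents the same pattern with other labels and has the same length.
  -- Minimality was over all label permutations, so this word is minimal too.
  have hK : Ascending (K.map lowEmb) := ascending_of_length_le _ fun L' hL' => by
    rw [List.length_map, hlen]
    exact hmin σ' L' (by rw [presents_iff, hL', ← hact, hL])
  rw [hact] at hL
  have hsource : ∀ k, P.source (σ' k) = src k := fun k => by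
    rw [hL]
    simp only [LinkPattern.act, Equiv.symm_apply_apply, minPattern_source, wordPerm_lowEmb_src]
  have htarget : ∀ k, P.target (σ' k) = lowNode (lowPerm K k.castSucc) := fun k => by
    rw [hL]
    simp only [LinkPattern.act, Equiv.symm_apply_apply, minPattern_target, ← lowNode_castSucc,
      wordPerm_lowEmb_lowNode]
  have hindex : ∀ k, sourceIndex P hP (σ' k) = k := fun k => by
    ext
    simp only [sourceIndex, hsource, src]
    omega
  refine ⟨lowPerm K, fun k => ?_, fun z γ μ h hh hzγ hz hγ hμ => ?_⟩
  · obtain ⟨k, rfl⟩ := σ'.surjective k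
    rw [htarget, hindex]
    rfl
  · have hx := generic_joinPoint hzγ hz fun i j hij => (hγ i j hij).1
    rw [← wordEval_mul_eulerM hτ hh hγ hμ hK z hzγ hz]
    have h0 := eval_diamond_minClass hF τ
      (fun v => substitution h z γ μ P hP (permMu σ v)) rfl
    refine congrArg (fun c => c * eulerM τ z γ / chernB τ h γ) (h0.trans ?_)
    have h1 := (hev τ h (fun k => substitution h z γ μ P hP (.mu k)) hτ hh (fun k => ?_)
      fun i j hij => ?_).2 _ hx
    -- The label permutation `σ'` sorts the arrows by their sources, so the substituted variables
    -- appear in their natural order.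
    · have e : ((fun k => substitution h z γ μ P hP (.mu k)) ∘ σ') =
          fun k => h + μ (Fin.last r) - μ k.castSucc := by
        funext k
        simp only [Function.comp_apply, substitution, hindex]
      rw [e] at h1
      exact h1
    · have := (hμ (sourceIndex P hP k).castSucc (Fin.last r) (Fin.castSucc_lt_last _)).2
      exact this
    · have hne : sourceIndex P hP i ≠ sourceIndex P hP j :=
        (sourceIndex_bijective P hP).1.ne hij
      simp only [substitution]
      rw [show h + μ (Fin.last r) - μ (sourceIndex P hP i).castSucc -
        (h + μ (Fin.last r) - μ (sourceIndex P hP j).castSucc) =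
        μ (sourceIndex P hP j).castSucc - μ (sourceIndex P hP i).castSucc by ring]
      rcases lt_or_gt_of_ne hne with hlt | hlt
      · exact (hμ _ _ (Fin.castSucc_lt_castSucc_iff.2 hlt)).1
      · rw [← neg_sub, vtheta_neg, neg_ne_zero]
        exact (hμ _ _ (Fin.castSucc_lt_castSucc_iff.2 hlt)).1

end classes

end EllipticLink
end

theorem mainTheorem7 (τ : ℂ) (hτ : 0 < τ.im) (r : ℕ)
    (P : LinkPattern (2 * r + 1) r) (hP : ∀ k, r + 1 ≤ (P.source k : ℕ)) :
    ∃ ω : Equiv.Perm (Fin (r + 1)),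
      (∀ k, (P.target k : ℕ) = (ω (sourceIndex P hP k).castSucc : ℕ)) ∧
      (∃ f, IsEllipticClass τ (by omega : 2 * r ≤ 2 * r + 1) P f) ∧
      ∀ f, IsEllipticClass τ (by omega : 2 * r ≤ 2 * r + 1) P f →
        ∀ (z : Fin (r + 1) → ℂ) (γ : Fin r → ℂ) (μ : Fin (r + 1) → ℂ) (h : ℂ),
          vtheta τ h ≠ 0 →
          (∀ i j, vtheta τ (z i - γ j) ≠ 0) →
          (∀ i j, i ≠ j → vtheta τ (z i - z j) ≠ 0) →
          (∀ i j, i ≠ j → vtheta τ (γ i - γ j) ≠ 0 ∧ vtheta τ (h + γ i - γ j) ≠ 0) →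
          (∀ i j, i < j → vtheta τ (μ j - μ i) ≠ 0 ∧ vtheta τ (h + μ j - μ i) ≠ 0) →
          f (substitution h z γ μ P hP) * eulerM τ z γ / chernB τ h γ =
            weightFunction τ h z γ μ ω := by
  obtain ⟨f₀, hf₀⟩ := exists_isEllipticClass τ (by omega : 2 * r ≤ 2 * r + 1) P
  obtain ⟨ω, hω, -⟩ := exists_weightFunction_of_isEllipticClass hτ hP hf₀
  refine ⟨ω, hω, ⟨f₀, hf₀⟩, fun f hf => ?_⟩
  obtain ⟨ω', hω', h⟩ := exists_weightFunction_of_isEllipticClass hτ hP hf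
  have : ω = ω' := eq_of_apply_castSucc fun k => by
    obtain ⟨k, rfl⟩ := (sourceIndex_bijective P hP).2 k
    exact Fin.ext ((hω k).symm.trans (hω' k))
  rwa [this]
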